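/- Let $q\in C^\infty([0,\infty))$ be real-valued and let $L_0$ be the operator in the complex Hilbert space $\mathcal H=L_2(0,\infty)$ given by $L_0y=-y''+qy$ on $$\mathrm{Dom}\,L_0=\{y\in\mathcal H\cap H^2_{\rm loc}([0,\infty))\;:\;y(0)=y'(0)=0,\ -y''+qy\in\mathcal H\}.$$ Assume that the limit point case takes place at infinity and that $L_0$ is positive definite, i.e. for some $\varkappa>0$ one has $(L_0y,y)\ge\varkappa\|y\|^2$ for all $y\in\mathrm{Dom}\,L_0$. Let $L$ be the Friedrichs extension of $L_0$, $\mathcal K=\mathrm{Ker}\,L_0^*$ and $\Gamma_1=L^{-1}L_0^*-I$ on $\mathrm{Dom}\,L_0^*$. Let $\mathcal M$ be the set of controls $h\in C^\infty([0,\infty);\mathcal K)$ with $\mathrm{supp}\,h\subset(0,\infty)$. For $h\in\mathcal M$ let $u^h$ be the classical ($\mathcal H$-valued) solution of $$u_{tt}+L_0^*u=0,\ t>0;\qquad u|_{t=0}=u_t|_{t=0}=0;\qquad \Gamma_1u=h,\ t\ge0 .$$ Put $\mathcal U^T=\{u^h(T): h\in\mathcal M\}$ and $\mathcal U=\bigcup_{T>0}\mathcal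 U^T$. Then for every $h\in\mathcal M$ the solution $u^h$ exists, is unique and belongs to $C^\infty([0,\infty);\mathcal H)$, and, functions being identified with elements of $\mathcal H$: (a) $\mathcal U^T=\{y\in C^\infty([0,\infty)):\mathrm{supp}\,y\subset[0,T)\}$ for every $T>0$; (b) $\mathcal U=\{y\in C^\infty([0,\infty)):\mathrm{supp}\,y\text{ is bounded}\}$; (c) hence the system is controllable, that is, $\overline{\mathcal U}=\mathcal H$. -/

import Mathlib

open Set Filter Topology MeasureTheory
open scoped ContDiff

/-! ### The dynamical system with boundary control of a positive definite operator

`A` is a densely defined operator in a complex Hilbert space `E`; `A.adjoint` is its adjoint. -/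

/-- `A` is positive definite: for some `κ > 0` one has `(A y, y) ≥ κ ‖y‖²` on `Dom A`
(in particular the quadratic form `(A y, y)` is real). -/
def IsPositiveDefinite {E : Type*} [NormedAddCommGroup E] [InnerProductSpace ℂ E]
    (A : E →ₗ.[ℂ] E) : Prop :=
  ∃ κ : ℝ, 0 < κ ∧ ∀ y : A.domain,
    (inner ℂ (y : E) (A y)).im = 0 ∧ κ * ‖(y : E)‖ ^ 2 ≤ (inner ℂ (y : E) (A y)).re

/-- The subspace `K = Ker A*`. -/
def defectSpace {E : Type*} [NormedAddCommGroup E] [InnerProductSpace ℂ E] [CompleteSpace E]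
    (A : E →ₗ.[ℂ] E) : Set E :=
  {y | (y, (0 : E)) ∈ A.adjoint.graph}

/-- The graph of the Friedrichs extension `L` of `A`: the restriction of `A*` to those `y ∈ Dom A*`
that belong to the completion of `Dom A` in the energy norm, that is, are limits in `E` of sequences
from `Dom A` that are Cauchy with respect to the quadratic form `(A y, y)`. -/
def friedrichsGraph {E : Type*} [NormedAddCommGroup E] [InnerProductSpace ℂ E] [CompleteSpace E]
    (A : E →ₗ.[ℂ] E) : Set (E × E) :=
  {p | p ∈ A.adjoint.graph ∧ ∃ s : ℕ → A.domain,
    Tendsto (fun n => (s n : E)) atTop (𝓝 p.1) ∧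
    Tendsto (fun k : ℕ × ℕ => inner ℂ ((s k.1 - s k.2 : A.domain) : E) (A (s k.1 - s k.2)))
      atTop (𝓝 0)}

/-- The graph of the boundary operator `Γ₁ = L⁻¹ A* - I`: the pairs `(y, h)` such that
`y ∈ Dom A*` and `h = L⁻¹ (A* y) - y`. -/
def gammaOneGraph {E : Type*} [NormedAddCommGroup E] [InnerProductSpace ℂ E] [CompleteSpace E]
    (A : E →ₗ.[ℂ] E) : Set (E × E) :=
  {p | ∃ w v : E, (p.1, w) ∈ A.adjoint.graph ∧ (v, w) ∈ friedrichsGraph A ∧ p.2 = v - p.1}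

/-- The support, as a subset of `[0, ∞)`, of a function on `[0, ∞)`; here and below only the values
on `[0, ∞)` of a function on `ℝ` that represents a function on `[0, ∞)` matter. -/
def halfLineSupport {F : Type*} [Zero F] (g : ℝ → F) : Set ℝ :=
  closure {x | 0 ≤ x ∧ g x ≠ 0}

/-- The class of smooth `K`-valued controls on `[0, ∞)` with support in `(0, ∞)`. -/
def smoothControls {E : Type*} [NormedAddCommGroup E] [InnerProductSpace ℂ E] [CompleteSpace E]
    (A : E →ₗ.[ℂ] E) : Set (ℝ → E) :=
  {h | ContDiffOn ℝ ∞ h (Ici 0) ∧ (∀ t, 0 ≤ t → h t ∈ defectSpace A) ∧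
    halfLineSupport h ⊆ Ioi 0}

/-- `u` is a classical solution on `[0, ∞)` of the system
`u_tt + A* u = 0` for `t > 0`, `u|_{t=0} = u_t|_{t=0} = 0`, `Γ₁ u = h` for `t ≥ 0`. -/
structure IsClassicalSolution {E : Type*} [NormedAddCommGroup E] [InnerProductSpace ℂ E]
    [CompleteSpace E] (A : E →ₗ.[ℂ] E) (h u : ℝ → E) : Prop where
  contDiffOn : ContDiffOn ℝ 2 u (Ici 0)
  equation : ∀ t, 0 < t → (u t, -iteratedDerivWithin 2 u (Ici 0) t) ∈ A.adjoint.graph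
  initial_value : u 0 = 0
  initial_velocity : derivWithin u (Ici 0) 0 = 0
  boundary : ∀ t, 0 ≤ t → (u t, h t) ∈ gammaOneGraph A

/-- For every smooth control the system has a classical solution which is `C^∞`-smooth in time, and
any classical solution coincides with it. -/
def WellPosed {E : Type*} [NormedAddCommGroup E] [InnerProductSpace ℂ E] [CompleteSpace E]
    (A : E →ₗ.[ℂ] E) : Prop :=
  ∀ h ∈ smoothControls A, ∃ u : ℝ → E, ContDiffOn ℝ ∞ u (Ici 0) ∧ IsClassicalSolution A h u ∧
    ∀ v : ℝ → E, IsClassicalSolution A h v → EqOn v u (Ici 0)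

/-- The set reachable at time `T`: the states `u^h(T)`, where `h` is a smooth control. -/
def reachableSet {E : Type*} [NormedAddCommGroup E] [InnerProductSpace ℂ E] [CompleteSpace E]
    (A : E →ₗ.[ℂ] E) (T : ℝ) : Set E :=
  {y | ∃ h ∈ smoothControls A, ∃ u : ℝ → E, IsClassicalSolution A h u ∧ u T = y}

/-- The total reachable set. -/
def totalReachableSet {E : Type*} [NormedAddCommGroup E] [InnerProductSpace ℂ E] [CompleteSpace E]
    (A : E →ₗ.[ℂ] E) : Set E :=
  ⋃ T ∈ Ioi (0 : ℝ), reachableSet A T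

/-- Controllability: the total reachable set is dense. -/
def IsControllable {E : Type*} [NormedAddCommGroup E] [InnerProductSpace ℂ E] [CompleteSpace E]
    (A : E →ₗ.[ℂ] E) : Prop :=
  closure (totalReachableSet A) = univ

/-! ### The Sturm-Liouville operator on the half-line -/

/-- The complex Hilbert space `L₂(0, ∞)`. -/
abbrev HalfLineL2 : Type := Lp ℂ 2 (volume.restrict (Ioi (0 : ℝ)))

/-- `g` belongs to `H²_loc([0, ∞))`, with `g'= g₁` and `g''= g₂`: the function `g` is continuously
differentiable on `[0, ∞)`, its derivative `g₁` is locally absolutely continuous, and the derivative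
`g₂` of `g₁` is square-integrable on every bounded interval `(0, R)`. -/
structure IsSobolevTwoLoc (g g₁ g₂ : ℝ → ℂ) : Prop where
  memLp : ∀ R : ℝ, MemLp g₂ 2 (volume.restrict (Ioo 0 R))
  eq_integral_one : ∀ x, 0 ≤ x → g₁ x = g₁ 0 + ∫ t in (0 : ℝ)..x, g₂ t
  eq_integral_zero : ∀ x, 0 ≤ x → g x = g 0 + ∫ t in (0 : ℝ)..x, g₁ t

namespace IsSobolevTwoLoc

variable {g g₁ g₂ f f₁ f₂ : ℝ → ℂ}

theorem intervalIntegrable_two (hg : IsSobolevTwoLoc g g₁ g₂) {x : ℝ} (hx : 0 ≤ x) :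
    IntervalIntegrable g₂ volume 0 x := by
  rw [intervalIntegrable_iff_integrableOn_Ioo_of_le hx]
  exact (hg.memLp x).integrable (by norm_num)

theorem continuousOn_one (hg : IsSobolevTwoLoc g g₁ g₂) (x : ℝ) :
    ContinuousOn g₁ (Icc 0 x) := by
  rcases lt_or_ge x 0 with h | h
  · simp [Icc_eq_empty_of_lt h]
  have : ContinuousOn (fun y => g₁ 0 + ∫ t in (0 : ℝ)..y, g₂ t) (Icc 0 x) := by
    have := intervalIntegral.continuousOn_primitive_interval (μ := volume) (a := 0) (b := x)
      (f := g₂) (by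
        rw [uIcc_of_le h, ← intervalIntegrable_iff_integrableOn_Icc_of_le h]
        exact hg.intervalIntegrable_two h)
    rw [uIcc_of_le h] at this
    exact continuousOn_const.add this
  exact this.congr fun y hy => hg.eq_integral_one y hy.1

theorem intervalIntegrable_one (hg : IsSobolevTwoLoc g g₁ g₂) {x : ℝ} (hx : 0 ≤ x) :
    IntervalIntegrable g₁ volume 0 x := by
  apply ContinuousOn.intervalIntegrable
  rw [uIcc_of_le hx]
  exact hg.continuousOn_one x

theorem zero : IsSobolevTwoLoc 0 0 0 :=
  ⟨fun _ => MemLp.zero, by simp, by simp⟩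

theorem add (hg : IsSobolevTwoLoc g g₁ g₂) (hf : IsSobolevTwoLoc f f₁ f₂) :
    IsSobolevTwoLoc (g + f) (g₁ + f₁) (g₂ + f₂) := by
  refine ⟨fun R => (hg.memLp R).add (hf.memLp R), fun x hx => ?_, fun x hx => ?_⟩
  · simp only [Pi.add_apply]
    rw [intervalIntegral.integral_add (hg.intervalIntegrable_two hx)
      (hf.intervalIntegrable_two hx), hg.eq_integral_one x hx, hf.eq_integral_one x hx]
    ring
  · simp only [Pi.add_apply]
    rw [intervalIntegral.integral_add (hg.intervalIntegrable_one hx)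
      (hf.intervalIntegrable_one hx), hg.eq_integral_zero x hx, hf.eq_integral_zero x hx]
    ring

theorem smul (c : ℂ) (hg : IsSobolevTwoLoc g g₁ g₂) :
    IsSobolevTwoLoc (c • g) (c • g₁) (c • g₂) := by
  refine ⟨fun R => (hg.memLp R).const_smul c, fun x hx => ?_, fun x hx => ?_⟩
  · simp only [Pi.smul_apply]
    rw [intervalIntegral.integral_smul, hg.eq_integral_one x hx, smul_add]
  · simp only [Pi.smul_apply]
    rw [intervalIntegral.integral_smul, hg.eq_integral_zero x hx, smul_add]

end IsSobolevTwoLoc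

/-- The graph of `L₀`: the pairs `(y, z)` with `y ∈ L₂(0, ∞) ∩ H²_loc([0, ∞))`,
`y(0) = y'(0) = 0` and `z = -y'' + q y ∈ L₂(0, ∞)`. -/
def sturmLiouvilleGraph (q : ℝ → ℝ) : Submodule ℂ (HalfLineL2 × HalfLineL2) where
  carrier := {p | ∃ g g₁ g₂ : ℝ → ℂ, IsSobolevTwoLoc g g₁ g₂ ∧ g 0 = 0 ∧ g₁ 0 = 0 ∧
    p.1 =ᵐ[volume.restrict (Ioi (0 : ℝ))] g ∧
    p.2 =ᵐ[volume.restrict (Ioi (0 : ℝ))] fun x => -g₂ x + q x * g x}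
  zero_mem' := by
    refine ⟨0, 0, 0, IsSobolevTwoLoc.zero, rfl, rfl, Lp.coeFn_zero _ _ _, ?_⟩
    refine (Lp.coeFn_zero ℂ 2 (volume.restrict (Ioi (0 : ℝ)))).trans ?_
    exact Eventually.of_forall fun x => by simp
  add_mem' := by
    rintro ⟨y, z⟩ ⟨y', z'⟩ ⟨g, g₁, g₂, hg, h0, h1, hy, hz⟩ ⟨f, f₁, f₂, hf, k0, k1, hy', hz'⟩
    refine ⟨_, _, _, hg.add hf, by simp [h0, k0], by simp [h1, k1],
      (Lp.coeFn_add y y').trans (hy.add hy'), ?_⟩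
    refine (Lp.coeFn_add z z').trans ((hz.add hz').trans ?_)
    exact Eventually.of_forall fun x => by simp only [Pi.add_apply]; ring
  smul_mem' := by
    rintro c ⟨y, z⟩ ⟨g, g₁, g₂, hg, h0, h1, hy, hz⟩
    refine ⟨_, _, _, hg.smul c, by simp [h0], by simp [h1],
      (Lp.coeFn_smul c y).trans (hy.const_smul c), ?_⟩
    refine (Lp.coeFn_smul c z).trans ((hz.const_smul c).trans ?_)
    exact Eventually.of_forall fun x => by simp only [Pi.smul_apply, smul_eq_mul]; ring

/-- The Sturm-Liouville operator `L₀ = -d²/dx² + q` in `L₂(0, ∞)`. -/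
noncomputable def sturmLiouville (q : ℝ → ℝ) : HalfLineL2 →ₗ.[ℂ] HalfLineL2 :=
  (sturmLiouvilleGraph q).toLinearPMap

/-- A locally integrable function on `[0, ∞)` with zero primitive vanishes almost everywhere. -/
theorem ae_eq_zero_of_primitive_eq_zero {p : ℝ → ℂ}
    (hp : ∀ x, 0 ≤ x → IntervalIntegrable p volume 0 x)
    (h : ∀ x, 0 ≤ x → ∫ t in (0 : ℝ)..x, p t = 0) :
    p =ᵐ[volume.restrict (Ioi (0 : ℝ))] 0 := by
  have key : ∀ᵐ x : ℝ, ∀ n : ℕ, x ∈ uIcc (0 : ℝ) n → ∀ c ∈ uIcc (0 : ℝ) n,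
      HasDerivAt (fun x => ∫ t in c..x, p t) (p x) x :=
    ae_all_iff.2 fun n => (hp n n.cast_nonneg).ae_hasDerivAt_integral
  refine (ae_restrict_iff' measurableSet_Ioi).2 ?_
  filter_upwards [key] with x hx hx0
  obtain ⟨n, hn⟩ := exists_nat_gt x
  have h0 : (0 : ℝ) < x := hx0
  have hd := hx n (by rw [uIcc_of_le n.cast_nonneg]; exact ⟨h0.le, hn.le⟩) 0 (by simp)
  have he : (fun x => ∫ t in (0 : ℝ)..x, p t) =ᶠ[𝓝 x] fun _ => 0 := by
    filter_upwards [Ioi_mem_nhds h0] with z hz using h z (le_of_lt hz)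
  exact hd.unique ((hasDerivAt_const x (0 : ℂ)).congr_of_eventuallyEq he)

/-- The graph is that of a (single-valued) operator. -/
theorem sturmLiouvilleGraph_snd_eq_zero (q : ℝ → ℝ) :
    ∀ p ∈ sturmLiouvilleGraph q, p.1 = 0 → p.2 = 0 := by
  rintro ⟨y, z⟩ ⟨g, g₁, g₂, hg, h0, h1, hy, hz⟩ (hy0 : y = 0)
  have cont : ∀ f : ℝ → ℂ, (∀ x, ContinuousOn f (Icc 0 x)) → ContinuousOn f (Ioi 0) := by
    intro f hf x hx
    have hx : (0 : ℝ) < x := hx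
    exact ((hf (x + 1)).continuousAt (Icc_mem_nhds hx (by linarith))).continuousWithinAt
  have van : ∀ f : ℝ → ℂ, (∀ x, ContinuousOn f (Icc 0 x)) → f 0 = 0 →
      f =ᵐ[volume.restrict (Ioi (0 : ℝ))] 0 → ∀ x, 0 ≤ x → f x = 0 := by
    intro f hf hf0 hfa x hx
    rcases hx.eq_or_lt with rfl | hx
    · exact hf0
    · exact Measure.eqOn_open_of_ae_eq hfa isOpen_Ioi (cont f hf) continuousOn_const hx
  have cg : ∀ x, ContinuousOn g (Icc 0 x) := by
    intro x
    rcases lt_or_ge x 0 with h | h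
    · simp [Icc_eq_empty_of_lt h]
    have := intervalIntegral.continuousOn_primitive_interval (μ := volume) (a := 0) (b := x)
      (f := g₁) (by
        rw [uIcc_of_le h, ← intervalIntegrable_iff_integrableOn_Icc_of_le h]
        exact hg.intervalIntegrable_one h)
    rw [uIcc_of_le h] at this
    exact (continuousOn_const.add this).congr fun y hy => hg.eq_integral_zero y hy.1
  have g0 : ∀ x, 0 ≤ x → g x = 0 := by
    refine van g cg h0 (hy.symm.trans ?_)
    rw [hy0]
    exact Lp.coeFn_zero _ _ _
  have g10 : ∀ x, 0 ≤ x → g₁ x = 0 := by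
    refine van g₁ hg.continuousOn_one h1 (ae_eq_zero_of_primitive_eq_zero
      (fun x hx => hg.intervalIntegrable_one hx) fun x hx => ?_)
    have := hg.eq_integral_zero x hx
    rw [g0 x hx, h0, zero_add] at this
    exact this.symm
  have g20 : g₂ =ᵐ[volume.restrict (Ioi (0 : ℝ))] 0 := by
    refine ae_eq_zero_of_primitive_eq_zero
      (fun x hx => hg.intervalIntegrable_two hx) fun x hx => ?_
    have := hg.eq_integral_one x hx
    rw [g10 x hx, h1, zero_add] at this
    exact this.symm
  refine (Lp.eq_zero_iff_ae_eq_zero (f := z)).2 (hz.trans ?_)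
  filter_upwards [g20, ae_restrict_mem measurableSet_Ioi] with x hx hx0
  simp [hx, g0 x (le_of_lt hx0)]

theorem sturmLiouville_graph (q : ℝ → ℝ) :
    (sturmLiouville q).graph = sturmLiouvilleGraph q :=
  Submodule.toLinearPMap_graph_eq _ (sturmLiouvilleGraph_snd_eq_zero q)

/-- The limit point case at infinity: it is not true that for every `l ∈ ℂ` all the solutions of
`-y'' + q y = l y` on `[0, ∞)` belong to `L₂(0, ∞)`. -/
def IsLimitPointCase (q : ℝ → ℝ) : Prop :=
  ∃ (l : ℂ) (y y₁ : ℝ → ℂ),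
    (∀ x, 0 ≤ x → HasDerivWithinAt y (y₁ x) (Ici 0) x) ∧
    (∀ x, 0 ≤ x → HasDerivWithinAt y₁ ((q x - l) * y x) (Ici 0) x) ∧
    ¬ MemLp y 2 (volume.restrict (Ioi (0 : ℝ)))

/-- The smooth functions on `[0, ∞)` with support in `[0, T)`, as elements of `L₂(0, ∞)`. -/
def smoothSupportedIn (T : ℝ) : Set HalfLineL2 :=
  {y | ∃ g : ℝ → ℂ, ContDiffOn ℝ ∞ g (Ici 0) ∧ halfLineSupport g ⊆ Ico 0 T ∧
    y =ᵐ[volume.restrict (Ioi (0 : ℝ))] g}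

/-- The smooth functions on `[0, ∞)` with bounded support, as elements of `L₂(0, ∞)`. -/
def smoothBoundedSupport : Set HalfLineL2 :=
  {y | ∃ g : ℝ → ℂ, ContDiffOn ℝ ∞ g (Ici 0) ∧ Bornology.IsBounded (halfLineSupport g) ∧
    y =ᵐ[volume.restrict (Ioi (0 : ℝ))] g}

/-!
The abstract system is the wave equation `u_tt = u_xx - q u` on the half-line with Dirichlet control at
the end point. In one space dimension the variables `x` and `t` play symmetric roles, so that the wave
can be computed from its trace at `x = 0` as well as, sideways, from its state at `t = T`.

*The operators.* Testing against twice integrated functions with two vanishing moments shows that the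
domain of `L₀*` consists of Sobolev functions, and the positivity of `L₀` gives the converse without
an analysis at infinity: an element of the maximal domain differs from an element of `Dom L₀` by a
smooth function with bounded support, for which Green's formula holds
(`mem_adjoint_iff_exists_maximalPair`). The Friedrichs extension is then the Dirichlet restriction
(`mem_friedrichsGraph_iff`), the defect space is spanned by one function `η` with `η(0) = 1`
(`exists_defect_apply_zero_eq_one`, `mem_defectSpace_iff`), and `Γ₁ u = c η` means `u(0) = -c`
(`mem_gammaOneGraph_iff`).

*The waves.* With `q` extended to a smooth function on the line (`exists_contDiff_eqOn_Ici`), the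
Goursat problem in characteristic coordinates, solved by successive approximations, has a smooth
solution on the whole plane (`exists_goursat`). It yields smooth solutions of the wave equation that
vanish for `t - x ≤ δ` and have either a prescribed trace at `x = 0`
(`exists_isDelayedWave_boundary`) or a prescribed final state at `t = T`
(`exists_isDelayedWave_final`). At each time such a wave has bounded support, so that its slices form
a smooth curve in `L₂(0, ∞)` (`contDiff_sliceCurve`) and a classical solution of the system
(`IsDelayedWave.isClassicalSolution`); classical solutions are unique by conservation of energy
(`eqOn_zero_of_energy`). The states at time `T` are therefore smooth with support in `[0, T - δ]`, and
each such function is reached, the control being the trace at `x = 0` of the wave with this final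
state. Density of the smooth functions with bounded support gives controllability.
-/

/-! ### Smooth extension across the endpoint of a half-line -/

section SmoothExtension

variable {F : Type*} [NormedAddCommGroup F] [NormedSpace ℝ F]

/-- **Borel's lemma**: every sequence is the sequence of derivatives at `0` of a smooth function.
The monomials of the formal Taylor series are cut off at scales that shrink so fast that the
series converges together with all its derivatives. -/
theorem exists_contDiff_iteratedDeriv_zero_eq [CompleteSpace F] (a : ℕ → F) :
    ∃ f : ℝ → F, ContDiff ℝ ∞ f ∧ ∀ k, iteratedDeriv k f 0 = a k := by
  let χ : ContDiffBump (0 : ℝ) := ⟨1, 2, one_pos, one_lt_two⟩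
  let G : ℕ → ℝ → F := fun n x => (χ x * (x ^ n * (n.factorial : ℝ)⁻¹)) • a n
  have hG : ∀ n, ContDiff ℝ ∞ (G n) := fun n =>
    (χ.contDiff.mul ((contDiff_id.pow n).mul contDiff_const)).smul contDiff_const
  have hGs : ∀ n, HasCompactSupport (G n) := fun n =>
    (χ.hasCompactSupport.mul_right).smul_right
  have bdd : ∀ H : ℝ → F, ContDiff ℝ ∞ H → HasCompactSupport H → ∀ k,
      ∃ C, 0 ≤ C ∧ ∀ x, ‖iteratedFDeriv ℝ k H x‖ ≤ C := by
    intro H hH hs k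
    obtain ⟨C, hC⟩ := (hs.iteratedFDeriv (𝕜 := ℝ) k).exists_bound_of_continuous
      (hH.continuous_iteratedFDeriv (mod_cast le_top))
    exact ⟨C, (norm_nonneg _).trans (hC 0), hC⟩
  choose C hC0 hC using fun n k => bdd (G n) (hG n) (hGs n) k
  let D : ℕ → ℝ := fun n => ∑ k ∈ Finset.range n, C n k
  have hD0 : ∀ n, 0 ≤ D n := fun n => Finset.sum_nonneg fun k _ => hC0 n k
  -- the scale of the `n`-th term: large enough to beat the derivatives of order `< n` by `2⁻ⁿ`
  let L : ℕ → ℝ := fun n => 1 + 2 ^ n * D n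
  have hL1 : ∀ n, 1 ≤ L n := fun n => by
    have := mul_nonneg (pow_nonneg (zero_le_two (α := ℝ)) n) (hD0 n)
    simp only [L]; linarith
  have hL0 : ∀ n, 0 < L n := fun n => one_pos.trans_le (hL1 n)
  let f : ℕ → ℝ → F := fun n => (L n ^ n)⁻¹ • fun x => G n (L n * x)
  have hf : ∀ n, ContDiff ℝ ∞ (f n) := fun n =>
    ((hG n).comp (contDiff_const.mul contDiff_id)).const_smul _
  have hfs : ∀ n, HasCompactSupport (f n) := fun n =>
    ((hGs n).comp_smul (hL0 n).ne').smul_left (f := fun _ => (L n ^ n)⁻¹)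
  choose B hB0 hB using fun n k => bdd (f n) (hf n) (hfs n) k
  let v : ℕ → ℕ → ℝ := fun k n => if k < n then (1 / 2 : ℝ) ^ n else B n k
  have hv : ∀ k, Summable (v k) := fun k => by
    refine (summable_geometric_two).congr_cofinite ?_
    rw [Nat.cofinite_eq_atTop]
    filter_upwards [eventually_gt_atTop k] with n hn
    simp [v, hn]
  have hfv : ∀ k n x, ‖iteratedFDeriv ℝ k (f n) x‖ ≤ v k n := by
    intro k n x
    by_cases hkn : k < n
    swap
    · simpa [v, hkn] using hB n k x
    simp only [v, hkn, if_true]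
    rw [norm_iteratedFDeriv_eq_norm_iteratedDeriv, iteratedDeriv_const_smul_field,
      iteratedDeriv_comp_const_smul ((hG n).of_le (mod_cast le_top)), norm_smul, norm_smul,
      ← norm_iteratedFDeriv_eq_norm_iteratedDeriv]
    have h1 : ‖iteratedFDeriv ℝ k (G n) (L n * x)‖ ≤ D n :=
      (hC n k _).trans (Finset.single_le_sum (f := C n) (fun k _ => hC0 n k)
        (Finset.mem_range.2 hkn))
    have h2 : L n ^ k * L n ≤ L n ^ n := by
      rw [← pow_succ]; exact pow_le_pow_right₀ (hL1 n) hkn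
    have h3 : 2 ^ n * D n ≤ L n := by simp only [L]; linarith
    rw [norm_inv, norm_pow, norm_pow, Real.norm_of_nonneg (hL0 n).le, inv_mul_le_iff₀
      (pow_pos (hL0 n) n)]
    calc L n ^ k * ‖iteratedFDeriv ℝ k (G n) (L n * x)‖ ≤ L n ^ k * D n := by
          gcongr
          exact pow_nonneg (hL0 n).le _
      _ = L n ^ k * (2 ^ n * D n) * (1 / 2) ^ n := by
          rw [one_div, inv_pow]; field_simp
      _ ≤ L n ^ k * L n * (1 / 2) ^ n := by
          gcongr
          exact pow_nonneg (hL0 n).le _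
      _ ≤ L n ^ n * (1 / 2) ^ n := by gcongr
  refine ⟨fun x => ∑' n, f n x, ?_, fun k => ?_⟩
  · exact contDiff_tsum (N := ⊤) hf (fun k _ => hv k) (fun k n x _ => hfv k n x)
  have hfk : ∀ n, iteratedDeriv k (f n) 0 = if n = k then a k else 0 := by
    intro n
    have e : f n =ᶠ[𝓝 0] fun x => x ^ n • ((n.factorial : ℝ)⁻¹ • a n) := by
      have : ∀ᶠ x : ℝ in 𝓝 0, L n * x ∈ Metric.closedBall (0 : ℝ) 1 := by
        have hc : Tendsto (fun x : ℝ => L n * x) (𝓝 0) (𝓝 0) := by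
          simpa using (continuous_const_mul (L n)).tendsto 0
        exact hc (Metric.closedBall_mem_nhds _ one_pos)
      filter_upwards [this] with x hx
      have h1 : χ (L n * x) = 1 := χ.one_of_mem_closedBall hx
      simp only [f, G, Pi.smul_apply, h1, one_mul, smul_smul, mul_pow]
      congr 1
      have := pow_ne_zero n (hL0 n).ne'
      field_simp
    rw [e.iteratedDeriv_eq, iteratedDeriv_smul_const (by fun_prop)]
    have hp : iteratedDeriv k (fun x : ℝ => x ^ n) 0 = if n = k then (n.factorial : ℝ) else 0 := by
      rw [iteratedDeriv_fun_pow_zero]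
      simp only [eq_comm (a := k), Nat.cast_ite, Nat.cast_zero]
    rw [hp]
    split_ifs with h
    · subst h
      rw [smul_smul, mul_inv_cancel₀ (by positivity), one_smul]
    · simp
  have h := iteratedFDeriv_tsum_apply (N := ⊤) hf (fun k _ => hv k) (fun k n x _ => hfv k n x)
    (k := k) le_top 0
  have hs : Summable fun n => iteratedFDeriv ℝ k (f n) 0 :=
    Summable.of_norm_bounded (hv k) fun n => hfv k n 0
  rw [iteratedDeriv_eq_iteratedFDeriv, h, ContinuousMultilinearMap.tsum_eval hs]
  simp_rw [← iteratedDeriv_eq_iteratedFDeriv, hfk]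
  exact tsum_ite_eq k _

/-- Extension by zero of a smooth function on `[0, ∞)` that is flat at `0`. -/
theorem contDiff_extend_zero_of_flat {r : ℝ → F} (hr : ContDiffOn ℝ ∞ r (Ici 0))
    (h0 : ∀ k, iteratedDerivWithin k r (Ici 0) 0 = 0) :
    ContDiff ℝ ∞ ((Ici (0 : ℝ)).indicator r) := by
  have key : ∀ k x, HasDerivAt ((Ici (0 : ℝ)).indicator (iteratedDerivWithin k r (Ici 0)))
      ((Ici (0 : ℝ)).indicator (iteratedDerivWithin (k + 1) r (Ici 0)) x) x := by
    intro k x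
    have hd : ∀ x, 0 ≤ x → HasDerivWithinAt (iteratedDerivWithin k r (Ici 0))
        (iteratedDerivWithin (k + 1) r (Ici 0) x) (Ici 0) x := fun x hx => by
      rw [iteratedDerivWithin_succ]
      exact ((hr.differentiableOn_iteratedDerivWithin (mod_cast ENat.natCast_lt_top k)
        (uniqueDiffOn_Ici 0)) x hx).hasDerivWithinAt
    rcases lt_trichotomy x 0 with hx | rfl | hx
    · rw [indicator_of_notMem (by simpa using hx)]
      refine (hasDerivAt_const x (0 : F)).congr_of_eventuallyEq ?_
      filter_upwards [Iio_mem_nhds hx] with y hy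
      rw [indicator_of_notMem (by simpa using hy)]
    · rw [indicator_of_mem (by simp), h0]
      have h1 := hd 0 le_rfl
      rw [h0] at h1
      have h2 : HasDerivWithinAt ((Ici (0 : ℝ)).indicator (iteratedDerivWithin k r (Ici 0))) 0
          (Ici 0) 0 := h1.congr (fun y hy => indicator_of_mem hy _) (indicator_of_mem (by simp) _)
      have h3 : HasDerivWithinAt ((Ici (0 : ℝ)).indicator (iteratedDerivWithin k r (Ici 0))) 0
          (Iic 0) 0 := by
        refine (hasDerivWithinAt_const 0 _ (0 : F)).congr (fun y hy => ?_) ?_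
        · rcases (mem_Iic.1 hy).lt_or_eq with h | rfl
          · exact indicator_of_notMem (by simpa using h) _
          · rw [indicator_of_mem (by simp), h0]
        · rw [indicator_of_mem (by simp), h0]
      simpa using h3.union h2
    · rw [indicator_of_mem (by simpa using hx.le)]
      refine ((hd x hx.le).hasDerivAt (Ici_mem_nhds hx)).congr_of_eventuallyEq ?_
      filter_upwards [Ici_mem_nhds hx] with y hy
      rw [indicator_of_mem hy]
  have hit : ∀ k, iteratedDeriv k ((Ici (0 : ℝ)).indicator r) =
      (Ici (0 : ℝ)).indicator (iteratedDerivWithin k r (Ici 0)) := by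
    intro k
    induction k with
    | zero => simp
    | succ k ih =>
      rw [iteratedDeriv_succ, ih]
      exact funext fun x => (key k x).deriv
  refine contDiff_of_differentiable_iteratedDeriv (n := ⊤) fun m _ => ?_
  rw [hit m]
  exact fun x => (key m x).differentiableAt

/-- A smooth function on `[0, ∞)` is the restriction of a smooth function on `ℝ`. -/
theorem exists_contDiff_eqOn_Ici [CompleteSpace F] {f : ℝ → F} (hf : ContDiffOn ℝ ∞ f (Ici 0)) :
    ∃ g : ℝ → F, ContDiff ℝ ∞ g ∧ EqOn g f (Ici 0) := by
  obtain ⟨p, hp, hp0⟩ := exists_contDiff_iteratedDeriv_zero_eq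
    fun k => iteratedDerivWithin k f (Ici 0) 0
  refine ⟨p + (Ici (0 : ℝ)).indicator (f - p),
    hp.add (contDiff_extend_zero_of_flat (hf.sub hp.contDiffOn) fun k => ?_), fun x hx => ?_⟩
  · rw [iteratedDerivWithin_sub self_mem_Ici (uniqueDiffOn_Ici 0)
      ((hf 0 self_mem_Ici).of_le (mod_cast le_top)) (hp.contDiffWithinAt.of_le (mod_cast le_top)),
      iteratedDerivWithin_eq_iteratedDeriv (uniqueDiffOn_Ici 0)
        (hp.contDiffAt.of_le (mod_cast le_top)) self_mem_Ici, hp0, sub_self]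
  · simp [indicator_of_mem hx]

end SmoothExtension

/-! ### Functions of two real variables and their partial primitives -/

section TwoVariables

theorem hasFDerivAt_of_continuous_partials {f f₁ f₂ : ℝ × ℝ → ℂ}
    (h₁ : ∀ a b, HasDerivAt (fun s => f (s, b)) (f₁ (a, b)) a)
    (h₂ : ∀ a b, HasDerivAt (fun s => f (a, s)) (f₂ (a, b)) b)
    (c₁ : Continuous f₁) (c₂ : Continuous f₂) (p : ℝ × ℝ) :
    HasFDerivAt f ((ContinuousLinearMap.fst ℝ ℝ ℝ).smulRight (f₁ p) +
      (ContinuousLinearMap.snd ℝ ℝ ℝ).smulRight (f₂ p)) p := by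
  have h := hasStrictFDerivAt_uncurry_coprod (𝕜 := ℝ) (u := p) (f := fun a b => f (a, b))
    (f₁ := fun a b => ContinuousLinearMap.toSpanSingleton ℝ (f₁ (a, b)))
    (f₂ := fun a b => ContinuousLinearMap.toSpanSingleton ℝ (f₂ (a, b)))
    (Eventually.of_forall fun v => (h₁ v.1 v.2).hasFDerivAt)
    (Eventually.of_forall fun v => (h₂ v.1 v.2).hasFDerivAt)
    ((ContinuousLinearMap.toSpanSingletonCLE (𝕜 := ℝ) (E := ℂ)).continuous.comp c₁).continuousAt
    ((ContinuousLinearMap.toSpanSingletonCLE (𝕜 := ℝ) (E := ℂ)).continuous.comp c₂).continuousAt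
  refine h.hasFDerivAt.congr_fderiv ?_
  ext <;> simp [Function.HasUncurry.uncurry]

theorem contDiff_succ_of_partials {n : ℕ} {f f₁ f₂ : ℝ × ℝ → ℂ}
    (h₁ : ∀ a b, HasDerivAt (fun s => f (s, b)) (f₁ (a, b)) a)
    (h₂ : ∀ a b, HasDerivAt (fun s => f (a, s)) (f₂ (a, b)) b)
    (c₁ : ContDiff ℝ n f₁) (c₂ : ContDiff ℝ n f₂) : ContDiff ℝ (n + 1) f :=
  contDiff_succ_iff_hasFDerivAt.2 ⟨_, (contDiff_const.smulRight c₁).add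
    (contDiff_const.smulRight c₂),
    hasFDerivAt_of_continuous_partials h₁ h₂ c₁.continuous c₂.continuous⟩

/-- The primitive of a function of two variables with respect to the first one. -/
noncomputable def primitiveFst (Q : ℝ × ℝ → ℂ) (p : ℝ × ℝ) : ℂ := ∫ s in (0 : ℝ)..p.1, Q (s, p.2)

/-- The primitive of a function of two variables with respect to the second one. -/
noncomputable def primitiveSnd (Q : ℝ × ℝ → ℂ) (p : ℝ × ℝ) : ℂ := ∫ s in (0 : ℝ)..p.2, Q (p.1, s)

theorem primitiveSnd_eq (Q : ℝ × ℝ → ℂ) :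
    primitiveSnd Q = primitiveFst (Q ∘ Prod.swap) ∘ Prod.swap := rfl

theorem continuous_primitiveFst {Q : ℝ × ℝ → ℂ} (hQ : Continuous Q) :
    Continuous (primitiveFst Q) :=
  (intervalIntegral.continuous_parametric_primitive_of_continuous (μ := volume) (a₀ := 0)
    (f := fun b s => Q (s, b)) (hQ.comp continuous_swap)).comp continuous_swap

theorem hasDerivAt_primitiveFst_fst {Q : ℝ × ℝ → ℂ} (hQ : Continuous Q) (a b : ℝ) :
    HasDerivAt (fun s => primitiveFst Q (s, b)) (Q (a, b)) a := by
  have hc : Continuous fun s => Q (s, b) := by fun_prop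
  exact hc.integral_hasStrictDerivAt 0 a |>.hasDerivAt

theorem hasDerivAt_primitiveFst_snd {Q Q' : ℝ × ℝ → ℂ} (hQ : Continuous Q) (hQ' : Continuous Q')
    (h : ∀ a b, HasDerivAt (fun s => Q (a, s)) (Q' (a, b)) b) (a b : ℝ) :
    HasDerivAt (fun s => primitiveFst Q (a, s)) (primitiveFst Q' (a, b)) b := by
  obtain ⟨C, hC⟩ := ((isCompact_uIcc (a := 0) (b := a)).prod
    (isCompact_closedBall b 1)).exists_bound_of_continuousOn hQ'.continuousOn
  refine (intervalIntegral.hasDerivAt_integral_of_dominated_loc_of_deriv_le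
    (F := fun s t => Q (t, s)) (F' := fun s t => Q' (t, s)) (bound := fun _ => C)
    (Metric.closedBall_mem_nhds b one_pos) (Eventually.of_forall fun s => ?_) ?_ ?_ ?_ ?_ ?_).2
  · exact Continuous.aestronglyMeasurable (by fun_prop)
  · exact Continuous.intervalIntegrable (by fun_prop) _ _
  · exact Continuous.aestronglyMeasurable (by fun_prop)
  · exact Eventually.of_forall fun t ht s hs => hC (t, s) ⟨uIoc_subset_uIcc ht, hs⟩
  · exact intervalIntegrable_const
  · exact Eventually.of_forall fun t _ s _ => h t s

theorem contDiff_nat_primitiveFst (n : ℕ) :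
    ∀ {Q : ℝ × ℝ → ℂ}, ContDiff ℝ n Q → ContDiff ℝ n (primitiveFst Q) := by
  induction n with
  | zero =>
    intro Q hQ
    exact contDiff_zero.2 (continuous_primitiveFst hQ.continuous)
  | succ n ih =>
    intro Q hQ
    have hd : Differentiable ℝ Q := hQ.differentiable (by simp)
    have hQ' : ContDiff ℝ n fun p => fderiv ℝ Q p (0, 1) :=
      (hQ.fderiv_right (m := n) (by simp)).clm_apply contDiff_const
    have hp : ∀ a b, HasDerivAt (fun s => Q (a, s)) (fderiv ℝ Q (a, b) (0, 1)) b := fun a b =>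
      (hd (a, b)).hasFDerivAt.comp_hasDerivAt b
        ((hasDerivAt_const b a).prodMk (hasDerivAt_id b))
    push_cast
    exact contDiff_succ_of_partials (hasDerivAt_primitiveFst_fst hQ.continuous)
      (hasDerivAt_primitiveFst_snd hQ.continuous hQ'.continuous hp)
      (hQ.of_le (by norm_cast; simp)) (ih hQ')

theorem contDiff_nat_primitiveSnd {n : ℕ} {Q : ℝ × ℝ → ℂ} (hQ : ContDiff ℝ n Q) :
    ContDiff ℝ n (primitiveSnd Q) := by
  rw [primitiveSnd_eq]
  exact (contDiff_nat_primitiveFst n (hQ.comp (contDiff_snd.prodMk contDiff_fst))).comp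
    (contDiff_snd.prodMk contDiff_fst)

theorem continuous_primitiveSnd {Q : ℝ × ℝ → ℂ} (hQ : Continuous Q) :
    Continuous (primitiveSnd Q) :=
  contDiff_zero.1 (contDiff_nat_primitiveSnd (n := 0) (contDiff_zero.2 hQ))

theorem hasDerivAt_primitiveSnd_snd {Q : ℝ × ℝ → ℂ} (hQ : Continuous Q) (a b : ℝ) :
    HasDerivAt (fun s => primitiveSnd Q (a, s)) (Q (a, b)) b := by
  have hc : Continuous fun s => Q (a, s) := by fun_prop
  exact hc.integral_hasStrictDerivAt 0 b |>.hasDerivAt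

/-- The integral over the rectangle `[0, a] × [0, b]`. -/
noncomputable def rectIntegral (Q : ℝ × ℝ → ℂ) : ℝ × ℝ → ℂ := primitiveFst (primitiveSnd Q)

theorem hasDerivAt_rectIntegral_fst {Q : ℝ × ℝ → ℂ} (hQ : Continuous Q) (a b : ℝ) :
    HasDerivAt (fun s => rectIntegral Q (s, b)) (primitiveSnd Q (a, b)) a :=
  hasDerivAt_primitiveFst_fst (continuous_primitiveSnd hQ) a b

theorem hasDerivAt_rectIntegral_snd {Q : ℝ × ℝ → ℂ} (hQ : Continuous Q) (a b : ℝ) :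
    HasDerivAt (fun s => rectIntegral Q (a, s)) (primitiveFst Q (a, b)) b :=
  hasDerivAt_primitiveFst_snd (continuous_primitiveSnd hQ) hQ (hasDerivAt_primitiveSnd_snd hQ) a b

/-- Integration over rectangles gains one derivative. -/
theorem contDiff_rectIntegral {n : ℕ} {Q : ℝ × ℝ → ℂ} (hQ : ContDiff ℝ n Q) :
    ContDiff ℝ (n + 1) (rectIntegral Q) :=
  contDiff_succ_of_partials (hasDerivAt_rectIntegral_fst hQ.continuous)
    (hasDerivAt_rectIntegral_snd hQ.continuous) (contDiff_nat_primitiveSnd hQ)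
    (contDiff_nat_primitiveFst n hQ)

theorem continuous_rectIntegral {Q : ℝ × ℝ → ℂ} (hQ : Continuous Q) :
    Continuous (rectIntegral Q) :=
  continuous_primitiveFst (continuous_primitiveSnd hQ)

/-- The partial derivative with respect to the first variable. -/
noncomputable def partialFst (f : ℝ × ℝ → ℂ) (p : ℝ × ℝ) : ℂ := fderiv ℝ f p (1, 0)

/-- The partial derivative with respect to the second variable. -/
noncomputable def partialSnd (f : ℝ × ℝ → ℂ) (p : ℝ × ℝ) : ℂ := fderiv ℝ f p (0, 1)

variable {f : ℝ × ℝ → ℂ}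

theorem contDiff_partialFst (hf : ContDiff ℝ ∞ f) : ContDiff ℝ ∞ (partialFst f) :=
  (hf.fderiv_right (m := ∞) le_rfl).clm_apply contDiff_const

theorem contDiff_partialSnd (hf : ContDiff ℝ ∞ f) : ContDiff ℝ ∞ (partialSnd f) :=
  (hf.fderiv_right (m := ∞) le_rfl).clm_apply contDiff_const

theorem hasDerivAt_partialFst (hf : ContDiff ℝ ∞ f) (a b : ℝ) :
    HasDerivAt (fun s => f (s, b)) (partialFst f (a, b)) a :=
  (hf.differentiable (by simp) (a, b)).hasFDerivAt.comp_hasDerivAt a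
    ((hasDerivAt_id a).prodMk (hasDerivAt_const a b))

theorem hasDerivAt_partialSnd (hf : ContDiff ℝ ∞ f) (a b : ℝ) :
    HasDerivAt (fun s => f (a, s)) (partialSnd f (a, b)) b :=
  (hf.differentiable (by simp) (a, b)).hasFDerivAt.comp_hasDerivAt b
    ((hasDerivAt_const b a).prodMk (hasDerivAt_id b))

theorem partialFst_partialSnd (hf : ContDiff ℝ ∞ f) (p : ℝ × ℝ) :
    partialFst (partialSnd f) p = partialSnd (partialFst f) p := by
  have hd : DifferentiableAt ℝ (fderiv ℝ f) p :=
    (hf.fderiv_right (m := ∞) le_rfl).differentiable (by simp) p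
  have hs : IsSymmSndFDerivAt ℝ f p :=
    (contDiff_infty.1 hf 2).contDiffAt.isSymmSndFDerivAt (by
      rw [minSmoothness_of_isRCLikeNormedField]; norm_num)
  have e : ∀ v w : ℝ × ℝ, fderiv ℝ (fun p => fderiv ℝ f p v) p w = fderiv ℝ (fderiv ℝ f) p w v :=
    fun v w => by
      rw [fderiv_clm_apply hd (differentiableAt_const v)]
      simp
  exact (e _ _).trans ((hs _ _).trans (e _ _).symm)

/-- Partial derivatives of the composition with an affine map. -/
theorem fderiv_comp_affine (hf : ContDiff ℝ ∞ f) (a b c d k l : ℝ) (p : ℝ × ℝ) :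
    partialFst (fun p => f (a * p.1 + b * p.2 + k, c * p.1 + d * p.2 + l)) p =
      a * partialFst f (a * p.1 + b * p.2 + k, c * p.1 + d * p.2 + l) +
      c * partialSnd f (a * p.1 + b * p.2 + k, c * p.1 + d * p.2 + l) ∧
    partialSnd (fun p => f (a * p.1 + b * p.2 + k, c * p.1 + d * p.2 + l)) p =
      b * partialFst f (a * p.1 + b * p.2 + k, c * p.1 + d * p.2 + l) +
      d * partialSnd f (a * p.1 + b * p.2 + k, c * p.1 + d * p.2 + l) := by
  have hA : HasFDerivAt (fun p : ℝ × ℝ => (a * p.1 + b * p.2 + k, c * p.1 + d * p.2 + l))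
      (((a • ContinuousLinearMap.fst ℝ ℝ ℝ + b • ContinuousLinearMap.snd ℝ ℝ ℝ)).prod
        (c • ContinuousLinearMap.fst ℝ ℝ ℝ + d • ContinuousLinearMap.snd ℝ ℝ ℝ)) p := by
    refine HasFDerivAt.prodMk ?_ ?_
    · exact (((hasFDerivAt_fst.const_mul a).add (hasFDerivAt_snd.const_mul b)).add_const k)
    · exact (((hasFDerivAt_fst.const_mul c).add (hasFDerivAt_snd.const_mul d)).add_const l)
  have h := ((hf.differentiable (by simp) _).hasFDerivAt.comp p hA).fderiv
  have hv : ∀ (L : ℝ × ℝ →L[ℝ] ℂ) (x y : ℝ), L (x, y) = x * L (1, 0) + y * L (0, 1) := by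
    intro L x y
    have : (x, y) = x • ((1, 0) : ℝ × ℝ) + y • ((0, 1) : ℝ × ℝ) := by simp
    rw [this, map_add, map_smul, map_smul, Complex.real_smul, Complex.real_smul]
  change fderiv ℝ (f ∘ _) p (1, 0) = _ ∧ fderiv ℝ (f ∘ _) p (0, 1) = _
  rw [h]
  constructor
  · simp only [ContinuousLinearMap.comp_apply]
    refine Eq.trans ?_ (hv _ a c)
    simp
  · simp only [ContinuousLinearMap.comp_apply]
    refine Eq.trans ?_ (hv _ b d)
    simp

end TwoVariables

/-! ### The Goursat problem and the wave equation in the quarter-plane -/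

section Goursat

/-- The integral of `Q` over the characteristic rectangle `[0, a] × [a, b]`. -/
noncomputable def charIntegral (Q : ℝ × ℝ → ℂ) (p : ℝ × ℝ) : ℂ :=
  rectIntegral Q p - rectIntegral Q (p.1, p.1)

theorem charIntegral_eq {Q : ℝ × ℝ → ℂ} (hQ : Continuous Q) (p : ℝ × ℝ) :
    charIntegral Q p = ∫ s in (0 : ℝ)..p.1, ∫ r in p.1..p.2, Q (s, r) := by
  have hc : Continuous (primitiveSnd Q) := continuous_primitiveSnd hQ
  have h1 : ∀ b, IntervalIntegrable (fun s => primitiveSnd Q (s, b)) volume 0 p.1 := fun b =>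
    Continuous.intervalIntegrable (by fun_prop) _ _
  simp only [charIntegral, rectIntegral, primitiveFst]
  rw [← intervalIntegral.integral_sub (h1 _) (h1 _)]
  refine intervalIntegral.integral_congr fun s _ => ?_
  have h2 : ∀ x y, IntervalIntegrable (fun r => Q (s, r)) volume x y := fun x y =>
    Continuous.intervalIntegrable (by fun_prop) _ _
  exact intervalIntegral.integral_interval_sub_left (h2 _ _) (h2 _ _)

theorem continuous_charIntegral {Q : ℝ × ℝ → ℂ} (hQ : Continuous Q) :
    Continuous (charIntegral Q) := by
  have := continuous_rectIntegral hQ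
  unfold charIntegral
  fun_prop

/-- The successive approximations (more exactly, their increments) for the Goursat problem. -/
noncomputable def goursatTerm (P : ℝ × ℝ → ℂ) (F : ℝ → ℂ) : ℕ → ℝ × ℝ → ℂ
  | 0 => fun p => F p.1
  | n + 1 => charIntegral fun p => P p * goursatTerm P F n p

variable {P : ℝ × ℝ → ℂ} {F : ℝ → ℂ}

theorem continuous_goursatTerm (hP : Continuous P) (hF : Continuous F) (n : ℕ) :
    Continuous (goursatTerm P F n) := by
  induction n with
  | zero => exact hF.comp continuous_fst
  | succ n ih => exact continuous_charIntegral (hP.mul ih)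

theorem goursatTerm_eq_zero (hP : Continuous P) (hF : Continuous F) {δ : ℝ} (hδ : 0 ≤ δ)
    (h0 : ∀ a ≤ δ, F a = 0) (n : ℕ) : ∀ a ≤ δ, ∀ b, goursatTerm P F n (a, b) = 0 := by
  induction n with
  | zero => exact fun a ha b => h0 a ha
  | succ n ih =>
    intro a ha b
    change charIntegral _ (a, b) = 0
    rw [charIntegral_eq (hP.fun_mul (continuous_goursatTerm hP hF n))]
    refine (intervalIntegral.integral_congr (g := fun _ => (0 : ℂ)) fun s hs => ?_).trans (by simp)
    have hs' : s ≤ δ := hs.2.trans (max_le hδ ha)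
    simp [ih s hs']

theorem norm_goursatTerm_le (hP : Continuous P) (hF : Continuous F)
    {R M A : ℝ} (hA : ∀ a ∈ Icc (-R) R, ‖F a‖ ≤ A)
    (hM : ∀ p ∈ Icc (-R) R ×ˢ Icc (-R) R, ‖P p‖ ≤ M) (hM0 : 0 ≤ M) (hA0 : 0 ≤ A) (n : ℕ) :
    ∀ a ∈ Icc 0 R, ∀ b ∈ Icc (-R) R,
      ‖goursatTerm P F n (a, b)‖ ≤ A * (2 * R * M) ^ n * (a ^ n / n.factorial) := by
  induction n with
  | zero =>
    intro a ha b _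
    simpa [goursatTerm] using hA a ⟨by linarith [ha.1, ha.2], ha.2⟩
  | succ n ih =>
    intro a ha b hb
    have hR : 0 ≤ R := ha.1.trans ha.2
    change ‖charIntegral _ (a, b)‖ ≤ _
    rw [charIntegral_eq (hP.fun_mul (continuous_goursatTerm hP hF n))]
    have hin : ∀ s ∈ Ioc 0 a, ‖∫ r in a..b, P (s, r) * goursatTerm P F n (s, r)‖ ≤
        A * (2 * R * M) ^ (n + 1) * (s ^ n / n.factorial) := by
      intro s hs
      have hsR : s ∈ Icc 0 R := ⟨hs.1.le, hs.2.trans ha.2⟩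
      have hs0 : 0 ≤ s := hs.1.le
      have := intervalIntegral.norm_integral_le_of_norm_le_const (a := a) (b := b)
        (f := fun r => P (s, r) * goursatTerm P F n (s, r))
        (C := M * (A * (2 * R * M) ^ n * (s ^ n / n.factorial))) fun r hr => by
          have hr' : r ∈ Icc (-R) R :=
            uIcc_subset_Icc ⟨by linarith [ha.1], ha.2⟩ hb (uIoc_subset_uIcc hr)
          rw [norm_mul]
          exact mul_le_mul (hM (s, r) ⟨⟨by linarith [hsR.1], hsR.2⟩, hr'⟩) (ih s hsR r hr')
            (norm_nonneg _) hM0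
      refine this.trans ?_
      have hab : |b - a| ≤ 2 * R := abs_le.2 ⟨by linarith [hb.1, ha.2], by linarith [hb.2, ha.1]⟩
      calc M * (A * (2 * R * M) ^ n * (s ^ n / n.factorial)) * |b - a|
          ≤ M * (A * (2 * R * M) ^ n * (s ^ n / n.factorial)) * (2 * R) := by gcongr
        _ = A * (2 * R * M) ^ (n + 1) * (s ^ n / n.factorial) := by ring
    refine (intervalIntegral.norm_integral_le_of_norm_le ha.1 (Eventually.of_forall hin)
      (Continuous.intervalIntegrable (by fun_prop) _ _)).trans (le_of_eq ?_)
    rw [intervalIntegral.integral_const_mul, intervalIntegral.integral_div, integral_pow,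
      Nat.factorial_succ]
    push_cast
    field_simp
    simp

/-- The Volterra integral equation of the Goursat problem has a continuous solution. -/
theorem exists_goursat_integral_eq (hP : Continuous P) (hF : Continuous F) {δ : ℝ} (hδ : 0 ≤ δ)
    (h0 : ∀ a ≤ δ, F a = 0) :
    ∃ V : ℝ × ℝ → ℂ, Continuous V ∧ (∀ a ≤ δ, ∀ b, V (a, b) = 0) ∧
      ∀ p, V p = F p.1 + charIntegral (fun p => P p * V p) p := by
  set T := goursatTerm P F
  have hT : ∀ n, Continuous (T n) := continuous_goursatTerm hP hF
  have bound : ∀ R : ℝ, 0 ≤ R → ∃ c : ℕ → ℝ, Summable c ∧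
      ∀ n, ∀ p ∈ Icc (-R) R ×ˢ Icc (-R) R, ‖T n p‖ ≤ c n := by
    intro R hR
    obtain ⟨A, hA⟩ := (isCompact_Icc (a := -R) (b := R)).exists_bound_of_continuousOn hF.continuousOn
    obtain ⟨M, hM⟩ := ((isCompact_Icc (a := -R) (b := R)).prod
      (isCompact_Icc (a := -R) (b := R))).exists_bound_of_continuousOn hP.continuousOn
    have hR0 : (0 : ℝ) ∈ Icc (-R) R := ⟨by linarith, hR⟩
    have hA0 : 0 ≤ A := (norm_nonneg _).trans (hA 0 hR0)
    have hM0 : 0 ≤ M := (norm_nonneg _).trans (hM (0, 0) ⟨hR0, hR0⟩)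
    refine ⟨fun n => A * ((2 * R * M * R) ^ n / n.factorial),
      (Real.summable_pow_div_factorial _).mul_left A, fun n p hp => ?_⟩
    rcases le_total p.1 0 with h | h
    · have : T n p = 0 := goursatTerm_eq_zero hP hF hδ h0 n p.1 (h.trans hδ) p.2
      rw [this, norm_zero]
      positivity
    · refine (norm_goursatTerm_le hP hF hA hM hM0 hA0 n p.1
        ⟨h, hp.1.2⟩ p.2 hp.2).trans ?_
      calc A * (2 * R * M) ^ n * (p.1 ^ n / n.factorial)
          ≤ A * (2 * R * M) ^ n * (R ^ n / n.factorial) := by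
            gcongr
            exact hp.1.2
        _ = A * ((2 * R * M * R) ^ n / n.factorial) := by rw [mul_pow _ R]; ring
  have hmem : ∀ p : ℝ × ℝ, ∃ R : ℝ, 0 ≤ R ∧ p ∈ Ioo (-R) R ×ˢ Ioo (-R) R := by
    intro p
    refine ⟨|p.1| + |p.2| + 1, by positivity, abs_lt.1 ?_, abs_lt.1 ?_⟩
    · linarith [abs_nonneg p.2]
    · linarith [abs_nonneg p.1]
  have hsum : ∀ p, Summable fun n => T n p := by
    intro p
    obtain ⟨R, hR, hp⟩ := hmem p
    obtain ⟨c, hc, hb⟩ := bound R hR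
    exact Summable.of_norm_bounded hc fun n =>
      hb n p (prod_mono Ioo_subset_Icc_self Ioo_subset_Icc_self hp)
  have hV : Continuous fun p => ∑' n, T n p := by
    rw [continuous_iff_continuousAt]
    intro p
    obtain ⟨R, hR, hp⟩ := hmem p
    obtain ⟨c, hc, hb⟩ := bound R hR
    refine (continuousOn_tsum (fun n => (hT n).continuousOn) hc hb).continuousAt ?_
    exact mem_of_superset ((isOpen_Ioo.prod isOpen_Ioo).mem_nhds hp)
      (prod_mono Ioo_subset_Icc_self Ioo_subset_Icc_self)
  refine ⟨fun p => ∑' n, T n p, hV, fun a ha b => ?_, fun p => ?_⟩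
  · simp [T, goursatTerm_eq_zero hP hF hδ h0 _ a ha b]
  obtain ⟨R, hR, hp⟩ := hmem p
  obtain ⟨c, hc, hb⟩ := bound R hR
  obtain ⟨M, hM⟩ := ((isCompact_Icc (a := -R) (b := R)).prod
      (isCompact_Icc (a := -R) (b := R))).exists_bound_of_continuousOn hP.continuousOn
  have hR0 : (0 : ℝ) ∈ Icc (-R) R := ⟨by linarith, hR⟩
  have hM0 : 0 ≤ M := (norm_nonneg _).trans (hM (0, 0) ⟨hR0, hR0⟩)
  have hp1 : p.1 ∈ Icc (-R) R := Ioo_subset_Icc_self hp.1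
  have hp2 : p.2 ∈ Icc (-R) R := Ioo_subset_Icc_self hp.2
  have hbP : ∀ n, ∀ s ∈ uIoc 0 p.1, ∀ r ∈ uIoc p.1 p.2, ‖P (s, r) * T n (s, r)‖ ≤ M * c n := by
    intro n s hs r hr
    have hsr : (s, r) ∈ Icc (-R) R ×ˢ Icc (-R) R :=
      ⟨uIcc_subset_Icc hR0 hp1 (uIoc_subset_uIcc hs),
        uIcc_subset_Icc hp1 hp2 (uIoc_subset_uIcc hr)⟩
    rw [norm_mul]
    exact mul_le_mul (hM _ hsr) (hb n _ hsr) (norm_nonneg _) hM0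
  have hinner : ∀ s ∈ uIoc 0 p.1, HasSum (fun n => ∫ r in p.1..p.2, P (s, r) * T n (s, r))
      (∫ r in p.1..p.2, P (s, r) * ∑' n, T n (s, r)) := by
    intro s hs
    refine intervalIntegral.hasSum_integral_of_dominated_convergence (fun n _ => M * c n)
      (fun n => ?_) (fun n => Eventually.of_forall fun r hr => hbP n s hs r hr)
      (Eventually.of_forall fun _ _ => hc.mul_left M) intervalIntegrable_const
      (Eventually.of_forall fun r _ => (hsum (s, r)).hasSum.mul_left _)
    have := hT n
    exact Continuous.aestronglyMeasurable (by fun_prop)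
  have houter : HasSum (fun n => T (n + 1) p) (charIntegral (fun p => P p * ∑' n, T n p) p) := by
    rw [charIntegral_eq (hP.fun_mul hV)]
    have e : ∀ n, T (n + 1) p = ∫ s in (0 : ℝ)..p.1, ∫ r in p.1..p.2, P (s, r) * T n (s, r) :=
      fun n => charIntegral_eq (hP.fun_mul (hT n)) p
    simp_rw [e]
    refine intervalIntegral.hasSum_integral_of_dominated_convergence
      (fun n _ => M * c n * |p.2 - p.1|)
      (fun n => ?_) (fun n => Eventually.of_forall fun s hs =>
        intervalIntegral.norm_integral_le_of_norm_le_const fun r hr => hbP n s hs r hr)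
      (Eventually.of_forall fun _ _ => (hc.mul_left M).mul_right _) intervalIntegrable_const
      (Eventually.of_forall fun s hs => hinner s hs)
    have := hT n
    exact (intervalIntegral.continuous_parametric_intervalIntegral_of_continuous'
      (f := fun s r => P (s, r) * T n (s, r)) (by
        simp only [Function.uncurry_def]
        fun_prop) _ _).aestronglyMeasurable
  change ∑' n, T n p = F p.1 + _
  rw [(hsum p).tsum_eq_zero_add, houter.tsum_eq]
  rfl

/-- A continuous solution of the Volterra equation with smooth data is smooth, as the integral
over a characteristic rectangle gains one derivative. -/
theorem contDiff_of_goursat_integral_eq (hP : ContDiff ℝ ∞ P) (hF : ContDiff ℝ ∞ F)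
    {V : ℝ × ℝ → ℂ} (hV : Continuous V)
    (h : ∀ p, V p = F p.1 + charIntegral (fun p => P p * V p) p) : ContDiff ℝ ∞ V := by
  refine contDiff_infty.2 fun n => ?_
  induction n with
  | zero => exact contDiff_zero.2 hV
  | succ n ih =>
    have hJ : ContDiff ℝ (n + 1) (rectIntegral fun p => P p * V p) :=
      contDiff_rectIntegral ((hP.of_le (mod_cast le_top)).mul ih)
    have e : V = fun p => F p.1 + (rectIntegral (fun p => P p * V p) p -
        rectIntegral (fun p => P p * V p) (p.1, p.1)) := funext h
    rw [e]
    push_cast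
    exact ((hF.of_le (mod_cast le_top)).comp contDiff_fst).add
      (hJ.sub (hJ.comp (contDiff_fst.prodMk contDiff_fst)))

/-- **The Goursat problem**: the equation `V_{ab} = P V` with `V = F` on the diagonal and `V = 0` on
the characteristic `a = 0`, for data `F` vanishing on `(-∞, δ]`. -/
theorem exists_goursat (hP : ContDiff ℝ ∞ P) (hF : ContDiff ℝ ∞ F) {δ : ℝ} (hδ : 0 ≤ δ)
    (h0 : ∀ a ≤ δ, F a = 0) :
    ∃ V : ℝ × ℝ → ℂ, ContDiff ℝ ∞ V ∧ (∀ a ≤ δ, ∀ b, V (a, b) = 0) ∧ (∀ a, V (a, a) = F a) ∧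
      ∀ p, partialFst (partialSnd V) p = P p * V p := by
  obtain ⟨V, hVc, hV0, hV⟩ := exists_goursat_integral_eq hP.continuous hF.continuous hδ h0
  have hVs := contDiff_of_goursat_integral_eq hP hF hVc hV
  have hQ : Continuous fun p => P p * V p := hP.continuous.mul hVc
  refine ⟨V, hVs, hV0, fun a => by rw [hV]; simp [charIntegral], fun p => ?_⟩
  have h2 : partialSnd V = primitiveFst fun p => P p * V p := by
    funext ⟨a, b⟩
    refine (hasDerivAt_partialSnd hVs a b).unique ?_
    have := (((hasDerivAt_rectIntegral_snd hQ a b).sub_const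
      (rectIntegral (fun p => P p * V p) (a, a))).const_add (F a))
    exact this.congr_of_eventuallyEq (Eventually.of_forall fun s => hV (a, s))
  have h3 := hasDerivAt_partialFst (contDiff_partialSnd hVs) p.1 p.2
  rw [h2] at h3 ⊢
  exact h3.unique (hasDerivAt_primitiveFst_fst hQ p.1 p.2)

/-- `u` is a smooth solution of `u_tt - u_xx + q u = 0` in the plane of the variables `(x, t)` that
vanishes ahead of the characteristic `x = t - δ`. -/
structure IsDelayedWave (q : ℝ → ℝ) (δ : ℝ) (u : ℝ × ℝ → ℂ) : Prop where
  contDiff : ContDiff ℝ ∞ u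
  equation : ∀ p, partialSnd (partialSnd u) p = partialFst (partialFst u) p - q p.1 * u p
  eq_zero : ∀ x t, t - x ≤ δ → u (x, t) = 0

/-- The change of variables `(x, t) ↦ (t - x, c (x + t) + l)`, `c = ±1`, turns a solution of the
Goursat problem into a wave: `c = 1` serves the forward and `c = -1` the sideways problem. -/
theorem isDelayedWave_of_goursat {q : ℝ → ℝ} {V : ℝ × ℝ → ℂ} {δ c l : ℝ} (hc : c * c = 1)
    (hVs : ContDiff ℝ ∞ V) (hV0 : ∀ a ≤ δ, ∀ b, V (a, b) = 0)
    (hV : ∀ p : ℝ × ℝ, partialFst (partialSnd V) (p.2 - p.1, c * p.1 + c * p.2 + l) =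
      -(c / 4) * q p.1 * V (p.2 - p.1, c * p.1 + c * p.2 + l)) :
    IsDelayedWave q δ fun p => V (p.2 - p.1, c * p.1 + c * p.2 + l) := by
  have hA : ∀ p : ℝ × ℝ, p.2 - p.1 = (-1) * p.1 + 1 * p.2 + 0 := fun p => by ring
  have h1 : ∀ f : ℝ × ℝ → ℂ, ContDiff ℝ ∞ f →
      partialFst (fun p => f (p.2 - p.1, c * p.1 + c * p.2 + l)) =
        fun p => (-partialFst f + c • partialSnd f) (p.2 - p.1, c * p.1 + c * p.2 + l) := by
    intro f hf
    funext p
    simp only [hA, (fderiv_comp_affine hf (-1) 1 c c 0 l p).1]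
    simp
  have h2 : ∀ f : ℝ × ℝ → ℂ, ContDiff ℝ ∞ f →
      partialSnd (fun p => f (p.2 - p.1, c * p.1 + c * p.2 + l)) =
        fun p => (partialFst f + c • partialSnd f) (p.2 - p.1, c * p.1 + c * p.2 + l) := by
    intro f hf
    funext p
    simp only [hA, (fderiv_comp_affine hf (-1) 1 c c 0 l p).2]
    simp
  have s1 := contDiff_partialFst hVs
  have s2 := contDiff_partialSnd hVs
  have lin1 : ∀ (f g : ℝ × ℝ → ℂ) (p : ℝ × ℝ), ContDiff ℝ ∞ f → ContDiff ℝ ∞ g →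
      ∀ k : ℝ, partialFst (k • f + c • g) p = k • partialFst f p + c • partialFst g p := by
    intro f g p hf hg k
    have df := hf.differentiable (by simp) p
    have dg := hg.differentiable (by simp) p
    simp only [partialFst]
    rw [fderiv_add (df.const_smul k) (dg.const_smul c), fderiv_const_smul df,
      fderiv_const_smul dg]
    simp
  have lin2 : ∀ (f g : ℝ × ℝ → ℂ) (p : ℝ × ℝ), ContDiff ℝ ∞ f → ContDiff ℝ ∞ g →
      ∀ k : ℝ, partialSnd (k • f + c • g) p = k • partialSnd f p + c • partialSnd g p := by
    intro f g p hf hg k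
    have df := hf.differentiable (by simp) p
    have dg := hg.differentiable (by simp) p
    simp only [partialSnd]
    rw [fderiv_add (df.const_smul k) (dg.const_smul c), fderiv_const_smul df,
      fderiv_const_smul dg]
    simp
  refine ⟨hVs.comp (by fun_prop), fun p => ?_, fun x t h => hV0 _ h _⟩
  rw [h1 V hVs, h2 V hVs, h1 (-partialFst V + c • partialSnd V) (s1.neg.add (s2.const_smul c)),
    h2 (partialFst V + c • partialSnd V) (s1.add (s2.const_smul c))]
  have e1 := lin1 (partialFst V) (partialSnd V) (p.2 - p.1, c * p.1 + c * p.2 + l) s1 s2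
  have e2 := lin2 (partialFst V) (partialSnd V) (p.2 - p.1, c * p.1 + c * p.2 + l) s1 s2
  have e1a := e1 1
  have e1b := e1 (-1)
  have e2a := e2 1
  have e2b := e2 (-1)
  simp only [one_smul, neg_smul] at e1a e1b e2a e2b
  simp only [Pi.add_apply, Pi.neg_apply, Pi.smul_apply, e1a, e1b, e2a, e2b,
    ← partialFst_partialSnd hVs, hV p, Complex.real_smul]
  have hc' : (c : ℂ) * c = 1 := by exact_mod_cast hc
  linear_combination (-(q p.1 : ℂ) * V (p.2 - p.1, c * p.1 + c * p.2 + l)) * hc'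

/-- The forward problem: a wave with prescribed values at the endpoint `x = 0`. -/
theorem exists_isDelayedWave_boundary {q : ℝ → ℝ} (hq : ContDiff ℝ ∞ q) (hF : ContDiff ℝ ∞ F)
    {δ : ℝ} (hδ : 0 ≤ δ) (h0 : ∀ t ≤ δ, F t = 0) :
    ∃ u, IsDelayedWave q δ u ∧ ∀ t, u (0, t) = F t := by
  obtain ⟨V, hVs, hV0, hVd, hV⟩ := exists_goursat
    (P := fun p => -(1 / 4) * (q ((p.2 - p.1) / 2) : ℂ))
    (contDiff_const.mul (Complex.ofRealCLM.contDiff.comp (hq.comp (by fun_prop)))) hF hδ h0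
  refine ⟨_, isDelayedWave_of_goursat (c := 1) (l := 0) (by norm_num) hVs hV0 fun p => ?_,
    fun t => ?_⟩
  · rw [hV]
    have : (1 * p.1 + 1 * p.2 + 0 - (p.2 - p.1)) / 2 = p.1 := by ring
    simp only [this]
    push_cast
    ring
  · simp [hVd]

/-- The sideways problem: a wave with a prescribed state at the instant `t = T`. The roles of `x`
and `t` are exchanged, which only reverses the sign of the potential. -/
theorem exists_isDelayedWave_final {q : ℝ → ℝ} (hq : ContDiff ℝ ∞ q) {y : ℝ → ℂ}
    (hy : ContDiff ℝ ∞ y) {δ T : ℝ} (hδ : 0 ≤ δ) (h0 : ∀ x, T - δ ≤ x → y x = 0) :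
    ∃ u, IsDelayedWave q δ u ∧ ∀ x, u (x, T) = y x := by
  obtain ⟨V, hVs, hV0, hVd, hV⟩ := exists_goursat (F := fun s => y (T - s))
    (P := fun p => 1 / 4 * (q (T - (p.1 + p.2) / 2) : ℂ))
    (contDiff_const.mul (Complex.ofRealCLM.contDiff.comp (hq.comp (by fun_prop))))
    (hy.comp (by fun_prop)) hδ (fun s hs => h0 _ (by linarith))
  refine ⟨_, isDelayedWave_of_goursat (c := -1) (l := 2 * T) (by norm_num) hVs hV0 fun p => ?_,
    fun x => ?_⟩
  · rw [hV]
    have : T - (p.2 - p.1 + (-1 * p.1 + -1 * p.2 + 2 * T)) / 2 = p.1 := by ring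
    simp only [this]
    push_cast
    ring
  · have : -1 * x + -1 * T + 2 * T = T - x := by ring
    simp only [this, hVd]
    congr 1
    ring

end Goursat

/-! ### The Friedrichs extension of a positive definite operator -/

section Friedrichs

variable {E : Type*} [NormedAddCommGroup E] [InnerProductSpace ℂ E] {A : E →ₗ.[ℂ] E}

/-- A positive definite operator is symmetric, by polarization. -/
theorem IsPositiveDefinite.inner_symm (hA : IsPositiveDefinite A) (x y : A.domain) :
    inner ℂ (A x) (y : E) = inner ℂ (x : E) (A y) := by
  obtain ⟨κ, -, h⟩ := hA
  have h1 := (h (x + y)).1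
  have h2 := (h (x + Complex.I • y)).1
  have hx := (h x).1
  have hy := (h y).1
  simp only [LinearPMap.map_add, LinearPMap.map_smul, Submodule.coe_add, Submodule.coe_smul,
    inner_add_left, inner_add_right, inner_smul_left, inner_smul_right, Complex.add_im,
    Complex.mul_im, Complex.conj_I, Complex.I_re, Complex.I_im, Complex.neg_re, Complex.neg_im,
    Complex.mul_re, Complex.add_re] at h1 h2
  rw [← inner_conj_symm]
  apply Complex.ext
  · rw [Complex.conj_re]; linarith
  · rw [Complex.conj_im]; linarith

/-- The energy form `(x, A y)` of a positive definite operator. -/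
noncomputable abbrev energyCore (hA : IsPositiveDefinite A) : PreInnerProductSpace.Core ℂ A.domain where
  inner x y := inner ℂ (x : E) (A y)
  conj_inner_symm x y := by rw [inner_conj_symm, hA.inner_symm]
  re_inner_nonneg x := by
    obtain ⟨κ, hκ, h⟩ := hA
    exact (mul_nonneg hκ.le (sq_nonneg _)).trans (h x).2
  add_left x y z := by simp
  smul_left x y r := by simp [mul_comm]

theorem IsPositiveDefinite.norm_energy_sq_le (hA : IsPositiveDefinite A) (x y : A.domain) :
    ‖inner ℂ (x : E) (A y)‖ ^ 2 ≤ (inner ℂ (x : E) (A x)).re * (inner ℂ (y : E) (A y)).re := by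
  have h := @InnerProductSpace.Core.inner_mul_inner_self_le ℂ A.domain _ _ _ (energyCore hA) x y
  have e : ‖inner ℂ (y : E) (A x)‖ = ‖inner ℂ (x : E) (A y)‖ := by
    rw [← hA.inner_symm, norm_inner_symm]
  change ‖inner ℂ (x : E) (A y)‖ * ‖inner ℂ (y : E) (A x)‖ ≤ _ at h
  rw [e] at h
  rw [sq]
  exact h

/-- Sequences that are Cauchy in the energy norm. -/
def IsEnergyCauchy (A : E →ₗ.[ℂ] E) (s : ℕ → A.domain) : Prop :=
  Tendsto (fun k : ℕ × ℕ => inner ℂ ((s k.1 - s k.2 : A.domain) : E) (A (s k.1 - s k.2)))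
      atTop (𝓝 0)

theorem IsEnergyCauchy.exists_forall_norm_le {s : ℕ → A.domain} (hs : IsEnergyCauchy A s) {ε : ℝ}
    (hε : 0 < ε) : ∃ N, ∀ m n, N ≤ m → N ≤ n →
      (inner ℂ ((s m - s n : A.domain) : E) (A (s m - s n))).re ≤ ε := by
  obtain ⟨⟨N₁, N₂⟩, hN⟩ := Metric.tendsto_atTop.1 hs ε hε
  refine ⟨max N₁ N₂, fun m n hm hn => ?_⟩
  have := hN (m, n) ⟨(le_max_left _ _).trans hm, (le_max_right _ _).trans hn⟩
  rw [dist_zero_right] at this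
  exact (Complex.re_le_norm _).trans this.le

theorem IsEnergyCauchy.exists_forall_norm_inner_le (hA : IsPositiveDefinite A)
    {s s' : ℕ → A.domain} (hs : IsEnergyCauchy A s) (hs' : IsEnergyCauchy A s') {ε : ℝ}
    (hε : 0 < ε) : ∃ N, ∀ m m' n, N ≤ m → N ≤ m' → N ≤ n →
      ‖inner ℂ ((s m - s m' : A.domain) : E) (A (s' n))‖ ≤ ε := by
  have hnn : ∀ x : A.domain, 0 ≤ (inner ℂ (x : E) (A x)).re := (energyCore hA).re_inner_nonneg
  obtain ⟨N₁, h₁⟩ := hs'.exists_forall_norm_le one_pos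
  -- the energies of the second sequence are bounded
  obtain ⟨C, hC0, hC⟩ : ∃ C, 0 < C ∧ ∀ n, N₁ ≤ n → (inner ℂ (s' n : E) (A (s' n))).re ≤ C := by
    refine ⟨2 * (1 + (inner ℂ (s' N₁ : E) (A (s' N₁))).re),
      by linarith [hnn (s' N₁)], fun n hn => ?_⟩
    have hp := hnn (s' n - s' N₁ - s' N₁)
    have h1 := h₁ n N₁ hn le_rfl
    set d := s' n - s' N₁ with hd
    have e : s' n = d + s' N₁ := by rw [hd, sub_add_cancel]
    rw [e]
    simp only [LinearPMap.map_add, LinearPMap.map_sub, Submodule.coe_add, Submodule.coe_sub,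
      inner_add_left, inner_add_right, inner_sub_left, inner_sub_right, Complex.add_re,
      Complex.sub_re] at hp h1 ⊢
    linarith
  obtain ⟨N₂, h₂⟩ := hs.exists_forall_norm_le (show 0 < ε ^ 2 / C by positivity)
  refine ⟨max N₁ N₂, fun m m' n hm hm' hn => ?_⟩
  have h3 := hA.norm_energy_sq_le (s m - s m') (s' n)
  have h4 := h₂ m m' ((le_max_right _ _).trans hm) ((le_max_right _ _).trans hm')
  have h5 := hC n ((le_max_left _ _).trans hn)
  have h6 : ‖inner ℂ ((s m - s m' : A.domain) : E) (A (s' n))‖ ^ 2 ≤ ε ^ 2 := by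
    refine h3.trans ((mul_le_mul h4 h5 (hnn _) (by positivity)).trans (le_of_eq ?_))
    field_simp
  exact (sq_le_sq₀ (norm_nonneg _) hε.le).1 h6

variable [CompleteSpace E]

theorem mem_adjoint_graph_iff (hd : Dense (A.domain : Set E)) {y z : E} :
    (y, z) ∈ A.adjoint.graph ↔ ∀ x : A.domain, inner ℂ (A x) y = inner ℂ (x : E) z := by
  rw [LinearPMap.adjoint_graph_eq_graph_adjoint hd, Submodule.mem_adjoint_iff]
  constructor
  · intro h x
    exact sub_eq_zero.1 (h x (A x) (LinearPMap.mem_graph A x))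
  · intro h a b hab
    obtain ⟨x, rfl, rfl⟩ := (LinearPMap.mem_graph_iff A).1 hab
    exact sub_eq_zero.2 (h x)

/-- If `(v, w)` belongs to the graph of the Friedrichs extension, then the energy products
`(s m, A (s' n))` of an approximating sequence `s` of `v` approach `(w, s' n)` uniformly in `n`. -/
theorem exists_forall_norm_energy_sub_le (hd : Dense (A.domain : Set E))
    (hA : IsPositiveDefinite A) {v w : E} {s s' : ℕ → A.domain}
    (hvw : (v, w) ∈ A.adjoint.graph) (hsv : Tendsto (fun n => (s n : E)) atTop (𝓝 v))
    (hs : IsEnergyCauchy A s) (hs' : IsEnergyCauchy A s') {ε : ℝ} (hε : 0 < ε) :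
    ∃ N, ∀ m n, N ≤ m → N ≤ n →
      ‖inner ℂ (s m : E) (A (s' n)) - inner ℂ w (s' n : E)‖ ≤ ε := by
  obtain ⟨N, hN⟩ := hs.exists_forall_norm_inner_le hA hs' hε
  refine ⟨N, fun m n hm hn => ?_⟩
  have e : inner ℂ w (s' n : E) = inner ℂ v (A (s' n)) := by
    rw [← inner_conj_symm, ← (mem_adjoint_graph_iff hd).1 hvw, inner_conj_symm]
  have hlim : Tendsto (fun m' => ‖inner ℂ (s m : E) (A (s' n)) - inner ℂ (s m' : E) (A (s' n))‖)
      atTop (𝓝 ‖inner ℂ (s m : E) (A (s' n)) - inner ℂ w (s' n : E)‖) := by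
    rw [e]
    exact (tendsto_const_nhds.sub (hsv.inner tendsto_const_nhds)).norm
  refine le_of_tendsto hlim ?_
  filter_upwards [eventually_ge_atTop N] with m' hm'
  have := hN m m' n hm hm' hn
  rwa [Submodule.coe_sub, inner_sub_left] at this

/-- The Friedrichs extension is symmetric. -/
theorem inner_eq_of_mem_friedrichsGraph (hd : Dense (A.domain : Set E))
    (hA : IsPositiveDefinite A) {v w v' w' : E} (h : (v, w) ∈ friedrichsGraph A)
    (h' : (v', w') ∈ friedrichsGraph A) : inner ℂ w v' = inner ℂ v w' := by
  obtain ⟨hvw, s, hsv, hs⟩ := h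
  obtain ⟨hvw', s', hsv', hs'⟩ := h'
  have key : ∀ ε : ℝ, 0 < ε → ‖inner ℂ v w' - inner ℂ w v'‖ ≤ ε := by
    intro ε hε
    obtain ⟨N, hN⟩ := exists_forall_norm_energy_sub_le hd hA hvw hsv hs hs' hε
    have h1 : ∀ m, N ≤ m → ‖inner ℂ (s m : E) w' - inner ℂ w v'‖ ≤ ε := by
      intro m hm
      have hlim : Tendsto (fun n => ‖inner ℂ (s m : E) (A (s' n)) - inner ℂ w (s' n : E)‖)
          atTop (𝓝 ‖inner ℂ (s m : E) w' - inner ℂ w v'‖) := by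
        rw [← (mem_adjoint_graph_iff hd).1 hvw' (s m)]
        simp_rw [← hA.inner_symm]
        exact ((tendsto_const_nhds.inner hsv').sub (tendsto_const_nhds.inner hsv')).norm
      refine le_of_tendsto hlim ?_
      filter_upwards [eventually_ge_atTop N] with n hn using hN m n hm hn
    refine le_of_tendsto ((hsv.inner tendsto_const_nhds).sub tendsto_const_nhds).norm ?_
    filter_upwards [eventually_ge_atTop N] with m hm using h1 m hm
  have := le_of_forall_pos_le_add (a := ‖inner ℂ v w' - inner ℂ w v'‖) (b := 0)
    fun ε hε => by simpa using key ε hε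
  exact (sub_eq_zero.1 (norm_le_zero_iff.1 this)).symm

/-- The Friedrichs extension has the lower bound of the operator. -/
theorem exists_le_inner_of_mem_friedrichsGraph (hd : Dense (A.domain : Set E))
    (hA : IsPositiveDefinite A) : ∃ κ : ℝ, 0 < κ ∧ ∀ {v w : E}, (v, w) ∈ friedrichsGraph A →
      κ * ‖v‖ ^ 2 ≤ (inner ℂ v w).re := by
  obtain ⟨κ, hκ, h⟩ := id hA
  refine ⟨κ, hκ, ?_⟩
  rintro v w ⟨hvw, s, hsv, hs⟩
  refine le_of_forall_pos_le_add fun ε hε => ?_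
  obtain ⟨N, hN⟩ := exists_forall_norm_energy_sub_le hd hA hvw hsv hs hs hε
  have e : (inner ℂ v w).re = (inner ℂ w v).re := by
    rw [← inner_conj_symm, Complex.conj_re]
  rw [e]
  refine le_of_tendsto_of_tendsto ((hsv.norm.pow 2).const_mul κ)
    (((Complex.continuous_re.tendsto _).comp (tendsto_const_nhds.inner hsv)).add_const ε) ?_
  filter_upwards [eventually_ge_atTop N] with n hn
  have h1 := (Complex.re_le_norm _).trans (hN n n hn hn)
  have h2 := (h (s n)).2
  rw [Complex.sub_re] at h1
  simp only [Function.comp_apply]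
  linarith

end Friedrichs

/-! ### Classes of functions in `L₂(0, ∞)` -/

section HalfLine

open scoped Classical in
/-- The class in `L₂(0, ∞)` of a function on the line; zero if the function is not
square-integrable on `(0, ∞)`. -/
noncomputable def halfLineClass (f : ℝ → ℂ) : HalfLineL2 :=
  if h : MemLp f 2 (volume.restrict (Ioi (0 : ℝ))) then h.toLp f else 0

theorem coeFn_halfLineClass {f : ℝ → ℂ} (h : MemLp f 2 (volume.restrict (Ioi (0 : ℝ)))) :
    halfLineClass f =ᵐ[volume.restrict (Ioi (0 : ℝ))] f := by
  rw [halfLineClass, dif_pos h]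
  exact h.coeFn_toLp

theorem eq_halfLineClass {f : ℝ → ℂ} {y : HalfLineL2}
    (h : y =ᵐ[volume.restrict (Ioi (0 : ℝ))] f) : y = halfLineClass f := by
  have hf : MemLp f 2 (volume.restrict (Ioi (0 : ℝ))) := (memLp_congr_ae h).1 (Lp.memLp y)
  exact Lp.ext (h.trans (coeFn_halfLineClass hf).symm)

/-- A function that vanishes beyond `R` coincides on `(0, ∞)` with its restriction to `(0, R]`. -/
theorem ae_eq_indicator_of_eq_zero {f : ℝ → ℂ} {R : ℝ} (h0 : ∀ x, R < x → f x = 0) :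
    f =ᵐ[volume.restrict (Ioi (0 : ℝ))] (Ioc 0 R).indicator f := by
  filter_upwards [ae_restrict_mem measurableSet_Ioi] with x hx
  by_cases h : x ≤ R
  · rw [indicator_of_mem (show x ∈ Ioc 0 R from ⟨hx, h⟩)]
  · rw [indicator_of_notMem (fun h' => h h'.2), h0 x (not_le.1 h)]

theorem restrict_Ioi_restrict_Ioc (R : ℝ) :
    (volume.restrict (Ioi (0 : ℝ))).restrict (Ioc 0 R) = volume.restrict (Ioc 0 R) := by
  rw [Measure.restrict_restrict measurableSet_Ioc, inter_eq_left.2 Ioc_subset_Ioi_self]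

theorem memLp_of_memLp_Ioc {f : ℝ → ℂ} {R : ℝ} (h0 : ∀ x, R < x → f x = 0)
    (hf : MemLp f 2 (volume.restrict (Ioc 0 R))) : MemLp f 2 (volume.restrict (Ioi (0 : ℝ))) := by
  rw [memLp_congr_ae (ae_eq_indicator_of_eq_zero h0), memLp_indicator_iff_restrict measurableSet_Ioc,
    restrict_Ioi_restrict_Ioc]
  exact hf

theorem ContinuousOn.memLp_Ioc {f : ℝ → ℂ} {R : ℝ} (hf : ContinuousOn f (Icc 0 R)) :
    MemLp f 2 (volume.restrict (Ioc 0 R)) := by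
  obtain ⟨C, hC⟩ := isCompact_Icc.exists_bound_of_continuousOn hf
  refine MemLp.of_bound ((hf.mono Ioc_subset_Icc_self).aestronglyMeasurable measurableSet_Ioc) C ?_
  filter_upwards [ae_restrict_mem measurableSet_Ioc] with x hx using hC x (Ioc_subset_Icc_self hx)

theorem memLp_of_continuousOn {f : ℝ → ℂ} {R : ℝ} (hf : ContinuousOn f (Icc 0 R))
    (h0 : ∀ x, R < x → f x = 0) : MemLp f 2 (volume.restrict (Ioi (0 : ℝ))) :=
  memLp_of_memLp_Ioc h0 hf.memLp_Ioc

theorem norm_halfLineClass_le {f : ℝ → ℂ} {R C : ℝ} (hR : 0 ≤ R) (hC : 0 ≤ C)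
    (h0 : ∀ x, R < x → f x = 0) (hf : ∀ x ∈ Ioc 0 R, ‖f x‖ ≤ C) :
    ‖halfLineClass f‖ ≤ Real.sqrt R * C := by
  by_cases h : MemLp f 2 (volume.restrict (Ioi (0 : ℝ)))
  swap
  · rw [halfLineClass, dif_neg h, norm_zero]
    positivity
  rw [halfLineClass, dif_pos h, Lp.norm_toLp]
  refine ENNReal.toReal_le_of_le_ofReal (by positivity) ?_
  rw [eLpNorm_congr_ae (ae_eq_indicator_of_eq_zero h0),
    eLpNorm_indicator_eq_eLpNorm_restrict measurableSet_Ioc, restrict_Ioi_restrict_Ioc]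
  refine (eLpNorm_le_of_ae_bound (C := C) ?_).trans (le_of_eq ?_)
  · filter_upwards [ae_restrict_mem measurableSet_Ioc] with x hx using hf x hx
  · rw [Measure.restrict_apply_univ, Real.volume_Ioc, sub_zero, ENNReal.ofReal_mul (by positivity),
      Real.sqrt_eq_rpow, ENNReal.ofReal_rpow_of_nonneg hR (by positivity)]
    norm_num

theorem inner_eq_integral {y y' : HalfLineL2} {f f' : ℝ → ℂ}
    (h : y =ᵐ[volume.restrict (Ioi (0 : ℝ))] f) (h' : y' =ᵐ[volume.restrict (Ioi (0 : ℝ))] f') :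
    inner ℂ y y' = ∫ x in Ioi 0, star (f x) * f' x := by
  rw [L2.inner_def]
  refine integral_congr_ae ?_
  filter_upwards [h, h'] with x hx hx'
  rw [hx, hx', RCLike.inner_apply, mul_comm]
  rfl

theorem integral_Ioi_eq_intervalIntegral {f : ℝ → ℂ} {R : ℝ} (hR : 0 ≤ R)
    (h0 : ∀ᵐ x, R < x → f x = 0) : ∫ x in Ioi 0, f x = ∫ x in (0 : ℝ)..R, f x := by
  rw [intervalIntegral.integral_of_le hR]
  refine (setIntegral_eq_of_subset_of_ae_sdiff_eq_zero measurableSet_Ioi.nullMeasurableSet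
    Ioc_subset_Ioi_self ?_)
  filter_upwards [h0] with x hx h
  exact hx (not_le.1 fun h' => h.2 ⟨h.1, h'⟩)

/-- Continuous functions on `[0, ∞)` that agree almost everywhere agree everywhere. -/
theorem eqOn_Ici_of_ae_eq {f g : ℝ → ℂ} (h : f =ᵐ[volume.restrict (Ioi (0 : ℝ))] g)
    (hf : ContinuousOn f (Ici 0)) (hg : ContinuousOn g (Ici 0)) : EqOn f g (Ici 0) := by
  rw [restrict_Ioi_eq_restrict_Ici] at h
  exact Measure.eqOn_of_ae_eq h hf hg (by simp)

end HalfLine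

/-! ### Integration by parts for Sobolev functions -/

section Parts

theorem integral_primitive_mul {φ γ : ℝ → ℂ} {X : ℝ} (hX : 0 ≤ X)
    (hφ : IntervalIntegrable φ volume 0 X) (hγ : IntervalIntegrable γ volume 0 X) :
    ∫ x in (0 : ℝ)..X, (∫ t in (0 : ℝ)..x, φ t) * γ x =
      ∫ t in (0 : ℝ)..X, φ t * ∫ x in t..X, γ x := by
  have hφ' := (intervalIntegrable_iff_integrableOn_Ioc_of_le hX).1 hφ
  have hγ' := (intervalIntegrable_iff_integrableOn_Ioc_of_le hX).1 hγ
  have hprod : Integrable (fun z : ℝ × ℝ => φ z.1 * γ z.2)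
      ((volume.restrict (Ioc 0 X)).prod (volume.restrict (Ioc 0 X))) := hφ'.mul_prod hγ'
  have hS : MeasurableSet {z : ℝ × ℝ | z.1 ≤ z.2} := measurableSet_le measurable_fst measurable_snd
  have hswap := integral_integral_swap (f := fun t x => {z : ℝ × ℝ | z.1 ≤ z.2}.indicator
    (fun z : ℝ × ℝ => φ z.1 * γ z.2) (t, x)) (hprod.indicator hS)
  rw [intervalIntegral.integral_of_le hX, intervalIntegral.integral_of_le hX]
  refine Eq.trans ?_ (hswap.symm.trans ?_)
  · refine setIntegral_congr_fun measurableSet_Ioc fun x hx => ?_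
    have e : ∀ t, {z : ℝ × ℝ | z.1 ≤ z.2}.indicator (fun z : ℝ × ℝ => φ z.1 * γ z.2) (t, x) =
        (Iic x).indicator (fun t => φ t * γ x) t := fun t => by
      by_cases h : t ≤ x <;> simp [indicator, h]
    simp only [e]
    rw [setIntegral_indicator measurableSet_Iic, Ioc_inter_Iic, min_eq_right hx.2,
      integral_mul_const, intervalIntegral.integral_of_le hx.1.le]
  · refine setIntegral_congr_fun measurableSet_Ioc fun t ht => ?_
    have e : ∀ x, {z : ℝ × ℝ | z.1 ≤ z.2}.indicator (fun z : ℝ × ℝ => φ z.1 * γ z.2) (t, x) =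
        (Ici t).indicator (fun x => φ t * γ x) x := fun x => by
      by_cases h : t ≤ x <;> simp [indicator, h]
    simp only [e]
    rw [setIntegral_indicator measurableSet_Ici]
    have hI : Ioc 0 X ∩ Ici t = Icc t X := by
      ext x
      simp only [mem_inter_iff, mem_Ioc, mem_Ici, mem_Icc]
      exact ⟨fun h => ⟨h.2, h.1.2⟩, fun h => ⟨⟨ht.1.trans_le h.1, h.2⟩, h.1⟩⟩
    rw [hI, integral_const_mul, intervalIntegral.integral_of_le ht.2, integral_Icc_eq_integral_Ioc]

/-- Integration by parts for functions that are primitives of integrable functions. -/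
theorem integral_deriv_mul_add_of_primitive {u u' v v' : ℝ → ℂ} {X : ℝ} (hX : 0 ≤ X)
    (hu' : IntervalIntegrable u' volume 0 X) (hv' : IntervalIntegrable v' volume 0 X)
    (hu : ∀ x ∈ Icc 0 X, u x = u 0 + ∫ t in (0 : ℝ)..x, u' t)
    (hv : ∀ x ∈ Icc 0 X, v x = v 0 + ∫ t in (0 : ℝ)..x, v' t) :
    ∫ x in (0 : ℝ)..X, (u' x * v x + u x * v' x) = u X * v X - u 0 * v 0 := by
  have hsub : ∀ x ∈ Icc 0 X, uIcc 0 x ⊆ uIcc 0 X := fun x hx => by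
    rw [uIcc_of_le hx.1, uIcc_of_le hX]
    exact Icc_subset_Icc_right hx.2
  have hsub' : ∀ x ∈ Icc 0 X, uIcc x X ⊆ uIcc 0 X := fun x hx => by
    rw [uIcc_of_le hx.2, uIcc_of_le hX]
    exact Icc_subset_Icc_left hx.1
  have hcu : ContinuousOn (fun x => ∫ t in (0 : ℝ)..x, u' t) (uIcc 0 X) :=
    intervalIntegral.continuousOn_primitive_interval
      ((intervalIntegrable_iff' (by finiteness)).1 hu')
  have hcv : ContinuousOn (fun x => ∫ t in (0 : ℝ)..x, v' t) (uIcc 0 X) :=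
    intervalIntegral.continuousOn_primitive_interval
      ((intervalIntegrable_iff' (by finiteness)).1 hv')
  have hXm : X ∈ Icc 0 X := ⟨hX, le_rfl⟩
  have hswap := integral_primitive_mul hX hu' hv'
  have e1 : ∫ t in (0 : ℝ)..X, u' t * ∫ x in t..X, v' x =
      (∫ t in (0 : ℝ)..X, u' t) * (∫ t in (0 : ℝ)..X, v' t) -
        ∫ t in (0 : ℝ)..X, u' t * ∫ x in (0 : ℝ)..t, v' x := by
    rw [← intervalIntegral.integral_mul_const, ← intervalIntegral.integral_sub
      (hu'.mul_const _) (hu'.mul_continuousOn hcv)]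
    refine intervalIntegral.integral_congr fun t ht => ?_
    rw [uIcc_of_le hX] at ht
    rw [← intervalIntegral.integral_interval_sub_left hv' (hv'.mono_set (hsub t ht))]
    ring
  have e2 : ∫ x in (0 : ℝ)..X, (u' x * v x + u x * v' x) =
      ∫ x in (0 : ℝ)..X, ((u' x * v 0 + u 0 * v' x) +
        (u' x * (∫ t in (0 : ℝ)..x, v' t) + (∫ t in (0 : ℝ)..x, u' t) * v' x)) := by
    refine intervalIntegral.integral_congr fun x hx => ?_
    rw [uIcc_of_le hX] at hx
    rw [hu x hx, hv x hx]
    ring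
  rw [e2, intervalIntegral.integral_add, intervalIntegral.integral_add,
    intervalIntegral.integral_add, intervalIntegral.integral_mul_const,
    intervalIntegral.integral_const_mul, hswap, e1, hu X hXm, hv X hXm]
  · ring
  · exact hu'.mul_continuousOn hcv
  · exact hv'.continuousOn_mul hcu
  · exact hu'.mul_const _
  · exact hv'.const_mul _
  · exact (hu'.mul_const _).add (hv'.const_mul _)
  · exact (hu'.mul_continuousOn hcv).add (hv'.continuousOn_mul hcu)

namespace IsSobolevTwoLoc

variable {f f₁ f₂ g g₁ g₂ : ℝ → ℂ}

theorem star (hg : IsSobolevTwoLoc g g₁ g₂) :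
    IsSobolevTwoLoc (fun x => star (g x)) (fun x => star (g₁ x)) (fun x => star (g₂ x)) := by
  have e : ∀ (h : ℝ → ℂ) (x : ℝ), ∫ t in (0 : ℝ)..x, Star.star (h t) =
      Star.star (∫ t in (0 : ℝ)..x, h t) := fun h x => by
    simp only [intervalIntegral.intervalIntegral_eq_integral_uIoc, Complex.star_def]
    rw [integral_conj]
    split_ifs <;> simp
  refine ⟨fun R => (hg.memLp R).star, fun x hx => ?_, fun x hx => ?_⟩
  · rw [hg.eq_integral_one x hx, star_add, e]
  · rw [hg.eq_integral_zero x hx, star_add, e]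

theorem continuousOn_zero (hg : IsSobolevTwoLoc g g₁ g₂) (x : ℝ) :
    ContinuousOn g (Icc 0 x) := by
  rcases lt_or_ge x 0 with h | h
  · simp [Icc_eq_empty_of_lt h]
  have := intervalIntegral.continuousOn_primitive_interval (μ := volume) (a := 0) (b := x)
    (f := g₁) (by
      rw [uIcc_of_le h, ← intervalIntegrable_iff_integrableOn_Icc_of_le h]
      exact hg.intervalIntegrable_one h)
  rw [uIcc_of_le h] at this
  exact (continuousOn_const.add this).congr fun y hy => hg.eq_integral_zero y hy.1

theorem continuousOn_Ici (hg : IsSobolevTwoLoc g g₁ g₂) : ContinuousOn g (Ici 0) := by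
  intro x hx
  have hx' : (0 : ℝ) ≤ x := hx
  refine ((hg.continuousOn_zero (x + 1)) x ⟨hx', by linarith⟩).mono_of_mem_nhdsWithin ?_
  rw [← Ici_inter_Iic]
  exact inter_mem self_mem_nhdsWithin (mem_nhdsWithin_of_mem_nhds (Iic_mem_nhds (by linarith)))

theorem of_contDiff (hf : ContDiff ℝ ∞ f) : IsSobolevTwoLoc f (deriv f) (deriv (deriv f)) := by
  have h1 : ContDiff ℝ ∞ (deriv f) := (contDiff_infty_iff_deriv.1 hf).2
  have h2 : ContDiff ℝ ∞ (deriv (deriv f)) := (contDiff_infty_iff_deriv.1 h1).2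
  refine ⟨fun R => ?_, fun x _ => ?_, fun x _ => ?_⟩
  · exact (h2.continuous.continuousOn.memLp_Ioc (R := R)).mono_measure
      (Measure.restrict_mono Ioo_subset_Ioc_self le_rfl)
  · rw [intervalIntegral.integral_deriv_eq_sub (fun x _ => h1.differentiable (by simp) x)
      (h2.continuous.intervalIntegrable _ _)]
    ring
  · rw [intervalIntegral.integral_deriv_eq_sub (fun x _ => hf.differentiable (by simp) x)
      (h1.continuous.intervalIntegrable _ _)]
    ring

/-- **Green's formula** on a bounded interval. -/
theorem green (hf : IsSobolevTwoLoc f f₁ f₂) (hg : IsSobolevTwoLoc g g₁ g₂) {X : ℝ} (hX : 0 ≤ X) :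
    ∫ x in (0 : ℝ)..X, (f₂ x * g x - f x * g₂ x) =
      (f₁ X * g X - f X * g₁ X) - (f₁ 0 * g 0 - f 0 * g₁ 0) := by
  have i1 := integral_deriv_mul_add_of_primitive hX (hf.intervalIntegrable_two hX)
    (hg.intervalIntegrable_one hX) (fun x hx => hf.eq_integral_one x hx.1)
    (fun x hx => hg.eq_integral_zero x hx.1)
  have i2 := integral_deriv_mul_add_of_primitive hX (hf.intervalIntegrable_one hX)
    (hg.intervalIntegrable_two hX) (fun x hx => hf.eq_integral_zero x hx.1)
    (fun x hx => hg.eq_integral_one x hx.1)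
  have cf := hf.continuousOn_zero X
  have cf1 := hf.continuousOn_one X
  have cg := hg.continuousOn_zero X
  have cg1 := hg.continuousOn_one X
  rw [← uIcc_of_le hX] at cf cf1 cg cg1
  have k1 : IntervalIntegrable (fun x => f₂ x * g x + f₁ x * g₁ x) volume 0 X :=
    ((hf.intervalIntegrable_two hX).mul_continuousOn cg).add
      ((hg.intervalIntegrable_one hX).continuousOn_mul cf1)
  have k2 : IntervalIntegrable (fun x => f₁ x * g₁ x + f x * g₂ x) volume 0 X :=
    ((hf.intervalIntegrable_one hX).mul_continuousOn cg1).add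
      ((hg.intervalIntegrable_two hX).continuousOn_mul cf)
  have := intervalIntegral.integral_sub k1 k2
  rw [i1, i2] at this
  calc _ = ∫ x in (0 : ℝ)..X, ((f₂ x * g x + f₁ x * g₁ x) - (f₁ x * g₁ x + f x * g₂ x)) :=
        intervalIntegral.integral_congr fun x _ => by ring
    _ = _ := by rw [this]; ring

end IsSobolevTwoLoc

end Parts

/-! ### The maximal Sturm-Liouville operator -/

section SturmLiouville

/-- `(y, z)` belongs to the graph of the maximal operator: `y` is the class of `g ∈ H²_loc([0, ∞))`
with derivatives `g₁`, `g₂`, and `z = -g'' + q g`. -/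
structure MaximalPair (q : ℝ → ℝ) (y z : HalfLineL2) (g g₁ g₂ : ℝ → ℂ) : Prop where
  sobolev : IsSobolevTwoLoc g g₁ g₂
  ae_fst : y =ᵐ[volume.restrict (Ioi (0 : ℝ))] g
  ae_snd : z =ᵐ[volume.restrict (Ioi (0 : ℝ))] fun x => -g₂ x + q x * g x

/-- The differential expression `-f'' + q f`. -/
noncomputable def slExpr (q : ℝ → ℝ) (f : ℝ → ℂ) (x : ℝ) : ℂ := -deriv (deriv f) x + q x * f x

variable {q : ℝ → ℝ}

theorem mem_sturmLiouvilleGraph_iff {y z : HalfLineL2} :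
    (y, z) ∈ sturmLiouvilleGraph q ↔
      ∃ g g₁ g₂, MaximalPair q y z g g₁ g₂ ∧ g 0 = 0 ∧ g₁ 0 = 0 :=
  ⟨fun ⟨g, g₁, g₂, hg, h0, h1, hy, hz⟩ => ⟨g, g₁, g₂, ⟨hg, hy, hz⟩, h0, h1⟩,
    fun ⟨g, g₁, g₂, ⟨hg, hy, hz⟩, h0, h1⟩ => ⟨g, g₁, g₂, hg, h0, h1, hy, hz⟩⟩

theorem sturmLiouville_congr {p : ℝ → ℝ} (h : EqOn p q (Ici 0)) :
    sturmLiouville p = sturmLiouville q := by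
  have key : ∀ {p q : ℝ → ℝ}, EqOn p q (Ici 0) →
      sturmLiouvilleGraph p ≤ sturmLiouvilleGraph q := by
    rintro p q h ⟨y, z⟩ ⟨g, g₁, g₂, hg, h0, h1, hy, hz⟩
    refine ⟨g, g₁, g₂, hg, h0, h1, hy, hz.trans ?_⟩
    filter_upwards [ae_restrict_mem measurableSet_Ioi] with x hx
    rw [h (mem_Ici.2 (le_of_lt hx))]
  rw [sturmLiouville, sturmLiouville, le_antisymm (key h) (key h.symm)]

theorem exists_domain_of_mem {y z : HalfLineL2} (h : (y, z) ∈ sturmLiouvilleGraph q) :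
    ∃ x : (sturmLiouville q).domain, (x : HalfLineL2) = y ∧ sturmLiouville q x = z := by
  rw [← sturmLiouville_graph] at h
  exact (LinearPMap.mem_graph_iff _).1 h

theorem mem_graph_of_domain (x : (sturmLiouville q).domain) :
    ((x : HalfLineL2), sturmLiouville q x) ∈ sturmLiouvilleGraph q := by
  rw [← sturmLiouville_graph]
  exact LinearPMap.mem_graph _ x

theorem inner_symm_of_mem (hpos : IsPositiveDefinite (sturmLiouville q)) {a b a' b' : HalfLineL2}
    (h : (a, b) ∈ sturmLiouvilleGraph q) (h' : (a', b') ∈ sturmLiouvilleGraph q) :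
    inner ℂ b a' = inner ℂ a b' := by
  obtain ⟨x, rfl, rfl⟩ := exists_domain_of_mem h
  obtain ⟨x', rfl, rfl⟩ := exists_domain_of_mem h'
  exact hpos.inner_symm x x'

namespace MaximalPair

variable {y z y' z' : HalfLineL2} {f f₁ f₂ g g₁ g₂ : ℝ → ℂ}

theorem add (h : MaximalPair q y z g g₁ g₂) (h' : MaximalPair q y' z' f f₁ f₂) :
    MaximalPair q (y + y') (z + z') (g + f) (g₁ + f₁) (g₂ + f₂) := by
  refine ⟨h.sobolev.add h'.sobolev, (Lp.coeFn_add y y').trans (h.ae_fst.add h'.ae_fst),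
    (Lp.coeFn_add z z').trans ((h.ae_snd.add h'.ae_snd).trans ?_)⟩
  exact Eventually.of_forall fun x => by simp only [Pi.add_apply]; ring

theorem smul (c : ℂ) (h : MaximalPair q y z g g₁ g₂) :
    MaximalPair q (c • y) (c • z) (c • g) (c • g₁) (c • g₂) := by
  refine ⟨h.sobolev.smul c, (Lp.coeFn_smul c y).trans (h.ae_fst.const_smul c),
    (Lp.coeFn_smul c z).trans ((h.ae_snd.const_smul c).trans ?_)⟩
  exact Eventually.of_forall fun x => by simp only [Pi.smul_apply, smul_eq_mul]; ring

theorem sub (h : MaximalPair q y z g g₁ g₂) (h' : MaximalPair q y' z' f f₁ f₂) :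
    MaximalPair q (y - y') (z - z') (g - f) (g₁ - f₁) (g₂ - f₂) := by
  simpa [sub_eq_add_neg] using h.add (h'.smul (-1))

theorem of_contDiff (hq : Continuous q) (hf : ContDiff ℝ ∞ f) {R : ℝ}
    (h0 : ∀ x, R < x → f x = 0) :
    MaximalPair q (halfLineClass f) (halfLineClass (slExpr q f)) f (deriv f) (deriv (deriv f)) := by
  have h1 : ∀ (u : ℝ → ℂ), (∀ x, R < x → u x = 0) → ∀ x, R < x → deriv u x = 0 := by
    intro u hu x hx
    have : u =ᶠ[𝓝 x] fun _ => 0 := by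
      filter_upwards [Ioi_mem_nhds hx] with s hs using hu s hs
    rw [this.deriv_eq, deriv_const]
  have hs := IsSobolevTwoLoc.of_contDiff hf
  have hc : ContDiff ℝ ∞ (deriv (deriv f)) :=
    (contDiff_infty_iff_deriv.1 (contDiff_infty_iff_deriv.1 hf).2).2
  have hc' : Continuous (slExpr q f) := by
    have := hc.continuous
    have := hf.continuous
    unfold slExpr
    fun_prop
  refine ⟨hs, coeFn_halfLineClass (memLp_of_continuousOn hf.continuous.continuousOn h0),
    coeFn_halfLineClass (memLp_of_continuousOn (R := R) hc'.continuousOn fun x hx => ?_)⟩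
  simp [slExpr, h1 _ (h1 f h0) x hx, h0 x hx]

/-- **Green's formula** for the maximal operator and a smooth function with bounded support. -/
theorem inner_sub_inner (hq : Continuous q) (h : MaximalPair q y z g g₁ g₂)
    (hf : ContDiff ℝ ∞ f) {R : ℝ} (h0 : ∀ x, R < x → f x = 0) :
    inner ℂ z (halfLineClass f) - inner ℂ y (halfLineClass (slExpr q f)) =
      star (g₁ 0) * f 0 - star (g 0) * deriv f 0 := by
  have hp := MaximalPair.of_contDiff hq hf h0
  set X := max R 0 + 1
  have hRX : R < X := (le_max_left R 0).trans_lt (lt_add_one _)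
  have hX : 0 ≤ X := (le_max_right R 0).trans (lt_add_one _).le
  have hd : ∀ x, R < x → deriv f x = 0 ∧ deriv (deriv f) x = 0 := by
    intro x hx
    have : f =ᶠ[𝓝 x] fun _ => 0 := by
      filter_upwards [Ioi_mem_nhds hx] with s hs using h0 s hs
    exact ⟨by rw [this.deriv_eq, deriv_const], by rw [this.deriv.deriv_eq]; simp⟩
  have hgr := h.sobolev.star.green hp.sobolev hX
  have cf : ContinuousOn f (uIcc 0 X) := hf.continuous.continuousOn
  have cf2 : ContinuousOn (deriv (deriv f)) (uIcc 0 X) :=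
    ((contDiff_infty_iff_deriv.1 (contDiff_infty_iff_deriv.1 hf).2).2).continuous.continuousOn
  have cg := h.sobolev.star.continuousOn_zero X
  rw [← uIcc_of_le hX] at cg
  have cq : Continuous fun x => (q x : ℂ) := by fun_prop
  rw [inner_eq_integral h.ae_snd hp.ae_fst, inner_eq_integral h.ae_fst hp.ae_snd,
    integral_Ioi_eq_intervalIntegral hX, integral_Ioi_eq_intervalIntegral hX,
    ← intervalIntegral.integral_sub]
  · rw [(hd X hRX).1, h0 X hRX] at hgr
    have e : ∀ x, star (-g₂ x + q x * g x) * f x -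
        star (g x) * (-deriv (deriv f) x + q x * f x) =
        -(star (g₂ x) * f x - star (g x) * deriv (deriv f) x) := fun x => by
      simp only [star_add, star_neg, star_mul', Complex.star_def, Complex.conj_ofReal]
      ring
    simp_rw [e]
    rw [intervalIntegral.integral_neg, hgr]
    ring
  · simp only [star_add, star_neg, star_mul', Complex.star_def, Complex.conj_ofReal]
    exact ((h.sobolev.star.intervalIntegrable_two hX).neg.add
      ((cq.continuousOn.mul cg).intervalIntegrable)).mul_continuousOn cf
  · exact (cg.mul (cf2.neg.add (cq.continuousOn.mul cf))).intervalIntegrable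
  · exact Eventually.of_forall fun x hx => by
      simp [(hd x (hRX.trans hx)).2, h0 x (hRX.trans hx)]
  · exact Eventually.of_forall fun x hx => by simp [h0 x (hRX.trans hx)]

end MaximalPair

/-- Smooth functions with support in `[0, 1]` and prescribed Cauchy data at `0`. -/
theorem exists_contDiff_cauchy_data : ∃ A B : ℝ → ℂ, ContDiff ℝ ∞ A ∧ ContDiff ℝ ∞ B ∧
    (∀ x, 1 ≤ x → A x = 0) ∧ (∀ x, 1 ≤ x → B x = 0) ∧
    A 0 = 1 ∧ deriv A 0 = 0 ∧ B 0 = 0 ∧ deriv B 0 = 1 := by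
  let χ : ContDiffBump (0 : ℝ) := ⟨1 / 2, 1, by norm_num, by norm_num⟩
  have hχ : ContDiff ℝ ∞ fun x => (χ x : ℂ) := Complex.ofRealCLM.contDiff.comp χ.contDiff
  have h1 : ∀ x : ℝ, 1 ≤ x → χ x = 0 := fun x hx => χ.zero_of_le_dist (by
    rw [dist_zero_right]; exact hx.trans (le_abs_self x))
  have h2 : ∀ᶠ x in 𝓝 (0 : ℝ), χ x = 1 := χ.eventuallyEq_one
  refine ⟨fun x => χ x, fun x => x * χ x, hχ, Complex.ofRealCLM.contDiff.mul hχ,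
    fun x hx => by simp [h1 x hx], fun x hx => by simp [h1 x hx], by simp [h2.self_of_nhds], ?_,
    by simp, ?_⟩
  · have : (fun x => (χ x : ℂ)) =ᶠ[𝓝 0] fun _ => 1 := h2.mono fun x hx => by simp [hx]
    rw [this.deriv_eq, deriv_const]
  · have : (fun x : ℝ => (x : ℂ) * χ x) =ᶠ[𝓝 0] fun x => (x : ℂ) := h2.mono fun x hx => by simp [hx]
    rw [this.deriv_eq]
    exact (Complex.ofRealCLM.hasDerivAt (x := 0)).deriv

/-- The smooth functions with compact support in `(0, ∞)` are dense in `L₂(0, ∞)`. -/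
theorem dense_smooth_compactSupport : Dense {y : HalfLineL2 | ∃ f : ℝ → ℂ, ContDiff ℝ ∞ f ∧
    HasCompactSupport f ∧ tsupport f ⊆ Ioi 0 ∧ y =ᵐ[volume.restrict (Ioi (0 : ℝ))] f} := by
  let W : Submodule ℂ HalfLineL2 :=
    { carrier := {y : HalfLineL2 | ∃ f : ℝ → ℂ, ContDiff ℝ ∞ f ∧
        HasCompactSupport f ∧ tsupport f ⊆ Ioi 0 ∧ y =ᵐ[volume.restrict (Ioi (0 : ℝ))] f}
      zero_mem' := ⟨0, contDiff_const, HasCompactSupport.zero, by simp [tsupport],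
        Lp.coeFn_zero _ _ _⟩
      add_mem' := by
        rintro y y' ⟨f, h1, h2, h3, h4⟩ ⟨f', h1', h2', h3', h4'⟩
        exact ⟨f + f', h1.add h1', h2.add h2',
          (tsupport_add f f').trans (union_subset h3 h3'),
          (Lp.coeFn_add y y').trans (h4.add h4')⟩
      smul_mem' := by
        rintro c y ⟨f, h1, h2, h3, h4⟩
        exact ⟨c • f, h1.const_smul c, h2.smul_left (f := fun _ => c),
          (tsupport_smul_subset_right (fun _ => c) f).trans h3,
          (Lp.coeFn_smul c y).trans (h4.const_smul c)⟩ }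
  change Dense (W : Set HalfLineL2)
  rw [Submodule.dense_iff_topologicalClosure_eq_top, Submodule.topologicalClosure_eq_top_iff,
    Submodule.eq_bot_iff]
  intro y hy
  have hloc : LocallyIntegrableOn y (Ioi 0) volume :=
    locallyIntegrableOn_of_locallyIntegrable_restrict ((Lp.memLp y).locallyIntegrable (by norm_num))
  have hae := isOpen_Ioi.ae_eq_zero_of_integral_contDiff_smul_eq_zero hloc fun g hg hgs hgt => ?_
  · refine (Lp.eq_zero_iff_ae_eq_zero (f := y)).2 ((ae_restrict_iff' measurableSet_Ioi).2 hae)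
  have hgc : Continuous fun x => (g x : ℂ) := Complex.continuous_ofReal.comp hg.continuous
  have hgs' : HasCompactSupport fun x => (g x : ℂ) :=
    hgs.comp_left (g := fun r : ℝ => (r : ℂ)) Complex.ofReal_zero
  have hm : MemLp (fun x => (g x : ℂ)) 2 (volume.restrict (Ioi (0 : ℝ))) :=
    hgc.memLp_of_hasCompactSupport hgs'
  have hmem : halfLineClass (fun x => (g x : ℂ)) ∈ W :=
    ⟨_, Complex.ofRealCLM.contDiff.comp hg, hgs',
      (tsupport_comp_subset Complex.ofReal_zero g).trans hgt, coeFn_halfLineClass hm⟩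
  have := (Submodule.mem_orthogonal W y).1 hy _ hmem
  rw [inner_eq_integral (coeFn_halfLineClass hm) (ae_eq_refl _)] at this
  rw [← setIntegral_eq_integral_of_forall_compl_eq_zero (s := Ioi 0), ← this]
  · refine setIntegral_congr_fun measurableSet_Ioi fun x _ => ?_
    simp
  · intro x hx
    have : g x = 0 := image_eq_zero_of_notMem_tsupport fun h => hx (hgt h)
    simp [this]

theorem eventually_gt_eq_zero_of_hasCompactSupport {f : ℝ → ℂ} (hf : HasCompactSupport f) :
    ∃ R, ∀ x, R < x → f x = 0 := by
  obtain ⟨R, hR⟩ := hf.isCompact.bddAbove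
  exact ⟨R, fun x hx => image_eq_zero_of_notMem_tsupport fun h => (hR h).not_gt hx⟩

theorem dense_sturmLiouville_domain (hq : Continuous q) :
    Dense ((sturmLiouville q).domain : Set HalfLineL2) := by
  refine dense_smooth_compactSupport.mono ?_
  rintro y ⟨f, hf, hfs, hft, hy⟩
  obtain ⟨R, hR⟩ := eventually_gt_eq_zero_of_hasCompactSupport hfs
  have h0 : f =ᶠ[𝓝 0] fun _ => 0 :=
    notMem_tsupport_iff_eventuallyEq.1 fun h => lt_irrefl _ (mem_Ioi.1 (hft h))
  obtain ⟨x, hx, -⟩ := exists_domain_of_mem (mem_sturmLiouvilleGraph_iff.2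
    ⟨f, _, _, MaximalPair.of_contDiff hq hf hR, h0.self_of_nhds, by rw [h0.deriv_eq, deriv_const]⟩)
  rw [eq_halfLineClass hy, ← hx]
  exact x.2

end SturmLiouville

/-! ### The adjoint operator -/

section Adjoint

variable {q : ℝ → ℝ}

theorem mem_sturmLiouville_adjoint_iff (hq : Continuous q) {y z : HalfLineL2} :
    (y, z) ∈ (sturmLiouville q).adjoint.graph ↔
      ∀ a b, (a, b) ∈ sturmLiouvilleGraph q → inner ℂ b y = inner ℂ a z := by
  rw [LinearPMap.adjoint_graph_eq_graph_adjoint (dense_sturmLiouville_domain hq),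
    sturmLiouville_graph, Submodule.mem_adjoint_iff]
  simp only [sub_eq_zero]

/-- The integral of a function that is orthogonal to `1` and `x` on `(0, R)`, iterated twice,
vanishes beyond `R`. -/
theorem exists_sobolev_of_moments {k : ℝ → ℂ} {R : ℝ} (hR : 0 ≤ R)
    (hk : MemLp k 2 (volume.restrict (Ioc 0 R))) (hk0 : ∀ x, R < x → k x = 0)
    (m0 : ∫ x in (0 : ℝ)..R, k x = 0) (m1 : ∫ x in (0 : ℝ)..R, k x * (x : ℂ) = 0) :
    ∃ f f₁, IsSobolevTwoLoc f f₁ k ∧ f 0 = 0 ∧ f₁ 0 = 0 ∧ (∀ x, R ≤ x → f x = 0) ∧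
      ∀ x, R ≤ x → f₁ x = 0 := by
  have hkL : MemLp k 2 (volume.restrict (Ioi (0 : ℝ))) := memLp_of_memLp_Ioc hk0 hk
  have hkR : ∀ S : ℝ, MemLp k 2 (volume.restrict (Ioo 0 S)) := fun S =>
    hkL.mono_measure (Measure.restrict_mono Ioo_subset_Ioi_self le_rfl)
  have hs : IsSobolevTwoLoc (fun x => ∫ s in (0 : ℝ)..x, ∫ t in (0 : ℝ)..s, k t)
      (fun x => ∫ t in (0 : ℝ)..x, k t) k := ⟨hkR, by simp, by simp⟩
  have h1 : ∀ x, R ≤ x → ∫ t in (0 : ℝ)..x, k t = 0 := by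
    intro x hx
    have hi := hs.intervalIntegrable_two (hR.trans hx)
    have hs1 : uIcc 0 R ⊆ uIcc 0 x := by
      rw [uIcc_of_le hR, uIcc_of_le (hR.trans hx)]; exact Icc_subset_Icc_right hx
    have hs2 : uIcc R x ⊆ uIcc 0 x := by
      rw [uIcc_of_le hx, uIcc_of_le (hR.trans hx)]; exact Icc_subset_Icc_left hR
    rw [← intervalIntegral.integral_add_adjacent_intervals (hi.mono_set hs1) (hi.mono_set hs2), m0,
      zero_add, intervalIntegral.integral_of_le hx]
    refine (setIntegral_congr_fun (g := fun _ => (0 : ℂ)) measurableSet_Ioc fun t ht => ?_).trans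
      (by simp)
    exact hk0 t ht.1
  refine ⟨_, _, hs, by simp, by simp, fun x hx => ?_, h1⟩
  have hi := hs.intervalIntegrable_one (hR.trans hx)
  have hs1 : uIcc 0 R ⊆ uIcc 0 x := by
    rw [uIcc_of_le hR, uIcc_of_le (hR.trans hx)]; exact Icc_subset_Icc_right hx
  have hs2 : uIcc R x ⊆ uIcc 0 x := by
    rw [uIcc_of_le hx, uIcc_of_le (hR.trans hx)]; exact Icc_subset_Icc_left hR
  have hid : ∀ x ∈ Icc 0 R, ((x : ℝ) : ℂ) = ((0 : ℝ) : ℂ) + ∫ _ in (0 : ℝ)..x, (1 : ℂ) := by simp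
  have hp := integral_deriv_mul_add_of_primitive (v := fun x => (x : ℂ)) hR
    (hs.intervalIntegrable_two hR) intervalIntegrable_const (fun x hx => hs.eq_integral_one x hx.1)
    hid
  rw [intervalIntegral.integral_add ((hs.intervalIntegrable_two hR).mul_continuousOn
    Complex.continuous_ofReal.continuousOn) ((hs.intervalIntegrable_one hR).mul_continuousOn
    continuousOn_const), m1, h1 R le_rfl] at hp
  simp only [mul_one, zero_add, zero_mul, Complex.ofReal_zero, mul_zero, sub_zero] at hp
  rw [← intervalIntegral.integral_add_adjacent_intervals (hi.mono_set hs1) (hi.mono_set hs2), hp,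
    zero_add, intervalIntegral.integral_of_le hx]
  refine (setIntegral_congr_fun (g := fun _ => (0 : ℂ)) measurableSet_Ioc fun t ht => ?_).trans
    (by simp)
  exact h1 t ht.1.le

/-- A function on `(0, R)` that annihilates all the square-integrable functions orthogonal to `1`
and `x` is affine. -/
theorem exists_affine_of_forall_moments {h : ℝ → ℂ} {R : ℝ} (hR : 0 < R)
    (hh : MemLp h 2 (volume.restrict (Ioc 0 R)))
    (H : ∀ k : ℝ → ℂ, MemLp k 2 (volume.restrict (Ioc 0 R)) → (∀ x, R < x → k x = 0) →
      ∫ x in (0 : ℝ)..R, k x = 0 → ∫ x in (0 : ℝ)..R, k x * (x : ℂ) = 0 →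
      ∫ x in (0 : ℝ)..R, star (k x) * h x = 0) :
    ∃ a b : ℂ, ∀ᵐ x ∂volume.restrict (Ioc 0 R), h x = a + b * x := by
  have hRC : (R : ℂ) ≠ 0 := by exact_mod_cast hR.ne'
  have hfin : IsFiniteMeasure (volume.restrict (Ioc 0 R)) := inferInstance
  have hi : IntervalIntegrable h volume 0 R :=
    (intervalIntegrable_iff_integrableOn_Ioc_of_le hR.le).2 (hh.integrable (by norm_num))
  have cid : Continuous fun x : ℝ => (x : ℂ) := Complex.continuous_ofReal
  have hi1 : IntervalIntegrable (fun x => h x * (x : ℂ)) volume 0 R :=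
    hi.mul_continuousOn cid.continuousOn
  set m0 := ∫ x in (0 : ℝ)..R, h x
  set m1 := ∫ x in (0 : ℝ)..R, h x * (x : ℂ)
  -- the affine function with the same moments of order `0` and `1` on `(0, R)`
  set a := 4 * m0 / R - 6 * m1 / R ^ 2 with ha
  set b := 12 * m1 / R ^ 3 - 6 * m0 / R ^ 2 with hb
  refine ⟨a, b, ?_⟩
  have caff : Continuous fun x : ℝ => a + b * (x : ℂ) := by fun_prop
  have hκ : MemLp (fun x => h x - (a + b * x)) 2 (volume.restrict (Ioc 0 R)) :=
    hh.sub caff.continuousOn.memLp_Ioc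
  set k : ℝ → ℂ := (Ioc 0 R).indicator fun x => h x - (a + b * x) with hk
  have hkκ : ∀ x ∈ Ioc 0 R, k x = h x - (a + b * x) := fun x hx => indicator_of_mem hx _
  have hkm : MemLp k 2 (volume.restrict (Ioc 0 R)) := by
    refine (memLp_congr_ae ?_).1 hκ
    filter_upwards [ae_restrict_mem measurableSet_Ioc] with x hx using (hkκ x hx).symm
  have icongr : ∀ {u v : ℝ → ℂ}, (∀ x ∈ Ioc 0 R, u x = v x) →
      ∫ x in (0 : ℝ)..R, u x = ∫ x in (0 : ℝ)..R, v x := fun {u v} huv => by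
    rw [intervalIntegral.integral_of_le hR.le, intervalIntegral.integral_of_le hR.le]
    exact setIntegral_congr_fun measurableSet_Ioc huv
  have ii : ∀ u : ℝ → ℂ, Continuous u → IntervalIntegrable u volume 0 R :=
    fun u hu => hu.intervalIntegrable _ _
  have p1 : ∫ x in (0 : ℝ)..R, (x : ℂ) = R ^ 2 / 2 := by
    rw [intervalIntegral.integral_ofReal, integral_id]; push_cast; ring
  have p2 : ∫ x in (0 : ℝ)..R, (x : ℂ) ^ 2 = R ^ 3 / 3 := by
    have : ∀ x : ℝ, (x : ℂ) ^ 2 = ((x ^ 2 : ℝ) : ℂ) := fun x => by push_cast; rfl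
    simp_rw [this]
    rw [intervalIntegral.integral_ofReal, integral_pow]
    push_cast
    norm_num
  have km0 : ∫ x in (0 : ℝ)..R, k x = 0 := by
    rw [icongr hkκ, intervalIntegral.integral_sub hi (ii _ caff),
      intervalIntegral.integral_add (ii _ (by fun_prop)) (ii _ (by fun_prop)),
      intervalIntegral.integral_const_mul, p1, intervalIntegral.integral_const]
    change m0 - _ = 0
    rw [ha, hb, sub_zero, Complex.real_smul]
    field_simp
    ring
  have km1 : ∫ x in (0 : ℝ)..R, k x * (x : ℂ) = 0 := by
    have e : ∀ x ∈ Ioc 0 R, k x * (x : ℂ) = h x * x - (a * x + b * x ^ 2) := fun x hx => by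
      rw [hkκ x hx]; ring
    rw [icongr e, intervalIntegral.integral_sub hi1 (ii _ (by fun_prop)),
      intervalIntegral.integral_add (ii _ (by fun_prop)) (ii _ (by fun_prop)),
      intervalIntegral.integral_const_mul, intervalIntegral.integral_const_mul, p1, p2]
    change m1 - _ = 0
    rw [ha, hb]
    field_simp
    ring
  have hH := H k hkm (fun x hx => indicator_of_notMem (fun h => h.2.not_gt hx) _) km0 km1
  have hki : IntervalIntegrable k volume 0 R :=
    (intervalIntegrable_iff_integrableOn_Ioc_of_le hR.le).2 (hkm.integrable (by norm_num))
  have hkh : IntervalIntegrable (fun x => star (k x) * h x) volume 0 R :=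
    (intervalIntegrable_iff_integrableOn_Ioc_of_le hR.le).2 (hkm.star.integrable_mul hh)
  have hks : IntervalIntegrable (fun x => star (k x)) volume 0 R :=
    (intervalIntegrable_iff_integrableOn_Ioc_of_le hR.le).2 (hkm.star.integrable (by norm_num))
  have istar : ∀ u : ℝ → ℂ, ∫ x in (0 : ℝ)..R, star (u x) = star (∫ x in (0 : ℝ)..R, u x) :=
    fun u => by
      rw [intervalIntegral.integral_of_le hR.le, intervalIntegral.integral_of_le hR.le]
      exact integral_conj
  have hkk : ∫ x in (0 : ℝ)..R, star (k x) * k x = 0 := by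
    have e : ∀ x ∈ Ioc 0 R, star (k x) * k x =
        star (k x) * h x - (a * star (k x) + b * star (k x * (x : ℂ))) := fun x hx => by
      rw [star_mul']
      simp only [Complex.star_def, Complex.conj_ofReal]
      nth_rewrite 2 [hkκ x hx]
      ring
    have hkx : IntervalIntegrable (fun x => star (k x * (x : ℂ))) volume 0 R := by
      simp only [star_mul']
      exact hks.mul_continuousOn (cid.star.continuousOn)
    rw [icongr e, intervalIntegral.integral_sub hkh ((hks.const_mul a).add (hkx.const_mul b)),
      intervalIntegral.integral_add (hks.const_mul a) (hkx.const_mul b),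
      intervalIntegral.integral_const_mul, intervalIntegral.integral_const_mul, istar, istar,
      hH, km0, km1]
    simp
  have hnn : ∫ x in Ioc 0 R, ‖k x‖ ^ 2 = 0 := by
    have e : ∀ x, star (k x) * k x = ((‖k x‖ ^ 2 : ℝ) : ℂ) := fun x => by
      rw [Complex.star_def, Complex.conj_mul']
      push_cast
      rfl
    simp_rw [e] at hkk
    rw [intervalIntegral.integral_ofReal, intervalIntegral.integral_of_le hR.le] at hkk
    exact_mod_cast hkk
  have hz := (setIntegral_eq_zero_iff_of_nonneg_ae (Eventually.of_forall fun x => by positivity)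
    ((memLp_two_iff_integrable_sq_norm hkm.1).1 hkm)).1 hnn
  filter_upwards [hz, ae_restrict_mem measurableSet_Ioc] with x hx hxm
  have : k x = 0 := by simpa using hx
  rw [hkκ x hxm] at this
  exact sub_eq_zero.1 this

/-- Two affine functions that agree almost everywhere on `(0, 1]` have the same coefficients. -/
theorem affine_coeff_eq {a b a' b' : ℂ}
    (h : ∀ᵐ x : ℝ ∂volume.restrict (Ioc (0 : ℝ) 1), a + b * (x : ℂ) = a' + b' * (x : ℂ)) :
    a = a' ∧ b = b' := by
  have hE := Measure.eqOn_of_ae_eq h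
    (show Continuous fun x : ℝ => a + b * (x : ℂ) by fun_prop).continuousOn
    (show Continuous fun x : ℝ => a' + b' * (x : ℂ) by fun_prop).continuousOn
    (by simp [closure_Ioo, Ioc_subset_Icc_self])
  have h1 := hE (show (1 : ℝ) ∈ Ioc (0 : ℝ) 1 by norm_num)
  have h2 := hE (show (1 / 2 : ℝ) ∈ Ioc (0 : ℝ) 1 by norm_num)
  push_cast at h1 h2
  constructor
  · linear_combination -h1 + 2 * h2
  · linear_combination 2 * h1 - 2 * h2

/-- Regularity: an element of the domain of the adjoint is a Sobolev function. -/
theorem exists_maximalPair_of_mem_adjoint (hq : Continuous q) {y w : HalfLineL2}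
    (H : ∀ a b, (a, b) ∈ sturmLiouvilleGraph q → inner ℂ b y = inner ℂ a w) :
    ∃ g g₁ g₂, MaximalPair q y w g g₁ g₂ := by
  have cq : Continuous fun x => (q x : ℂ) := by fun_prop
  have hyL : ∀ R : ℝ, MemLp y 2 (volume.restrict (Ioc 0 R)) := fun R =>
    (Lp.memLp y).mono_measure (Measure.restrict_mono Ioc_subset_Ioi_self le_rfl)
  have hwL : ∀ R : ℝ, MemLp w 2 (volume.restrict (Ioc 0 R)) := fun R =>
    (Lp.memLp w).mono_measure (Measure.restrict_mono Ioc_subset_Ioi_self le_rfl)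
  set g₂ : ℝ → ℂ := fun x => q x * y x - w x with hg₂
  have hg₂L : ∀ R : ℝ, MemLp g₂ 2 (volume.restrict (Ioc 0 R)) := by
    intro R
    refine MemLp.sub ?_ (hwL R)
    obtain ⟨C, hC⟩ := (isCompact_Icc (a := 0) (b := R)).exists_bound_of_continuousOn cq.continuousOn
    refine (hyL R).of_le_mul (c := C) (cq.aestronglyMeasurable.mul (hyL R).1) ?_
    filter_upwards [ae_restrict_mem measurableSet_Ioc] with x hx
    rw [norm_mul]
    exact mul_le_mul_of_nonneg_right (hC x (Ioc_subset_Icc_self hx)) (norm_nonneg _)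
  -- a particular second primitive of `q y - w`
  set G₁ : ℝ → ℂ := fun x => ∫ t in (0 : ℝ)..x, g₂ t
  set G : ℝ → ℂ := fun x => ∫ t in (0 : ℝ)..x, G₁ t
  have hG : IsSobolevTwoLoc G G₁ g₂ :=
    ⟨fun R => (hg₂L R).mono_measure (Measure.restrict_mono Ioo_subset_Ioc_self le_rfl),
      by simp [G₁], by simp [G]⟩
  have key : ∀ R : ℝ, 0 < R → ∃ a b : ℂ,
      ∀ᵐ x ∂volume.restrict (Ioc 0 R), y x - G x = a + b * x := by
    intro R hR
    have hGc := hG.continuousOn_zero R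
    refine exists_affine_of_forall_moments hR ((hyL R).sub hGc.memLp_Ioc) ?_
    intro k hk hk0 m0 m1
    obtain ⟨f, f₁, hf, f0, f10, fR, f1R⟩ := exists_sobolev_of_moments hR.le hk hk0 m0 m1
    have hfc := hf.continuousOn_zero R
    have hfL : MemLp f 2 (volume.restrict (Ioi (0 : ℝ))) :=
      memLp_of_continuousOn hfc fun x hx => fR x hx.le
    have hLf : MemLp (fun x => -k x + q x * f x) 2 (volume.restrict (Ioi (0 : ℝ))) := by
      refine MemLp.add (memLp_of_memLp_Ioc hk0 hk).neg ?_
      exact memLp_of_continuousOn (cq.continuousOn.mul hfc) fun x hx => by simp [fR x hx.le]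
    have hin := H _ _ (mem_sturmLiouvilleGraph_iff.2
      ⟨f, f₁, k, ⟨hf, coeFn_halfLineClass hfL, coeFn_halfLineClass hLf⟩, f0, f10⟩)
    rw [inner_eq_integral (coeFn_halfLineClass hLf) (ae_eq_refl _),
      inner_eq_integral (coeFn_halfLineClass hfL) (ae_eq_refl _),
      integral_Ioi_eq_intervalIntegral hR.le, integral_Ioi_eq_intervalIntegral hR.le] at hin
    rotate_left
    · exact Eventually.of_forall fun x hx => by simp [fR x hx.le]
    · exact Eventually.of_forall fun x hx => by simp [hk0 x hx, fR x hx.le]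
    have hgr := hf.star.green hG hR.le
    simp only [fR R le_rfl, f1R R le_rfl, f0, f10, star_zero, zero_mul, sub_zero] at hgr
    have hint : ∀ u v : ℝ → ℂ, MemLp u 2 (volume.restrict (Ioc 0 R)) →
        MemLp v 2 (volume.restrict (Ioc 0 R)) →
        IntervalIntegrable (fun x => star (u x) * v x) volume 0 R := fun u v hu hv =>
      (intervalIntegrable_iff_integrableOn_Ioc_of_le hR.le).2 (hu.star.integrable_mul hv)
    rw [intervalIntegral.integral_sub (hint k G hk hGc.memLp_Ioc)
      (hint f g₂ hfc.memLp_Ioc (hg₂L R))] at hgr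
    have e1 : ∀ x, star (k x) * (y x - G x) =
        star (k x) * y x - star (k x) * G x := fun x => by ring
    have e2 : ∀ x, star (-k x + q x * f x) * y x =
        star (f x) * g₂ x + star (f x) * w x - star (k x) * y x := fun x => by
      simp only [hg₂, star_add, star_neg, star_mul', Complex.star_def, Complex.conj_ofReal]
      ring
    simp_rw [e2] at hin
    rw [intervalIntegral.integral_sub ((hint f g₂ hfc.memLp_Ioc (hg₂L R)).add
      (hint f w hfc.memLp_Ioc (hwL R))) (hint k y hk (hyL R)), intervalIntegral.integral_add
      (hint f g₂ hfc.memLp_Ioc (hg₂L R)) (hint f w hfc.memLp_Ioc (hwL R))] at hin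
    simp_rw [e1]
    rw [intervalIntegral.integral_sub (hint k y hk (hyL R)) (hint k G hk hGc.memLp_Ioc)]
    linear_combination -hin - hgr
  choose a b hab using fun n : ℕ => key (n + 1) (by positivity)
  have hcoef : ∀ n, a n = a 0 ∧ b n = b 0 := by
    intro n
    have h0 := hab 0
    rw [Nat.cast_zero, zero_add] at h0
    refine affine_coeff_eq ?_
    have hn := ae_restrict_of_ae_restrict_of_subset (s := Ioc (0 : ℝ) 1)
      (Ioc_subset_Ioc_right (by simp)) (hab n)
    filter_upwards [h0, hn] with x hx hx' using hx'.symm.trans hx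
  have hae : y =ᵐ[volume.restrict (Ioi (0 : ℝ))] fun x => G x + (a 0 + b 0 * x) := by
    have hall := ae_all_iff.2 fun n => (ae_restrict_iff' measurableSet_Ioc).1 (hab n)
    refine (ae_restrict_iff' measurableSet_Ioi).2 ?_
    filter_upwards [hall] with x hx hx0
    obtain ⟨n, hn⟩ := exists_nat_gt x
    have := hx n ⟨hx0, by linarith⟩
    rw [(hcoef n).1, (hcoef n).2] at this
    rw [← this]
    ring
  refine ⟨fun x => G x + (a 0 + b 0 * x), fun x => G₁ x + b 0, g₂, ⟨hG.memLp, fun x hx => ?_,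
    fun x hx => ?_⟩, hae, ?_⟩
  · simp [G₁]; ring
  · rw [intervalIntegral.integral_add (hG.intervalIntegrable_one hx) intervalIntegrable_const]
    simp [G, G₁]
    ring
  · filter_upwards [hae] with x hx
    simp only [hg₂]
    rw [hx]
    ring

/-- The adjoint of `L₀` is the maximal operator. As `L₀` imposes no condition at infinity, that
there is no boundary term at infinity rests on the symmetry of `L₀`: subtracting a smooth function
with bounded support and the same Cauchy data turns an element of the maximal domain into an element
of the domain of `L₀`. -/
theorem mem_adjoint_iff_exists_maximalPair (hq : Continuous q)
    (hpos : IsPositiveDefinite (sturmLiouville q)) {y z : HalfLineL2} :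
    (y, z) ∈ (sturmLiouville q).adjoint.graph ↔ ∃ g g₁ g₂, MaximalPair q y z g g₁ g₂ := by
  rw [mem_sturmLiouville_adjoint_iff hq]
  refine ⟨exists_maximalPair_of_mem_adjoint hq, ?_⟩
  rintro ⟨g, g₁, g₂, h⟩ a b hab
  obtain ⟨A, B, hA, hB, hA1, hB1, A0, A0', B0, B0'⟩ := exists_contDiff_cauchy_data
  have dA := hA.differentiable (by simp)
  have dB := hB.differentiable (by simp)
  set f : ℝ → ℂ := fun x => g 0 * A x + g₁ 0 * B x with hf
  have hfs : ContDiff ℝ ∞ f := (contDiff_const.mul hA).add (contDiff_const.mul hB)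
  have hf1 : ∀ x, 1 < x → f x = 0 := fun x hx => by simp [hf, hA1 x hx.le, hB1 x hx.le]
  have hf0 : f 0 = g 0 := by simp [hf, A0, B0]
  have hf0' : deriv f 0 = g₁ 0 := by
    have := (((dA 0).hasDerivAt.const_mul (g 0)).add ((dB 0).hasDerivAt.const_mul (g₁ 0))).deriv
    rw [A0', B0', mul_zero, zero_add, mul_one] at this
    exact this
  have hm := MaximalPair.of_contDiff hq hfs hf1
  have h1 := inner_symm_of_mem hpos hab (mem_sturmLiouvilleGraph_iff.2 ⟨_, _, _, h.sub hm,
    by simp [hf0], by simp [hf0']⟩)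
  obtain ⟨u, u₁, u₂, hu, hu0, hu1⟩ := mem_sturmLiouvilleGraph_iff.1 hab
  have h2 := hu.inner_sub_inner hq hfs hf1
  simp only [hu0, hu1, star_zero, zero_mul, sub_zero] at h2
  rw [inner_sub_right, inner_sub_right] at h1
  linear_combination h1 + h2

end Adjoint

/-! ### The Friedrichs extension of the Sturm-Liouville operator -/

section FriedrichsDirichlet

variable {q : ℝ → ℝ}

/-- Smooth functions with support in `[0, 1]`, zero value and unit slope at `0` that tend to zero
uniformly, while their second derivatives stay bounded in the mean: the functions
`B ((n + 1) x) / (n + 1)`. -/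
theorem exists_seq_unit_slope : ∃ (ψ : ℕ → ℝ → ℂ) (C : ℝ), 0 ≤ C ∧ ∀ n, ContDiff ℝ ∞ (ψ n) ∧
    (∀ x, 1 ≤ x → ψ n x = 0) ∧ ψ n 0 = 0 ∧ deriv (ψ n) 0 = 1 ∧
    (∀ x, 0 ≤ x → ‖ψ n x‖ ≤ C / (n + 1)) ∧ ∫ x in (0 : ℝ)..1, ‖deriv (deriv (ψ n)) x‖ ≤ C := by
  obtain ⟨-, B, -, hB, -, hB1, -, -, B0, B0'⟩ := exists_contDiff_cauchy_data
  have dB := hB.differentiable (by simp)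
  have hB' : ContDiff ℝ ∞ (deriv B) := (contDiff_infty_iff_deriv.1 hB).2
  have dB' := hB'.differentiable (by simp)
  have cB'' : Continuous (deriv (deriv B)) := (contDiff_infty_iff_deriv.1 hB').2.continuous
  obtain ⟨C₀, hC₀⟩ := (isCompact_Icc (a := (0 : ℝ)) (b := 1)).exists_bound_of_continuousOn
    hB.continuous.continuousOn
  have hC₀' : ∀ x, 0 ≤ x → ‖B x‖ ≤ max C₀ 0 := by
    intro x hx
    rcases le_or_gt x 1 with h | h
    · exact (hC₀ x ⟨hx, h⟩).trans (le_max_left _ _)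
    · rw [hB1 x h.le, norm_zero]; exact le_max_right _ _
  have hB2 : ∀ x, 1 < x → deriv (deriv B) x = 0 := by
    intro x hx
    have : B =ᶠ[𝓝 x] fun _ => 0 := by
      filter_upwards [Ioi_mem_nhds hx] with s hs using hB1 s (le_of_lt hs)
    rw [this.deriv.deriv_eq]; simp
  set C₂ := ∫ x in (0 : ℝ)..1, ‖deriv (deriv B) x‖
  have hd : ∀ (l : ℝ), l ≠ 0 → deriv (fun x => (l : ℂ)⁻¹ * B (l * x)) = fun x => deriv B (l * x) := by
    intro l hl
    funext x
    rw [deriv_const_mul _ (by fun_prop), deriv_comp_mul_left, Complex.real_smul]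
    have : (l : ℂ) ≠ 0 := by exact_mod_cast hl
    field_simp
  have hd2 : ∀ (l : ℝ), deriv (fun x => deriv B (l * x)) = fun x => l • deriv (deriv B) (l * x) := by
    intro l
    funext x
    exact deriv_comp_mul_left l (deriv B) x
  refine ⟨fun n x => (((n + 1 : ℝ) : ℝ) : ℂ)⁻¹ * B ((n + 1 : ℝ) * x), max (max C₀ 0) C₂,
    (le_max_right C₀ 0).trans (le_max_left _ _), fun n => ?_⟩
  have hn : (0 : ℝ) < n + 1 := by positivity
  have hn1 : (1 : ℝ) ≤ n + 1 := by simp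
  refine ⟨contDiff_const.mul (hB.comp (contDiff_const.mul contDiff_id)), fun x hx => ?_, by simp [B0],
    ?_, fun x hx => ?_, ?_⟩
  · dsimp only
    rw [hB1 _ (by nlinarith), mul_zero]
  · rw [hd _ hn.ne']
    simp [B0']
  · rw [norm_mul, norm_inv, Complex.norm_real, Real.norm_of_nonneg hn.le, mul_comm,
      ← div_eq_mul_inv]
    gcongr
    exact (hC₀' _ (by positivity)).trans (le_max_left _ _)
  · rw [hd _ hn.ne', hd2]
    simp only [norm_smul, Real.norm_of_nonneg hn.le]
    rw [intervalIntegral.integral_const_mul,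
      intervalIntegral.mul_integral_comp_mul_left (f := fun x => ‖deriv (deriv B) x‖), mul_zero,
      mul_one, ← intervalIntegral.integral_add_adjacent_intervals (b := 1)
        (cB''.norm.intervalIntegrable _ _) (cB''.norm.intervalIntegrable _ _)]
    have : ∫ x in (1 : ℝ)..(n + 1), ‖deriv (deriv B) x‖ = 0 := by
      refine intervalIntegral.integral_zero_ae (Eventually.of_forall fun x hx => ?_)
      rw [uIoc_of_le hn1] at hx
      rw [hB2 x hx.1, norm_zero]
    rw [this, add_zero]
    exact le_max_right _ _

/-- The mixed energies of functions as in `exists_seq_unit_slope`: one factor is uniformly small and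
the other is bounded in the mean. -/
theorem norm_inner_slExpr_le (hq : Continuous q) {Q : ℝ} (hQ : ∀ x ∈ Icc (0 : ℝ) 1, |q x| ≤ Q)
    {f ψ : ℝ → ℂ} (hf : ContDiff ℝ ∞ f) (hψ : ContDiff ℝ ∞ ψ) (hf1 : ∀ x, 1 ≤ x → f x = 0)
    (hψ1 : ∀ x, 1 ≤ x → ψ x = 0) {ε C : ℝ} (hε : ∀ x, 0 ≤ x → ‖f x‖ ≤ ε)
    (hC : ∀ x, 0 ≤ x → ‖ψ x‖ ≤ C) (hC' : ∫ x in (0 : ℝ)..1, ‖deriv (deriv ψ) x‖ ≤ C) :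
    ‖inner ℂ (halfLineClass f) (halfLineClass (slExpr q ψ))‖ ≤ ε * (C + Q * C) := by
  have hε0 : 0 ≤ ε := (norm_nonneg _).trans (hε 0 le_rfl)
  have hQ0 : 0 ≤ Q := (abs_nonneg _).trans (hQ 0 (by simp))
  have mf := MaximalPair.of_contDiff hq hf fun x (hx : 1 < x) => hf1 x hx.le
  have mψ := MaximalPair.of_contDiff hq hψ fun x (hx : 1 < x) => hψ1 x hx.le
  have c2 : Continuous (deriv (deriv ψ)) :=
    (contDiff_infty_iff_deriv.1 (contDiff_infty_iff_deriv.1 hψ).2).2.continuous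
  rw [inner_eq_integral mf.ae_fst mψ.ae_snd, integral_Ioi_eq_intervalIntegral zero_le_one
    (Eventually.of_forall fun x hx => by simp [hf1 x hx.le])]
  have hb : ∀ x ∈ Icc (0 : ℝ) 1, ‖star (f x) * (-deriv (deriv ψ) x + q x * ψ x)‖ ≤
      ε * (‖deriv (deriv ψ) x‖ + Q * C) := by
    intro x hx
    rw [norm_mul, norm_star]
    refine mul_le_mul (hε x hx.1) ((norm_add_le _ _).trans ?_) (norm_nonneg _) hε0
    rw [norm_neg, norm_mul, Complex.norm_real, Real.norm_eq_abs]
    have := mul_le_mul (hQ x hx) (hC x hx.1) (norm_nonneg _) hQ0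
    linarith
  refine (intervalIntegral.norm_integral_le_of_norm_le zero_le_one
    (Eventually.of_forall fun x hx => hb x (Ioc_subset_Icc_self hx))
    ((c2.norm.add continuous_const).const_smul ε |>.intervalIntegrable _ _)).trans ?_
  rw [intervalIntegral.integral_const_mul, intervalIntegral.integral_add
    (c2.norm.intervalIntegrable _ _) intervalIntegrable_const]
  simp only [intervalIntegral.integral_const, sub_zero, one_smul]
  gcongr

/-- An element of the maximal domain with zero boundary value belongs to the Friedrichs extension:
it is approximated in the energy norm after subtracting functions as in `exists_seq_unit_slope`,
which remove its slope at `0`. -/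
theorem mem_friedrichsGraph_of_apply_zero (hq : Continuous q)
    (hpos : IsPositiveDefinite (sturmLiouville q)) {y z : HalfLineL2} {g g₁ g₂ : ℝ → ℂ}
    (h : MaximalPair q y z g g₁ g₂) (h0 : g 0 = 0) : (y, z) ∈ friedrichsGraph (sturmLiouville q) := by
  obtain ⟨ψ, C, hC0, hψ⟩ := exists_seq_unit_slope
  obtain ⟨Q, hQ⟩ := (isCompact_Icc (a := (0 : ℝ)) (b := 1)).exists_bound_of_continuousOn
    hq.continuousOn
  have hp := fun n => MaximalPair.of_contDiff hq (hψ n).1 fun x (hx : 1 < x) => (hψ n).2.1 x hx.le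
  set c := g₁ 0
  have hs : ∀ n, ∃ s : (sturmLiouville q).domain,
      (s : HalfLineL2) = y - c • halfLineClass (ψ n) ∧
      sturmLiouville q s = z - c • halfLineClass (slExpr q (ψ n)) := fun n =>
    exists_domain_of_mem (mem_sturmLiouvilleGraph_iff.2 ⟨_, _, _, h.sub ((hp n).smul c),
      by simp [h0, (hψ n).2.2.1], by simp [c, (hψ n).2.2.2.1]⟩)
  choose s hs hs' using hs
  have hlim : Tendsto (fun n : ℕ => C / ((n : ℝ) + 1)) atTop (𝓝 0) := by
    have := (tendsto_one_div_add_atTop_nhds_zero_nat (𝕜 := ℝ)).const_mul C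
    simpa only [mul_one_div, mul_zero] using this
  have hb : ∀ i j : ℕ, ‖inner ℂ (halfLineClass (ψ i)) (halfLineClass (slExpr q (ψ j)))‖ ≤
      C / (i + 1) * (C + Q * C) := by
    intro i j
    refine norm_inner_slExpr_le hq hQ (hψ i).1 (hψ j).1 (hψ i).2.1 (hψ j).2.1 (hψ i).2.2.2.2.1
      (fun x hx => ((hψ j).2.2.2.2.1 x hx).trans ?_) (hψ j).2.2.2.2.2
    exact div_le_self hC0 (by simp)
  refine ⟨(mem_adjoint_iff_exists_maximalPair hq hpos).2 ⟨g, g₁, g₂, h⟩, s, ?_, ?_⟩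
  · have h1 : Tendsto (fun n => halfLineClass (ψ n)) atTop (𝓝 0) := by
      refine squeeze_zero_norm (fun n => ?_) hlim
      have := norm_halfLineClass_le (f := ψ n) (C := C / (n + 1)) zero_le_one (by positivity)
        (fun x hx => (hψ n).2.1 x hx.le) fun x hx => (hψ n).2.2.2.2.1 x hx.1.le
      simpa using this
    simp_rw [hs]
    simpa using tendsto_const_nhds.sub (h1.const_smul c)
  · have hle : ∀ k : ℕ × ℕ, ‖inner ℂ ((s k.1 - s k.2 : (sturmLiouville q).domain) : HalfLineL2)
        (sturmLiouville q (s k.1 - s k.2))‖ ≤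
        ‖c‖ ^ 2 * (2 * (C + Q * C)) * (C / (k.1 + 1) + C / (k.2 + 1)) := by
      rintro ⟨m, n⟩
      have e1 : ((s m - s n : (sturmLiouville q).domain) : HalfLineL2) =
          c • (halfLineClass (ψ n) - halfLineClass (ψ m)) := by
        rw [Submodule.coe_sub, hs, hs, smul_sub]; abel
      have e2 : sturmLiouville q (s m - s n) =
          c • (halfLineClass (slExpr q (ψ n)) - halfLineClass (slExpr q (ψ m))) := by
        rw [LinearPMap.map_sub, hs', hs', smul_sub]; abel
      rw [e1, e2, inner_smul_left, inner_smul_right, ← mul_assoc, norm_mul, norm_mul,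
        RCLike.norm_conj, ← sq, mul_assoc]
      refine mul_le_mul_of_nonneg_left ?_ (by positivity)
      rw [inner_sub_left, inner_sub_right, inner_sub_right]
      refine (norm_sub_le _ _).trans ((add_le_add (norm_sub_le _ _) (norm_sub_le _ _)).trans ?_)
      have := hb n n
      have := hb n m
      have := hb m m
      have := hb m n
      dsimp only
      linarith
    refine squeeze_zero_norm hle ?_
    have h2 : Tendsto (fun k : ℕ × ℕ => C / ((k.1 : ℝ) + 1) + C / (k.2 + 1)) atTop (𝓝 (0 + 0)) := by
      rw [← prod_atTop_atTop_eq]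
      exact (hlim.comp tendsto_fst).add (hlim.comp tendsto_snd)
    simpa using h2.const_mul (‖c‖ ^ 2 * (2 * (C + Q * C)))

/-- The Friedrichs extension is the restriction of the maximal operator by the Dirichlet condition
at `0`. -/
theorem mem_friedrichsGraph_iff (hq : Continuous q)
    (hpos : IsPositiveDefinite (sturmLiouville q)) {y z : HalfLineL2} :
    (y, z) ∈ friedrichsGraph (sturmLiouville q) ↔
      ∃ g g₁ g₂, MaximalPair q y z g g₁ g₂ ∧ g 0 = 0 := by
  refine ⟨fun h => ?_, fun ⟨g, g₁, g₂, h, h0⟩ => mem_friedrichsGraph_of_apply_zero hq hpos h h0⟩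
  obtain ⟨g, g₁, g₂, hg⟩ := (mem_adjoint_iff_exists_maximalPair hq hpos).1 h.1
  refine ⟨g, g₁, g₂, hg, ?_⟩
  obtain ⟨-, B, -, hB, -, hB1, -, -, B0, B0'⟩ := exists_contDiff_cauchy_data
  have hB1' : ∀ x, 1 < x → B x = 0 := fun x hx => hB1 x hx.le
  have h1 := inner_eq_of_mem_friedrichsGraph (dense_sturmLiouville_domain hq) hpos h
    (mem_friedrichsGraph_of_apply_zero hq hpos (MaximalPair.of_contDiff hq hB hB1') B0)
  have h2 := hg.inner_sub_inner hq hB hB1'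
  rw [h1, sub_self, B0, B0', mul_zero, mul_one, zero_sub, eq_comm, neg_eq_zero, star_eq_zero] at h2
  exact h2

end FriedrichsDirichlet

/-! ### The defect space and the boundary operator -/

section Defect

variable {q : ℝ → ℝ}

theorem eq_zero_of_maximalPair_zero (hq : Continuous q)
    (hpos : IsPositiveDefinite (sturmLiouville q)) {y : HalfLineL2} {g g₁ g₂ : ℝ → ℂ}
    (h : MaximalPair q y 0 g g₁ g₂) (h0 : g 0 = 0) : y = 0 := by
  obtain ⟨κ, hκ, hle⟩ := exists_le_inner_of_mem_friedrichsGraph (dense_sturmLiouville_domain hq) hpos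
  have := hle (mem_friedrichsGraph_of_apply_zero hq hpos h h0)
  rw [inner_zero_right, Complex.zero_re] at this
  have h2 : ‖y‖ ^ 2 ≤ 0 := by nlinarith
  exact norm_eq_zero.1 (pow_eq_zero_iff two_ne_zero |>.1 (le_antisymm h2 (sq_nonneg _)))

/-- The range of the symmetric operator `L₀` is closed in the following sense: if `L₀ xₙ → w`, then
`w` is the value of the maximal operator on the limit of `xₙ`, which vanishes at `0`. -/
theorem exists_maximalPair_of_mem_closure_range (hq : Continuous q)
    (hpos : IsPositiveDefinite (sturmLiouville q)) {w : HalfLineL2}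
    (hw : w ∈ closure (range (sturmLiouville q))) :
    ∃ y g g₁ g₂, MaximalPair q y w g g₁ g₂ ∧ g 0 = 0 := by
  have hd := dense_sturmLiouville_domain hq
  obtain ⟨v, hv, hlim⟩ := mem_closure_iff_seq_limit.1 hw
  choose x hx using hv
  obtain ⟨κ, hκ, hle⟩ := id hpos
  have hnorm : ∀ u : (sturmLiouville q).domain, ‖(u : HalfLineL2)‖ ≤ κ⁻¹ * ‖sturmLiouville q u‖ := by
    intro u
    have h1 := (hle u).2.trans ((Complex.re_le_norm _).trans (norm_inner_le_norm _ _))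
    rcases (norm_nonneg (u : HalfLineL2)).eq_or_lt with h0 | h0
    · rw [← h0]; positivity
    · rw [le_inv_mul_iff₀ hκ]
      nlinarith
  have hvC : CauchySeq v := hlim.cauchySeq
  have hxC : CauchySeq fun n => (x n : HalfLineL2) := by
    rw [Metric.cauchySeq_iff] at hvC ⊢
    intro ε hε
    obtain ⟨N, hN⟩ := hvC (κ * ε) (by positivity)
    refine ⟨N, fun m hm n hn => ?_⟩
    have h1 := hN m hm n hn
    have h2 := hnorm (x m - x n)
    rw [LinearPMap.map_sub, hx, hx, Submodule.coe_sub, ← dist_eq_norm, ← dist_eq_norm] at h2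
    refine h2.trans_lt ?_
    rw [inv_mul_lt_iff₀ hκ]
    exact h1
  obtain ⟨y, hy⟩ := cauchySeq_tendsto_of_complete hxC
  have hadj : (y, w) ∈ (sturmLiouville q).adjoint.graph := by
    rw [mem_adjoint_graph_iff hd]
    intro u
    refine tendsto_nhds_unique (tendsto_const_nhds.inner hy) ?_
    refine (tendsto_const_nhds.inner hlim).congr fun n => ?_
    rw [← hx, hpos.inner_symm]
  obtain ⟨g, g₁, g₂, hg⟩ := (mem_adjoint_iff_exists_maximalPair hq hpos).1 hadj
  refine ⟨y, g, g₁, g₂, hg, ?_⟩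
  -- the boundary value is a continuous functional of the pair, by Green's formula
  obtain ⟨-, B, -, hB, -, hB1, -, -, B0, B0'⟩ := exists_contDiff_cauchy_data
  have hB1' : ∀ x, 1 < x → B x = 0 := fun x hx => hB1 x hx.le
  have h1 : ∀ n, inner ℂ (v n) (halfLineClass B) -
      inner ℂ (x n : HalfLineL2) (halfLineClass (slExpr q B)) = 0 := by
    intro n
    obtain ⟨u, u₁, u₂, hu, hu0, hu1⟩ := mem_sturmLiouvilleGraph_iff.1 (mem_graph_of_domain (x n))
    have := hu.inner_sub_inner hq hB hB1'
    rw [hx, hu0, hu1] at this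
    simpa using this
  have h2 := tendsto_nhds_unique ((hlim.inner tendsto_const_nhds).sub (hy.inner tendsto_const_nhds))
    (tendsto_const_nhds.congr fun n => (h1 n).symm)
  have h3 := hg.inner_sub_inner hq hB hB1'
  rw [h2, B0, B0', mul_zero, mul_one, zero_sub, eq_comm, neg_eq_zero, star_eq_zero] at h3
  exact h3

/-- The homogeneous equation has a square-integrable solution with value `1` at `0`. Otherwise the
range of `L₀` would be dense, and a function with value `1` at `0` could be corrected to such a
solution by an element that vanishes at `0`. -/
theorem exists_defect_apply_zero_eq_one (hq : Continuous q)
    (hpos : IsPositiveDefinite (sturmLiouville q)) :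
    ∃ η g g₁ g₂, MaximalPair q η 0 g g₁ g₂ ∧ g 0 = 1 := by
  by_contra hcon
  have hd := dense_sturmLiouville_domain hq
  have hK : ∀ y, (y, (0 : HalfLineL2)) ∈ (sturmLiouville q).adjoint.graph → y = 0 := by
    intro y hy
    obtain ⟨g, g₁, g₂, hg⟩ := (mem_adjoint_iff_exists_maximalPair hq hpos).1 hy
    by_cases h0 : g 0 = 0
    · exact eq_zero_of_maximalPair_zero hq hpos hg h0
    · have := hg.smul (g 0)⁻¹
      rw [smul_zero] at this
      exact absurd ⟨_, _, _, _, this, by simp [h0]⟩ hcon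
  let W : Submodule ℂ HalfLineL2 := LinearMap.range (sturmLiouville q).toFun
  have hW : W.topologicalClosure = ⊤ := by
    rw [Submodule.topologicalClosure_eq_top_iff, Submodule.eq_bot_iff]
    intro y hy
    refine hK y ((mem_adjoint_graph_iff hd).2 fun x => ?_)
    rw [inner_zero_right]
    exact (Submodule.mem_orthogonal W y).1 hy _ ⟨x, rfl⟩
  obtain ⟨A, -, hA, -, hA1, -, A0, -⟩ := exists_contDiff_cauchy_data
  have hw : halfLineClass (slExpr q A) ∈ closure (range (sturmLiouville q)) := by
    have : halfLineClass (slExpr q A) ∈ W.topologicalClosure := by rw [hW]; trivial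
    exact this
  obtain ⟨y, g, g₁, g₂, hg, hg0⟩ := exists_maximalPair_of_mem_closure_range hq hpos hw
  have := (MaximalPair.of_contDiff hq hA fun x (hx : 1 < x) => hA1 x hx.le).sub hg
  rw [sub_self] at this
  exact hcon ⟨_, _, _, _, this, by simp [A0, hg0]⟩

variable {η : HalfLineL2} {e e₁ e₂ : ℝ → ℂ}

/-- The defect space is one-dimensional. -/
theorem mem_defectSpace_iff (hq : Continuous q) (hpos : IsPositiveDefinite (sturmLiouville q))
    (hη : MaximalPair q η 0 e e₁ e₂) (he : e 0 = 1) {k : HalfLineL2} :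
    k ∈ defectSpace (sturmLiouville q) ↔ ∃ c : ℂ, k = c • η := by
  have iff := mem_adjoint_iff_exists_maximalPair hq hpos (y := k) (z := 0)
  constructor
  · intro hk
    obtain ⟨g, g₁, g₂, hg⟩ := iff.1 hk
    refine ⟨g 0, sub_eq_zero.1 ?_⟩
    have := hg.sub (hη.smul (g 0))
    rw [smul_zero, sub_zero] at this
    exact eq_zero_of_maximalPair_zero hq hpos this (by simp [he])
  · rintro ⟨c, rfl⟩
    have := hη.smul c
    rw [smul_zero] at this
    exact iff.2 ⟨_, _, _, this⟩

/-- The boundary operator `Γ₁` is, up to sign, evaluation at `0`, the defect space being identified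
with `ℂ` by means of its element with value `1` at `0`. -/
theorem mem_gammaOneGraph_iff (hq : Continuous q) (hpos : IsPositiveDefinite (sturmLiouville q))
    (hη : MaximalPair q η 0 e e₁ e₂) (he : e 0 = 1) {y : HalfLineL2} {c : ℂ} :
    (y, c • η) ∈ gammaOneGraph (sturmLiouville q) ↔
      ∃ w g g₁ g₂, MaximalPair q y w g g₁ g₂ ∧ g 0 = -c := by
  have hc := hη.smul c
  rw [smul_zero] at hc
  constructor
  · rintro ⟨w, v, hyw, hvw, hh⟩
    obtain ⟨f, f₁, f₂, hf, hf0⟩ := (mem_friedrichsGraph_iff hq hpos).1 hvw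
    have h1 := hf.sub hc
    have e1 : v - c • η = y := by
      change c • η = v - y at hh
      rw [hh, sub_sub_cancel]
    rw [sub_zero, e1] at h1
    exact ⟨w, _, _, _, h1, by simp [hf0, he]⟩
  · rintro ⟨w, g, g₁, g₂, hg, h0⟩
    have h1 := hg.add hc
    rw [add_zero] at h1
    exact ⟨w, _, (mem_adjoint_iff_exists_maximalPair hq hpos).2 ⟨_, _, _, hg⟩,
      mem_friedrichsGraph_of_apply_zero hq hpos h1 (by simp [h0, he]), by simp⟩

end Defect

/-! ### Smooth functions of two variables as curves in `L₂(0, ∞)` -/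

section Curve

/-- The curve `t ↦ v(·, t)` in `L₂(0, ∞)`. -/
noncomputable def sliceCurve (v : ℝ × ℝ → ℂ) (t : ℝ) : HalfLineL2 :=
  halfLineClass fun x => v (x, t)

variable {v : ℝ × ℝ → ℂ} {δ : ℝ}

theorem coeFn_sliceCurve (hv : ContDiff ℝ ∞ v) (h0 : ∀ x t, t - x ≤ δ → v (x, t) = 0) (t : ℝ) :
    sliceCurve v t =ᵐ[volume.restrict (Ioi (0 : ℝ))] fun x => v (x, t) := by
  have hc := hv.continuous
  refine coeFn_halfLineClass (memLp_of_continuousOn (R := t - δ)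
    (by fun_prop : Continuous fun x => v (x, t)).continuousOn fun x hx => h0 x t (by linarith))

theorem partialSnd_eq_zero (hv : ContDiff ℝ ∞ v) (h0 : ∀ x t, t - x ≤ δ → v (x, t) = 0)
    (x t : ℝ) (h : t - x ≤ δ) : partialSnd v (x, t) = 0 := by
  have h1 : HasDerivWithinAt (fun s => v (x, s)) 0 (Iic t) t :=
    (hasDerivWithinAt_const t (Iic t) (0 : ℂ)).congr
      (fun s hs => h0 x s (by have : s ≤ t := hs; linarith)) (h0 x t h)
  exact (uniqueDiffOn_Iic t t self_mem_Iic).eq_deriv _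
    (hasDerivAt_partialSnd hv x t).hasDerivWithinAt h1

/-- Taylor's estimate in the second variable. -/
theorem norm_sub_sub_smul_partialSnd_le (hv : ContDiff ℝ ∞ v) {x t₀ M : ℝ}
    (hM : ∀ s ∈ Icc (t₀ - 1) (t₀ + 1), ‖partialSnd (partialSnd v) (x, s)‖ ≤ M) {t : ℝ}
    (ht : t ∈ Icc (t₀ - 1) (t₀ + 1)) :
    ‖v (x, t) - v (x, t₀) - (t - t₀) • partialSnd v (x, t₀)‖ ≤ M * |t - t₀| ^ 2 := by
  have ht₀ : t₀ ∈ Icc (t₀ - 1) (t₀ + 1) := ⟨by linarith, by linarith⟩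
  have hM0 : 0 ≤ M := (norm_nonneg _).trans (hM t₀ ht₀)
  have hsub : uIcc t₀ t ⊆ Icc (t₀ - 1) (t₀ + 1) := uIcc_subset_Icc ht₀ ht
  have h1 : ∀ s ∈ uIcc t₀ t, ‖partialSnd v (x, s) - partialSnd v (x, t₀)‖ ≤ M * |t - t₀| := by
    intro s hs
    have := (convex_uIcc t₀ t).norm_image_sub_le_of_norm_hasDerivWithin_le
      (fun r _ => (hasDerivAt_partialSnd (contDiff_partialSnd hv) x r).hasDerivWithinAt)
      (fun r hr => hM r (hsub hr)) left_mem_uIcc hs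
    refine this.trans (mul_le_mul_of_nonneg_left ?_ hM0)
    rw [Real.norm_eq_abs]
    exact abs_sub_left_of_mem_uIcc hs
  have h2 : ∀ s ∈ uIcc t₀ t, HasDerivWithinAt (fun s => v (x, s) - s • partialSnd v (x, t₀))
      (partialSnd v (x, s) - partialSnd v (x, t₀)) (uIcc t₀ t) s := fun s _ => by
    have := (hasDerivAt_partialSnd hv x s).sub ((hasDerivAt_id s).smul_const (partialSnd v (x, t₀)))
    rw [one_smul] at this
    exact this.hasDerivWithinAt
  have := (convex_uIcc t₀ t).norm_image_sub_le_of_norm_hasDerivWithin_le h2 h1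
    left_mem_uIcc right_mem_uIcc
  rw [Real.norm_eq_abs, mul_assoc, ← sq] at this
  refine le_trans (le_of_eq ?_) this
  congr 1
  rw [sub_smul]
  abel

theorem hasDerivAt_sliceCurve (hv : ContDiff ℝ ∞ v) (h0 : ∀ x t, t - x ≤ δ → v (x, t) = 0)
    (t₀ : ℝ) : HasDerivAt (sliceCurve v) (sliceCurve (partialSnd v) t₀) t₀ := by
  have h0' := partialSnd_eq_zero hv h0
  set R := max (t₀ + 1 - δ) 0
  have hR : 0 ≤ R := le_max_right _ _
  have c2 := (contDiff_partialSnd (contDiff_partialSnd hv)).continuous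
  obtain ⟨M, hM⟩ := (isCompact_Icc.prod isCompact_Icc : IsCompact (Icc 0 R ×ˢ
    Icc (t₀ - 1) (t₀ + 1))).exists_bound_of_continuousOn c2.continuousOn
  have hM0 : 0 ≤ M := (norm_nonneg _).trans (hM (0, t₀)
    ⟨⟨le_rfl, hR⟩, by dsimp only; linarith, by dsimp only; linarith⟩)
  rw [hasDerivAt_iff_isLittleO]
  have key : (fun t => sliceCurve v t - sliceCurve v t₀ -
      (t - t₀) • sliceCurve (partialSnd v) t₀) =O[𝓝 t₀] fun t => (t - t₀) ^ 2 := by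
    refine Asymptotics.IsBigO.of_bound (Real.sqrt R * M) ?_
    filter_upwards [Icc_mem_nhds (show t₀ - 1 < t₀ by linarith) (show t₀ < t₀ + 1 by linarith)]
      with t ht
    have e : sliceCurve v t - sliceCurve v t₀ - (t - t₀) • sliceCurve (partialSnd v) t₀ =
        halfLineClass fun x => v (x, t) - v (x, t₀) - (t - t₀) • partialSnd v (x, t₀) := by
      refine eq_halfLineClass ?_
      filter_upwards [Lp.coeFn_sub (sliceCurve v t - sliceCurve v t₀)
        ((t - t₀) • sliceCurve (partialSnd v) t₀), Lp.coeFn_sub (sliceCurve v t) (sliceCurve v t₀),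
        Lp.coeFn_smul (t - t₀) (sliceCurve (partialSnd v) t₀), coeFn_sliceCurve hv h0 t,
        coeFn_sliceCurve hv h0 t₀, coeFn_sliceCurve (contDiff_partialSnd hv) h0' t₀]
        with x e1 e2 e3 e4 e5 e6
      rw [e1, Pi.sub_apply, e2, Pi.sub_apply, e3, Pi.smul_apply, e4, e5, e6]
    rw [e, mul_assoc, norm_pow, Real.norm_eq_abs]
    refine norm_halfLineClass_le hR (by positivity) (fun x hx => ?_) fun x hx =>
      norm_sub_sub_smul_partialSnd_le hv (fun s hs => hM (x, s) ⟨Ioc_subset_Icc_self hx, hs⟩) ht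
    have hx' : t₀ + 1 - δ < x := (le_max_left _ _).trans_lt hx
    rw [h0 x t (by linarith [ht.2]), h0 x t₀ (by linarith), h0' x t₀ (by linarith)]
    simp
  refine key.trans_isLittleO ?_
  have h1 : Tendsto (fun t => t - t₀) (𝓝 t₀) (𝓝 0) := by
    have : Continuous fun t : ℝ => t - t₀ := by fun_prop
    simpa using this.tendsto t₀
  exact (Asymptotics.isLittleO_pow_id (𝕜 := ℝ) one_lt_two).comp_tendsto h1

theorem contDiff_sliceCurve (hv : ContDiff ℝ ∞ v) (h0 : ∀ x t, t - x ≤ δ → v (x, t) = 0) :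
    ContDiff ℝ ∞ (sliceCurve v) := by
  rw [contDiff_infty]
  intro n
  induction n generalizing v with
  | zero =>
    exact contDiff_zero.2 (continuous_iff_continuousAt.2 fun t =>
      (hasDerivAt_sliceCurve hv h0 t).continuousAt)
  | succ n ih =>
    have hd : deriv (sliceCurve v) = sliceCurve (partialSnd v) :=
      funext fun t => (hasDerivAt_sliceCurve hv h0 t).deriv
    push_cast
    rw [contDiff_succ_iff_deriv, hd]
    exact ⟨fun t => (hasDerivAt_sliceCurve hv h0 t).differentiableAt, by simp,
      ih (contDiff_partialSnd hv) (partialSnd_eq_zero hv h0)⟩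

theorem sliceCurve_zero (hδ : 0 ≤ δ) (h0 : ∀ x t, t - x ≤ δ → v (x, t) = 0) :
    sliceCurve v 0 = 0 := by
  have := norm_halfLineClass_le (f := fun x => v (x, 0)) (R := 0) (C := 0) le_rfl le_rfl
    (fun x hx => h0 x 0 (by linarith)) fun x hx => absurd (hx.1.trans_le hx.2) (lt_irrefl _)
  rw [mul_zero] at this
  exact norm_le_zero_iff.1 this

end Curve

/-! ### Conservation of energy -/

section Energy

variable {E : Type*} [NormedAddCommGroup E] [InnerProductSpace ℂ E]

/-- The derivative of a symmetric quadratic form along a curve, for `b = L a` with a symmetric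
operator `L`: no differentiability of `b` is needed. -/
theorem hasDerivAt_re_inner_of_symm {a b : ℝ → E} {a' : E} {t : ℝ}
    (ha : HasDerivAt a a' t) (hb : ContinuousAt b t)
    (hs : ∀ᶠ s in 𝓝 t, inner ℂ (b s) (a t) = inner ℂ (a s) (b t)) :
    HasDerivAt (fun s => (inner ℂ (a s) (b s)).re) (2 * (inner ℂ a' (b t)).re) t := by
  rw [hasDerivAt_iff_tendsto_slope] at ha ⊢
  have hb' : Tendsto b (𝓝[≠] t) (𝓝 (b t)) := hb.tendsto.mono_left nhdsWithin_le_nhds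
  have h1 := (Complex.continuous_re.tendsto _).comp (ha.inner (𝕜 := ℂ) (hb'.add_const (b t)))
  rw [← two_smul ℝ (b t), inner_smul_right_eq_smul, Complex.real_smul, Complex.re_ofReal_mul] at h1
  refine h1.congr' ?_
  filter_upwards [nhdsWithin_le_nhds hs] with s hs
  have e : (inner ℂ (a t) (b s)).re = (inner ℂ (a s) (b t)).re := by
    rw [← hs, ← inner_conj_symm, Complex.conj_re]
  simp only [Function.comp_apply, slope_def_module, smul_eq_mul]
  rw [inner_smul_left_eq_smul, Complex.real_smul, Complex.re_ofReal_mul, inner_sub_left,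
    inner_add_right, inner_add_right, Complex.sub_re, Complex.add_re, Complex.add_re, e]
  ring

/-- Uniqueness for the Cauchy problem `w'' + L w = 0` with a symmetric positive definite relation
`L`. -/
theorem eqOn_zero_of_energy {S : Set (E × E)} {κ : ℝ} (hκ : 0 < κ)
    (hS : ∀ {v w v' w' : E}, (v, w) ∈ S → (v', w') ∈ S → inner ℂ w v' = inner ℂ v w')
    (hle : ∀ {v w : E}, (v, w) ∈ S → κ * ‖v‖ ^ 2 ≤ (inner ℂ v w).re) {w : ℝ → E}
    (hw : ContDiffOn ℝ 2 w (Ici 0)) (h0 : w 0 = 0) (h0' : derivWithin w (Ici 0) 0 = 0)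
    (heq : ∀ t, 0 < t → (w t, -iteratedDerivWithin 2 w (Ici 0) t) ∈ S) :
    EqOn w 0 (Ici 0) := by
  have hU : UniqueDiffOn ℝ (Ici (0 : ℝ)) := uniqueDiffOn_Ici 0
  set w₁ := derivWithin w (Ici 0)
  set w₂ := iteratedDerivWithin 2 w (Ici 0)
  have hw₂ : w₂ = derivWithin w₁ (Ici 0) := by
    funext t
    simp only [w₂, w₁]
    rw [iteratedDerivWithin_succ, iteratedDerivWithin_one]
  have hw' : ContDiffOn ℝ 1 w₁ (Ici 0) := hw.derivWithin hU (by norm_num)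
  have c0 := hw.continuousOn
  have c1 := hw'.continuousOn
  have c2 : ContinuousOn w₂ (Ici 0) := by
    rw [hw₂]; exact hw'.continuousOn_derivWithin hU le_rfl
  have d0 : ∀ t, 0 < t → HasDerivAt w (w₁ t) t := fun t ht =>
    ((hw.differentiableOn (by norm_num) t ht.le).hasDerivWithinAt).hasDerivAt (Ici_mem_nhds ht)
  have d1 : ∀ t, 0 < t → HasDerivAt w₁ (w₂ t) t := fun t ht => by
    rw [hw₂]
    exact ((hw'.differentiableOn (by norm_num) t ht.le).hasDerivWithinAt).hasDerivAt
      (Ici_mem_nhds ht)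
  set En : ℝ → ℝ := fun t => (inner ℂ (w₁ t) (w₁ t)).re + (inner ℂ (w t) (-w₂ t)).re
  have hE : ∀ t, 0 < t → HasDerivAt En 0 t := by
    intro t ht
    have e1 := hasDerivAt_re_inner_of_symm (d1 t ht) (d1 t ht).continuousAt
      (Eventually.of_forall fun s => rfl)
    have e2 := hasDerivAt_re_inner_of_symm (b := fun t => -w₂ t) (d0 t ht)
      ((c2.continuousAt (Ici_mem_nhds ht)).neg)
      (by filter_upwards [Ioi_mem_nhds ht] with s hs using hS (heq s hs) (heq t ht))
    have e3 := e1.add e2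
    rw [inner_neg_right, Complex.neg_re, ← inner_conj_symm (w₂ t), Complex.conj_re] at e3
    exact e3.congr_deriv (by ring)
  have hEc : ContinuousOn En (Ici 0) :=
    (Complex.continuous_re.comp_continuousOn (c1.inner c1)).add
      (Complex.continuous_re.comp_continuousOn (c0.inner c2.neg))
  have hE0 : En 0 = 0 := by simp [En, h0, h0']
  intro t ht
  rcases (show (0 : ℝ) ≤ t from ht).eq_or_lt with rfl | ht
  · exact h0
  obtain ⟨c, hc, hc'⟩ := exists_hasDerivAt_eq_slope En (fun _ => 0) ht
    (hEc.mono Icc_subset_Ici_self) fun s hs => hE s hs.1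
  rw [hE0, sub_zero, sub_zero, eq_comm, div_eq_zero_iff, or_iff_left ht.ne'] at hc'
  have h1 := hle (heq t ht)
  have h2 : 0 ≤ (inner ℂ (w₁ t) (w₁ t)).re := inner_self_nonneg (𝕜 := ℂ)
  have h3 : ‖w t‖ ^ 2 ≤ 0 := by
    have : (inner ℂ (w₁ t) (w₁ t)).re + (inner ℂ (w t) (-w₂ t)).re = 0 := hc'
    nlinarith
  exact norm_eq_zero.1 (pow_eq_zero_iff two_ne_zero |>.1 (le_antisymm h3 (sq_nonneg _)))

/-- Classical solutions are unique: the difference of two solutions satisfies the homogeneous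
boundary condition, hence takes its values in the domain of the Friedrichs extension. -/
theorem IsClassicalSolution.unique [CompleteSpace E] {A : E →ₗ.[ℂ] E}
    (hd : Dense (A.domain : Set E)) (hA : IsPositiveDefinite A)
    (hsub : ∀ {p p' : E × E}, p ∈ friedrichsGraph A → p' ∈ friedrichsGraph A →
      p - p' ∈ friedrichsGraph A) {h u v : ℝ → E} (hv : IsClassicalSolution A h v)
    (hu : IsClassicalSolution A h u) : EqOn v u (Ici 0) := by
  obtain ⟨κ, hκ, hle⟩ := exists_le_inner_of_mem_friedrichsGraph hd hA
  have hU := uniqueDiffOn_Ici (0 : ℝ)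
  have hz := eqOn_zero_of_energy (w := v - u) hκ (inner_eq_of_mem_friedrichsGraph hd hA) hle
    (hv.contDiffOn.sub hu.contDiffOn) (by simp [hv.initial_value, hu.initial_value]) ?_ ?_
  · intro t ht
    exact sub_eq_zero.1 (hz ht)
  · rw [derivWithin_sub (hv.contDiffOn.differentiableOn (by norm_num) 0 self_mem_Ici)
      (hu.contDiffOn.differentiableOn (by norm_num) 0 self_mem_Ici), hv.initial_velocity,
      hu.initial_velocity, sub_zero]
  · intro t ht
    rw [iteratedDerivWithin_sub (mem_Ici.2 ht.le) hU (hv.contDiffOn t ht.le)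
      (hu.contDiffOn t ht.le)]
    obtain ⟨w, a, hw, ha, e1⟩ := hv.boundary t ht.le
    obtain ⟨w', a', hw', ha', e2⟩ := hu.boundary t ht.le
    have k1 := LinearPMap.mem_graph_snd_inj' _ hw (hv.equation t ht) rfl
    have k2 := LinearPMap.mem_graph_snd_inj' _ hw' (hu.equation t ht) rfl
    dsimp only at e1 e2 k1 k2
    have hs := hsub ha ha'
    rw [Prod.mk_sub_mk] at hs
    have ea : a - a' = v t - u t := by
      rw [e1, sub_eq_sub_iff_sub_eq_sub] at e2
      exact e2
    have ew : w - w' = -(iteratedDerivWithin 2 v (Ici 0) t - iteratedDerivWithin 2 u (Ici 0) t) := by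
      rw [k1, k2]; abel
    rwa [ea, ew] at hs

end Energy

/-! ### The boundary control system -/

section Control

variable {q : ℝ → ℝ} {η : HalfLineL2} {e e₁ e₂ : ℝ → ℂ}

theorem maximalPair_slice (hq : Continuous q) {u : ℝ × ℝ → ℂ} {δ : ℝ} (hu : IsDelayedWave q δ u)
    (t : ℝ) : ∃ f₁ f₂, MaximalPair q (sliceCurve u t) (-sliceCurve (partialSnd (partialSnd u)) t)
      (fun x => u (x, t)) f₁ f₂ := by
  have h2 := contDiff_partialSnd (contDiff_partialSnd hu.contDiff)
  have h0 := partialSnd_eq_zero (contDiff_partialSnd hu.contDiff)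
    (partialSnd_eq_zero hu.contDiff hu.eq_zero)
  have hs : ContDiff ℝ ∞ fun x => u (x, t) :=
    hu.contDiff.comp (contDiff_id.prodMk contDiff_const)
  have hm := MaximalPair.of_contDiff hq hs (R := t - δ)
    fun x hx => hu.eq_zero x t (by linarith)
  have e : halfLineClass (slExpr q fun x => u (x, t)) =
      -sliceCurve (partialSnd (partialSnd u)) t := by
    refine (eq_halfLineClass ?_).symm
    filter_upwards [Lp.coeFn_neg (sliceCurve (partialSnd (partialSnd u)) t),
      coeFn_sliceCurve h2 h0 t] with x e1 e2
    have d1 : deriv (fun x => u (x, t)) = fun x => partialFst u (x, t) :=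
      funext fun x => (hasDerivAt_partialFst hu.contDiff x t).deriv
    have d2 : deriv (fun x => partialFst u (x, t)) x = partialFst (partialFst u) (x, t) :=
      (hasDerivAt_partialFst (contDiff_partialFst hu.contDiff) x t).deriv
    rw [e1, Pi.neg_apply, e2, slExpr, d1, d2, hu.equation]
    ring
  rw [e] at hm
  exact ⟨_, _, hm⟩

/-- A smooth solution of the wave equation that starts at a positive time is a classical solution of
the control system, the control being given by its boundary values. -/
theorem IsDelayedWave.isClassicalSolution (hq : Continuous q)
    (hpos : IsPositiveDefinite (sturmLiouville q)) (hη : MaximalPair q η 0 e e₁ e₂) (he : e 0 = 1)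
    {u : ℝ × ℝ → ℂ} {δ : ℝ} (hδ : 0 ≤ δ) (hu : IsDelayedWave q δ u) {h : ℝ → HalfLineL2}
    (hh : ∀ t, 0 ≤ t → h t = (-u (0, t)) • η) :
    IsClassicalSolution (sturmLiouville q) h (sliceCurve u) := by
  have hc := contDiff_sliceCurve hu.contDiff hu.eq_zero
  have h2 : (2 : WithTop ℕ∞) ≤ ∞ := WithTop.coe_le_coe.2 le_top
  have hd1 : deriv (sliceCurve u) = sliceCurve (partialSnd u) :=
    funext fun t => (hasDerivAt_sliceCurve hu.contDiff hu.eq_zero t).deriv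
  have h0' := partialSnd_eq_zero hu.contDiff hu.eq_zero
  have hd2 : deriv (sliceCurve (partialSnd u)) = sliceCurve (partialSnd (partialSnd u)) :=
    funext fun t => (hasDerivAt_sliceCurve (contDiff_partialSnd hu.contDiff) h0' t).deriv
  refine ⟨(hc.of_le h2).contDiffOn, fun t ht => ?_, sliceCurve_zero hδ hu.eq_zero, ?_,
    fun t ht => ?_⟩
  · have e2 : iteratedDerivWithin 2 (sliceCurve u) (Ici 0) t =
        sliceCurve (partialSnd (partialSnd u)) t := by
      rw [iteratedDerivWithin_eq_iteratedDeriv (uniqueDiffOn_Ici 0) (hc.of_le h2).contDiffAt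
        (mem_Ici.2 ht.le), iteratedDeriv_succ, iteratedDeriv_one, hd1, hd2]
    obtain ⟨f₁, f₂, hm⟩ := maximalPair_slice hq hu t
    rw [← e2] at hm
    exact (mem_adjoint_iff_exists_maximalPair hq hpos).2 ⟨_, _, _, hm⟩
  · have e1 : derivWithin (sliceCurve u) (Ici 0) 0 = sliceCurve (partialSnd u) 0 :=
      (hasDerivAt_sliceCurve hu.contDiff hu.eq_zero 0).hasDerivWithinAt.derivWithin
        (uniqueDiffOn_Ici 0 0 self_mem_Ici)
    exact e1.trans (sliceCurve_zero hδ h0')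
  · obtain ⟨f₁, f₂, hm⟩ := maximalPair_slice hq hu t
    rw [hh t ht]
    exact (mem_gammaOneGraph_iff hq hpos hη he).2 ⟨_, _, _, _, hm, by simp⟩

theorem sub_mem_friedrichsGraph (hq : Continuous q) (hpos : IsPositiveDefinite (sturmLiouville q))
    {p p' : HalfLineL2 × HalfLineL2} (h : p ∈ friedrichsGraph (sturmLiouville q))
    (h' : p' ∈ friedrichsGraph (sturmLiouville q)) : p - p' ∈ friedrichsGraph (sturmLiouville q) := by
  obtain ⟨g, g₁, g₂, hg, hg0⟩ := (mem_friedrichsGraph_iff hq hpos).1 h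
  obtain ⟨g', g₁', g₂', hg', hg0'⟩ := (mem_friedrichsGraph_iff hq hpos).1 h'
  exact mem_friedrichsGraph_of_apply_zero hq hpos (hg.sub hg') (by simp [hg0, hg0'])

theorem sturmLiouville_classicalSolution_unique (hq : Continuous q)
    (hpos : IsPositiveDefinite (sturmLiouville q)) {h u v : ℝ → HalfLineL2}
    (hv : IsClassicalSolution (sturmLiouville q) h v)
    (hu : IsClassicalSolution (sturmLiouville q) h u) : EqOn v u (Ici 0) :=
  hv.unique (dense_sturmLiouville_domain hq) hpos (sub_mem_friedrichsGraph hq hpos) hu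

/-- A smooth control is a scalar smooth function that vanishes for small times, times the element of
the defect space with value `1` at `0`. -/
theorem exists_smooth_of_mem_smoothControls (hq : Continuous q)
    (hpos : IsPositiveDefinite (sturmLiouville q)) (hη : MaximalPair q η 0 e e₁ e₂) (he : e 0 = 1)
    {h : ℝ → HalfLineL2} (hh : h ∈ smoothControls (sturmLiouville q)) :
    ∃ (F : ℝ → ℂ) (δ : ℝ), 0 < δ ∧ ContDiff ℝ ∞ F ∧ (∀ t ≤ δ, F t = 0) ∧
      ∀ t, 0 ≤ t → h t = (-F t) • η := by
  obtain ⟨hs, hK, hsupp⟩ := hh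
  obtain ⟨ε, hε, hball⟩ := Metric.isOpen_iff.1 (isClosed_closure.isOpen_compl :
    IsOpen (halfLineSupport h)ᶜ) 0 fun h' => lt_irrefl _ (mem_Ioi.1 (hsupp h'))
  have hz : ∀ t, 0 ≤ t → t < ε → h t = 0 := by
    intro t ht htε
    by_contra hne
    exact hball (by rw [Metric.mem_ball, dist_zero_right, Real.norm_of_nonneg ht]; exact htε)
      (subset_closure ⟨ht, hne⟩)
  have hη0 : η ≠ 0 := by
    rintro rfl
    have := eqOn_Ici_of_ae_eq (hη.ae_fst.symm.trans (Lp.coeFn_zero _ _ _))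
      hη.sobolev.continuousOn_Ici continuousOn_const (self_mem_Ici (a := (0 : ℝ)))
    rw [he] at this
    exact one_ne_zero this
  have hηη : inner ℂ η η ≠ (0 : ℂ) := inner_self_ne_zero.2 hη0
  set f : ℝ → ℂ := fun t => -((inner ℂ η η)⁻¹ * inner ℂ η (h t)) with hf
  have hfs : ContDiffOn ℝ ∞ f (Ici 0) := by
    have : ContDiffOn ℝ ∞ (fun t => inner ℂ η (h t)) (Ici 0) :=
      ((innerSL ℂ η).restrictScalars ℝ).contDiff.comp_contDiffOn hs
    exact (contDiffOn_const.mul this).neg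
  have hfz : ∀ t, 0 ≤ t → t < ε → f t = 0 := fun t h1 h2 => by simp [hf, hz t h1 h2]
  refine ⟨(Ici 0).indicator f, ε / 2, by positivity, contDiff_iff_contDiffAt.2 fun t => ?_,
    fun t ht => ?_, fun t ht => ?_⟩
  · rcases lt_or_ge t ε with h1 | h1
    · have : (Ici 0).indicator f =ᶠ[𝓝 t] fun _ => 0 := by
        filter_upwards [Iio_mem_nhds h1] with s hs
        by_cases h2 : 0 ≤ s
        · rw [indicator_of_mem (mem_Ici.2 h2), hfz s h2 hs]
        · rw [indicator_of_notMem (by simpa using h2)]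
      exact contDiffAt_const.congr_of_eventuallyEq this
    · have h0 : 0 < t := hε.trans_le h1
      have : (Ici 0).indicator f =ᶠ[𝓝 t] f := by
        filter_upwards [Ioi_mem_nhds h0] with s hs using indicator_of_mem (mem_Ici.2 (le_of_lt hs)) f
      exact (hfs.contDiffAt (Ici_mem_nhds h0)).congr_of_eventuallyEq this
  · by_cases h2 : 0 ≤ t
    · rw [indicator_of_mem (mem_Ici.2 h2), hfz t h2 (by linarith)]
    · rw [indicator_of_notMem (by simpa using h2)]
  · rw [indicator_of_mem (mem_Ici.2 ht)]
    obtain ⟨c, hc⟩ := (mem_defectSpace_iff hq hpos hη he).1 (hK t ht)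
    simp only [hf]
    rw [hc, inner_smul_right, neg_neg]
    congr 1
    field_simp

theorem halfLineSupport_subset_Icc {F : Type*} [Zero F] {g : ℝ → F} {R : ℝ}
    (h : ∀ x, R < x → g x = 0) : halfLineSupport g ⊆ Icc 0 R :=
  closure_minimal (fun x hx => ⟨hx.1, not_lt.1 fun h' => hx.2 (h x h')⟩) isClosed_Icc

/-- Solutions exist, and are the slices of smooth waves. -/
theorem exists_isDelayedWave_of_mem_smoothControls {h : ℝ → HalfLineL2}
    (hq : ContDiff ℝ ∞ q) (hpos : IsPositiveDefinite (sturmLiouville q))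
    (hh : h ∈ smoothControls (sturmLiouville q)) : ∃ δ u, 0 < δ ∧ IsDelayedWave q δ u ∧
      IsClassicalSolution (sturmLiouville q) h (sliceCurve u) := by
  obtain ⟨η, e, e₁, e₂, hη, he⟩ := exists_defect_apply_zero_eq_one hq.continuous hpos
  obtain ⟨F, δ, hδ, hF, hF0, hhF⟩ :=
    exists_smooth_of_mem_smoothControls hq.continuous hpos hη he hh
  obtain ⟨u, hu, huF⟩ := exists_isDelayedWave_boundary hq hF hδ.le hF0
  exact ⟨δ, u, hδ, hu, hu.isClassicalSolution hq.continuous hpos hη he hδ.le fun t ht => by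
    rw [huF, hhF t ht]⟩

theorem wellPosed_sturmLiouville (hq : ContDiff ℝ ∞ q)
    (hpos : IsPositiveDefinite (sturmLiouville q)) : WellPosed (sturmLiouville q) := by
  intro h hh
  obtain ⟨δ, u, -, hu, hsol⟩ := exists_isDelayedWave_of_mem_smoothControls hq hpos hh
  exact ⟨_, (contDiff_sliceCurve hu.contDiff hu.eq_zero).contDiffOn, hsol,
    fun v hv => sturmLiouville_classicalSolution_unique hq.continuous hpos hv hsol⟩

theorem reachableSet_subset (hq : ContDiff ℝ ∞ q) (hpos : IsPositiveDefinite (sturmLiouville q))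
    {T : ℝ} (hT : 0 < T) : reachableSet (sturmLiouville q) T ⊆ smoothSupportedIn T := by
  rintro y ⟨h, hh, v, hv, rfl⟩
  obtain ⟨δ, u, hδ, hu, hsol⟩ := exists_isDelayedWave_of_mem_smoothControls hq hpos hh
  have hs : ContDiff ℝ ∞ fun x => u (x, T) :=
    hu.contDiff.comp (contDiff_id.prodMk contDiff_const)
  refine ⟨fun x => u (x, T), hs.contDiffOn, ?_, ?_⟩
  · refine (halfLineSupport_subset_Icc (R := T - δ) fun x hx =>
      hu.eq_zero x T (by linarith)).trans fun x hx => ⟨hx.1, by linarith [hx.2]⟩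
  · rw [sturmLiouville_classicalSolution_unique hq.continuous hpos hv hsol (mem_Ici.2 hT.le)]
    exact coeFn_sliceCurve hu.contDiff hu.eq_zero T

/-- A state is reached by the control that is the trace at `0` of the wave with this final state,
obtained by solving the wave equation sideways. -/
theorem subset_reachableSet (hq : ContDiff ℝ ∞ q) (hpos : IsPositiveDefinite (sturmLiouville q))
    {T : ℝ} (hT : 0 < T) : smoothSupportedIn T ⊆ reachableSet (sturmLiouville q) T := by
  rintro y ⟨g, hg, hsupp, hy⟩
  obtain ⟨G, hG, hGg⟩ := exists_contDiff_eqOn_Ici hg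
  obtain ⟨ε, hε, hball⟩ := Metric.isOpen_iff.1 (isClosed_closure.isOpen_compl :
    IsOpen (halfLineSupport g)ᶜ) T fun h' => lt_irrefl _ (hsupp h').2
  have hz : ∀ x, 0 ≤ x → T - ε < x → g x = 0 := by
    intro x hx hxε
    by_contra hne
    have hm : x ∈ halfLineSupport g := subset_closure ⟨hx, hne⟩
    refine hball ?_ hm
    rw [Metric.mem_ball, Real.dist_eq, abs_lt]
    constructor <;> linarith [(hsupp hm).2]
  set δ := min (ε / 2) T
  have hδ : 0 < δ := lt_min (by positivity) hT
  have hδε : δ ≤ ε / 2 := min_le_left _ _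
  have hG0 : ∀ x, T - δ ≤ x → G x = 0 := by
    intro x hx
    have hx0 : 0 ≤ x := by linarith [min_le_right (ε / 2) T]
    rw [hGg (mem_Ici.2 hx0), hz x hx0 (by linarith)]
  obtain ⟨u, hu, huG⟩ := exists_isDelayedWave_final hq hG hδ.le hG0
  obtain ⟨η, e, e₁, e₂, hη, he⟩ := exists_defect_apply_zero_eq_one hq.continuous hpos
  have hs : ContDiff ℝ ∞ fun t => u (0, t) :=
    hu.contDiff.comp (contDiff_const.prodMk contDiff_id)
  refine ⟨fun t => (-u (0, t)) • η, ⟨(hs.neg.smul contDiff_const).contDiffOn, fun t _ =>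
    (mem_defectSpace_iff hq.continuous hpos hη he).2 ⟨_, rfl⟩, ?_⟩, sliceCurve u,
    hu.isClassicalSolution hq.continuous hpos hη he hδ.le fun t _ => rfl, ?_⟩
  · refine (closure_minimal (fun t ht => ?_) isClosed_Ici).trans (Ici_subset_Ioi.2 hδ)
    by_contra hlt
    exact ht.2 (by simp [hu.eq_zero 0 t (by linarith [not_le.1 (mem_Ici.not.1 hlt)])])
  · refine Lp.ext ((coeFn_sliceCurve hu.contDiff hu.eq_zero T).trans (EventuallyEq.trans ?_ hy.symm))
    filter_upwards [ae_restrict_mem measurableSet_Ioi] with x hx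
    rw [huG, hGg (mem_Ici.2 (le_of_lt hx))]

theorem iUnion_smoothSupportedIn : ⋃ T ∈ Ioi (0 : ℝ), smoothSupportedIn T = smoothBoundedSupport := by
  ext y
  simp only [mem_iUnion]
  constructor
  · rintro ⟨T, -, g, hg, hsupp, hy⟩
    exact ⟨g, hg, (Metric.isBounded_Ico 0 T).subset hsupp, hy⟩
  · rintro ⟨g, hg, hb, hy⟩
    obtain ⟨R, hR⟩ := hb.bddAbove
    have h0 : halfLineSupport g ⊆ Ici 0 := closure_minimal (fun x hx => hx.1) isClosed_Ici
    exact ⟨max R 0 + 1, by simp; positivity, g, hg, fun x hx =>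
      ⟨h0 hx, (hR hx).trans_lt ((le_max_left R 0).trans_lt (lt_add_one _))⟩, hy⟩

theorem dense_smoothBoundedSupport : Dense smoothBoundedSupport := by
  refine dense_smooth_compactSupport.mono ?_
  rintro y ⟨f, hf, hfs, -, hy⟩
  obtain ⟨R, hR⟩ := eventually_gt_eq_zero_of_hasCompactSupport hfs
  exact ⟨f, hf.contDiffOn, (Metric.isBounded_Icc 0 R).subset (halfLineSupport_subset_Icc hR), hy⟩

end Control

theorem lemma1 (q : ℝ → ℝ) (hq_smooth : ContDiffOn ℝ ∞ q (Ici 0))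
    (hq_limit_point : IsLimitPointCase q)
    (hq_pos : IsPositiveDefinite (sturmLiouville q)) :
    WellPosed (sturmLiouville q) ∧
    (∀ T : ℝ, 0 < T → reachableSet (sturmLiouville q) T = smoothSupportedIn T) ∧
    totalReachableSet (sturmLiouville q) = smoothBoundedSupport ∧
    IsControllable (sturmLiouville q) := by
  -- only the values of `q` on the half-line matter, so `q` may be taken smooth on the whole line
  obtain ⟨p, hp, hpq⟩ := exists_contDiff_eqOn_Ici hq_smooth
  rw [← sturmLiouville_congr hpq] at hq_pos ⊢
  have hreach : ∀ T : ℝ, 0 < T → reachableSet (sturmLiouville p) T = smoothSupportedIn T :=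
    fun T hT => (reachableSet_subset hp hq_pos hT).antisymm (subset_reachableSet hp hq_pos hT)
  have htotal : totalReachableSet (sturmLiouville p) = smoothBoundedSupport := by
    rw [← iUnion_smoothSupportedIn]
    exact iUnion₂_congr hreach
  refine ⟨wellPosed_sturmLiouville hp hq_pos, hreach, htotal, ?_⟩
  rw [IsControllable, htotal]
  exact dense_smoothBoundedSupport.closure_eq
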